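/- Let $X=\{F=0\}\subset\mathbb P^5$ be a complex cubic fourfold containing a plane, which we take to be $P=\{x=y=z=0\}$ in homogeneous coordinates $(x:y:z:t_0:t_1:t_2)$. Write $F=\sum_{i\le j}a_{ij}t_it_j+\sum_i b_it_i+c$ with $a_{ij},b_i,c\in\mathbb C[x,y,z]$ homogeneous of degrees $1,2,3$, and let $$M=\begin{pmatrix}2a_{00}&a_{01}&a_{02}&b_0\\a_{01}&2a_{11}&a_{12}&b_1\\a_{02}&a_{12}&2a_{22}&b_2\\b_0&b_1&b_2&2c\end{pmatrix}$$ be the Gram matrix of the quadric surface bundle $\mathrm{Bl}_PX\to\mathbb P^2$ given by projection from $P$; its fibre over $y$ is a quadric $Q_y$. Let $D_6=\{\det M=0\}\subset\mathbb P^2$ be its discriminant sextic, and let $S=\{w^2=\det M\}\to\mathbb P^2$ be the double cover branched over $D_6$. Let $\alpha\colon\widetilde F\to S$ be the natural map from the relative Fano variety of lines of the quadric bundle, which sends a line in $Q_y$ to the point of $S$ over $y$ that corresponds to its ruling. For a hyperplane $H=\{h_0x+h_1y+h_2z+h_3t_0+h_4t_1+h_5t_2=0\}$ put $Y=X\cap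 H$ and $L=P\cap H$. Let $D_H=\{n^{T}\operatorname{adj}(M)\,n=0\}\subset\mathbb P^2$, where $n=(h_3,h_4,h_5,h_0x+h_1y+h_2z)$, be the discriminant quintic of the conic bundle $\mathrm{Bl}_LY\to\mathbb P^2$ with fibres $Q_y\cap H$. Let $C_H$ be the closure of the set of lines $L'\ne L$ in $Y$ that meet $L$; these lines lie in the quadrics $Q_y$, and $\overline C_H=\alpha(C_H)\subset S$ denotes the image of $C_H$. Let $\mathcal U_X$ be the set of hyperplanes $H$ such that $Y$ and $D_H$ are smooth and $D_6$ and $D_H$ intersect with multiplicity at most $2$ at every point. (a) For a general cubic $X$ containing $P$ (that is, for all $F$ in a nonempty Zariski open subset of the space of cubic forms vanishing on $P$), $X$ and $D_6$ are smooth and $\mathcal U_X$ contains a nonempty Zariski open set of hyperplanes. (b) For every cubic $X$ containing $P$ such that $X$ and $D_6$ are smooth, and for every $H\in\mathcal U_X$: 1. the curves $D_6$ and $D_H$ meet with multiplicity exactly $2$ at each of their intersection points; 2. $\overline C_H$ is a $15$-nodal curve on $S$, i.e. it is irreducible and has exactly $15$ singular points, all of which are ordinary double points; 3. each of these nodes lies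 over a point of $D_6\cap D_H$. -/

import Mathlib

open MvPolynomial

noncomputable section

namespace PlaneCubic

/-! ### Cubic fourfolds containing a plane

`ℙ⁵` has homogeneous coordinates `(x : y : z : t₀ : t₁ : t₂)`, numbered `0, …, 5`, and the plane is
`P = {x = y = z = 0}`.  The projection from `P` is `(x : y : z : t₀ : t₁ : t₂) ↦ (x : y : z)`. -/

/-- Cubic forms `F` in six variables whose hypersurface `X = {F = 0}` contains `P`. -/
def cubicsContainingPlane : Set (MvPolynomial (Fin 6) ℂ) :=
  {F | F.IsHomogeneous 3 ∧ ∀ v : Fin 6 → ℂ, v 0 = 0 → v 1 = 0 → v 2 = 0 → eval v F = 0}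

/-- Jacobian criterion: the hypersurface `{f = 0}` in projective space is smooth. -/
def IsSmoothHypersurface {n : ℕ} (f : MvPolynomial (Fin n) ℂ) : Prop :=
  ∀ v : Fin n → ℂ, v ≠ 0 → eval v f = 0 → ∃ i, eval v (pderiv i f) ≠ 0

/-- Jacobian criterion: the hyperplane section `Y = {F = 0} ∩ {∑ hᵢ xᵢ = 0}` is smooth (of
codimension two in `ℙ⁵`). -/
def IsSmoothSection (F : MvPolynomial (Fin 6) ℂ) (h : Fin 6 → ℂ) : Prop :=
  ∀ v : Fin 6 → ℂ, v ≠ 0 → eval v F = 0 → h ⬝ᵥ v = 0 →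
    LinearIndependent ℂ ![fun i => eval v (pderiv i F), h]

/-- Restriction of a polynomial to `t₀ = t₁ = t₂ = 0`. -/
def restrictT (G : MvPolynomial (Fin 6) ℂ) : MvPolynomial (Fin 3) ℂ :=
  aeval ![X 0, X 1, X 2, 0, 0, 0] G

/-- The Gram matrix of the quadric surface bundle `Bl_P X → ℙ²` in the fibre coordinates
`(t₀, t₁, t₂, s)`.  For `F = ∑_{i ≤ j} aᵢⱼ tᵢ tⱼ + ∑ bᵢ tᵢ + c`, with `aᵢⱼ`, `bᵢ`, `c` forms in
`x, y, z` of degrees `1`, `2`, `3`, it is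
`(2a₀₀ a₀₁ a₀₂ b₀; a₀₁ 2a₁₁ a₁₂ b₁; a₀₂ a₁₂ 2a₂₂ b₂; b₀ b₁ b₂ 2c)`. -/
def gram (F : MvPolynomial (Fin 6) ℂ) : Matrix (Fin 4) (Fin 4) (MvPolynomial (Fin 3) ℂ) :=
  let a (i j : Fin 6) := restrictT (pderiv i (pderiv j F))
  let b (i : Fin 6) := restrictT (pderiv i F)
  !![a 3 3, a 3 4, a 3 5, b 3;
     a 4 3, a 4 4, a 4 5, b 4;
     a 5 3, a 5 4, a 5 5, b 5;
     b 3,   b 4,   b 5,   2 * restrictT F]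

/-- The equation of the discriminant sextic `D₆` of `Bl_P X → ℙ²`. -/
def sextic (F : MvPolynomial (Fin 6) ℂ) : MvPolynomial (Fin 3) ℂ := (gram F).det

/-- The hyperplane `H = {∑ hᵢ xᵢ = 0}` in the fibre coordinates `(t₀, t₁, t₂, s)`:
it is `h₃ t₀ + h₄ t₁ + h₅ t₂ + (h₀ x + h₁ y + h₂ z) s = 0`. -/
def normal (h : Fin 6 → ℂ) : Fin 4 → MvPolynomial (Fin 3) ℂ :=
  ![C (h 3), C (h 4), C (h 5), C (h 0) * X 0 + C (h 1) * X 1 + C (h 2) * X 2]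

/-- The equation of the discriminant quintic `D_H` of the conic bundle `Bl_L Y → ℙ²`, whose
quadratic form is the restriction of the one of `Bl_P X → ℙ²` to the rank three subbundle
`n = 0`, `n = normal h`.  Its discriminant is `nᵀ adj(M) n`, with `M = gram F`:
see `quintic_eq_det_restricted` for the Gram determinant after elimination of `t₀`. -/
def quintic (F : MvPolynomial (Fin 6) ℂ) (h : Fin 6 → ℂ) : MvPolynomial (Fin 3) ℂ :=
  normal h ⬝ᵥ (gram F).adjugate.mulVec (normal h)

/-- If `H` is `t₀ = l(x, y, z, t₁, t₂)`, then `D_H` is the determinant of the Gram matrix of the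
form obtained by substituting `l` for `t₀`, in the coordinates `(t₁, t₂, s)`. -/
theorem quintic_eq_det_restricted (F : MvPolynomial (Fin 6) ℂ) (l : Fin 6 → ℂ) :
    let B : Matrix (Fin 4) (Fin 3) (MvPolynomial (Fin 3) ℂ) :=
      !![C (l 4), C (l 5), C (l 0) * X 0 + C (l 1) * X 1 + C (l 2) * X 2;
         1, 0, 0;
         0, 1, 0;
         0, 0, 1]
    quintic F ![-l 0, -l 1, -l 2, 1, -l 4, -l 5] = (B.transpose * gram F * B).det := by
  intro B
  unfold quintic normal
  generalize gram F = M
  simp only [B, dotProduct, Matrix.mulVec, Fin.sum_univ_four, Matrix.adjugate_apply]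
  simp [Matrix.det_succ_row_zero, Fin.sum_univ_succ, Matrix.updateRow_apply, Fin.succAbove,
    Matrix.mul_apply, Pi.single_apply]
  ring

/-! ### Intersection multiplicities of plane curves -/

/-- The local ring of affine space at the point `v`. -/
abbrev LocalRingAt {n : ℕ} (v : Fin n → ℂ) : Type :=
  Localization.AtPrime (vanishingIdeal ℂ {v} : Ideal (MvPolynomial (Fin n) ℂ))

/-- The ideal generated by `I` in the local ring at `v`. -/
def germ {n : ℕ} (v : Fin n → ℂ) (I : Ideal (MvPolynomial (Fin n) ℂ)) : Ideal (LocalRingAt v) :=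
  I.map (algebraMap _ _)

/-- The intersection multiplicity `dim_ℂ 𝒪_{ℙ², [v]} / (f, g)` of the plane curves `f = 0` and
`g = 0` at `[v] ∈ ℙ²`, for forms `f` and `g`.  The affine chart `{xᵢ ≠ 0}` of `ℙ²`, with `vᵢ ≠ 0`,
is identified with the affine plane `{xᵢ = vᵢ}` through `v`. -/
def intersectionMultiplicity (f g : MvPolynomial (Fin 3) ℂ) (i : Fin 3) (v : Fin 3 → ℂ) : ℕ∞ :=
  Module.length ℂ (LocalRingAt v ⧸ germ v (Ideal.span {X i - C (v i), f, g}))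

/-! ### The set `U` of hyperplanes -/

/-- `X` and `D₆` are smooth. -/
def IsSmoothPair (F : MvPolynomial (Fin 6) ℂ) : Prop :=
  IsSmoothHypersurface F ∧ IsSmoothHypersurface (sextic F)

/-- The hyperplanes `H` such that `Y = X ∩ H` and `D_H` are smooth and `D_H` and `D₆` intersect with
multiplicity at most two at every point. -/
def goodHyperplanes (F : MvPolynomial (Fin 6) ℂ) : Set (Fin 6 → ℂ) :=
  {h | h ≠ 0 ∧ IsSmoothSection F h ∧ IsSmoothHypersurface (quintic F h) ∧
    ∀ (v : Fin 3 → ℂ) (i : Fin 3), v i ≠ 0 → eval v (sextic F) = 0 → eval v (quintic F h) = 0 →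
      intersectionMultiplicity (sextic F) (quintic F h) i v ≤ 2}

/-! ### The double plane `S` -/

/-- Homogeneous coordinates `(x, y, z, w)` on the total space of `𝒪(3)` over `ℙ²`. -/
abbrev TotRep : Type := {p : Fin 4 → ℂ // ![p 0, p 1, p 2] ≠ 0}

/-- `(x, y, z, w) ∼ (c x, c y, c z, c³ w)` for `c ≠ 0`. -/
instance totSetoid : Setoid TotRep where
  r p q := ∃ c : ℂ, c ≠ 0 ∧ q.1 = ![c * p.1 0, c * p.1 1, c * p.1 2, c ^ 3 * p.1 3]
  iseqv :=
    { refl := fun p => ⟨1, one_ne_zero, by ext i; fin_cases i <;> simp⟩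
      symm := by
        rintro p q ⟨c, hc, h⟩
        refine ⟨c⁻¹, inv_ne_zero hc, ?_⟩
        ext i
        fin_cases i <;> simp [h, hc]
      trans := by
        rintro p q r ⟨c, hc, h⟩ ⟨d, hd, k⟩
        refine ⟨d * c, mul_ne_zero hd hc, ?_⟩
        ext i
        fin_cases i <;> simp [h, k] <;> ring }

/-- The total space of `𝒪(3)` over `ℙ²`, that is `ℙ(1, 1, 1, 3)` without `(0 : 0 : 0 : 1)`. -/
abbrev TotO3 : Type := Quotient totSetoid

/-- The base point in `ℙ²` of a point, in homogeneous coordinates. -/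
def base (p : TotRep) : Fin 3 → ℂ := ![p.1 0, p.1 1, p.1 2]

/-- The homogeneous coordinates of the points of `T`. -/
def cone (T : Set TotO3) : Set (Fin 4 → ℂ) := {p | ∃ hp : ![p 0, p 1, p 2] ≠ 0, ⟦⟨p, hp⟩⟧ ∈ T}

/-- The double cover `S = {w² = det M(x, y, z)}` of `ℙ²`, branched over `D₆`. -/
def doublePlane (F : MvPolynomial (Fin 6) ℂ) : Set TotO3 :=
  {q | ∀ p : TotRep, ⟦p⟧ = q → p.1 3 ^ 2 = eval (base p) (sextic F)}

/-- Zariski closure in the total space of `𝒪(3)`. -/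
def zariskiClosure (T : Set TotO3) : Set TotO3 :=
  {q | ∀ p : TotRep, ⟦p⟧ = q → p.1 ∈ zeroLocus ℂ (vanishingIdeal ℂ (cone T))}

/-! ### The curve `C_H` and its image in `S` -/

/-- The point of `ℙ⁵` with fibre coordinates `(t₀, t₁, t₂, s)` over `y ∈ ℙ²`. -/
def fibrePoint (y : Fin 3 → ℂ) (u : Fin 4 → ℂ) : Fin 6 → ℂ :=
  ![u 3 * y 0, u 3 * y 1, u 3 * y 2, u 0, u 1, u 2]

/-- The symmetric bilinear form of the quadric `Q_y`. -/
def form (F : MvPolynomial (Fin 6) ℂ) (y : Fin 3 → ℂ) (u v : Fin 4 → ℂ) : ℂ :=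
  u ⬝ᵥ ((gram F).map (eval y)).mulVec v

/-- `u, v` is a basis of (the plane over) a line contained in the quadric `Q_y`: together with
`y ∈ ℙ²`, this line is a point of the relative Fano variety of lines of `Bl_P X → ℙ²`. -/
def IsLineInFibre (F : MvPolynomial (Fin 6) ℂ) (y : Fin 3 → ℂ) (u v : Fin 4 → ℂ) : Prop :=
  LinearIndependent ℂ ![u, v] ∧ form F y u u = 0 ∧ form F y u v = 0 ∧ form F y v v = 0

/-- The map `α` from the relative Fano variety of lines to `S` (over `ℙ²`) sends the line spanned by
`u, v` in `Q_y` to the point `(y, w)` with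
`B(a, u) B(b, v) - B(a, v) B(b, u) = w det(a, b, u, v)` for all `a, b`, where `B` is the bilinear
form of `Q_y`.  Such a `w` exists, as the left hand side is alternating in `(a, b)` and vanishes for
`a` in the span of `u, v`; it does not depend on the basis `u, v`, and `w²` is the Gram determinant.
If `Q_y` is smooth, then the two values of `w` correspond to the two rulings of `Q_y`; if `Q_y` is a
cone, then `w = 0`. So the fibres of `α` are connected. -/
def IsAlphaImage (F : MvPolynomial (Fin 6) ℂ) (y : Fin 3 → ℂ) (u v : Fin 4 → ℂ) (w : ℂ) : Prop :=
  ∀ a b : Fin 4 → ℂ, form F y a u * form F y b v - form F y a v * form F y b u =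
    w * (Matrix.of ![a, b, u, v]).det

/-- The linear subspace of `ℂ⁶` over the line `L = P ∩ H`. -/
def lineL (h : Fin 6 → ℂ) : Submodule ℂ (Fin 6 → ℂ) where
  carrier := {v | v 0 = 0 ∧ v 1 = 0 ∧ v 2 = 0 ∧ h ⬝ᵥ v = 0}
  zero_mem' := by simp
  add_mem' := by
    rintro v w ⟨h0, h1, h2, h3⟩ ⟨k0, k1, k2, k3⟩
    simp [dotProduct_add, *]
  smul_mem' := by
    rintro c v ⟨h0, h1, h2, h3⟩
    simp [dotProduct_smul, *]

/-- Lines `L' ≠ L` contained in `Y = X ∩ H` and meeting `L`.  The closure of the set of these lines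
is the curve `C_H`. -/
def IsLineOfCurve (F : MvPolynomial (Fin 6) ℂ) (h : Fin 6 → ℂ)
    (L' : Submodule ℂ (Fin 6 → ℂ)) : Prop :=
  Module.finrank ℂ L' = 2 ∧ (∀ v ∈ L', eval v F = 0 ∧ h ⬝ᵥ v = 0) ∧
    L' ≠ lineL h ∧ L' ⊓ lineL h ≠ ⊥

/-- The image `α(C_H)` of the curve `C_H` in `S`. As `α` is proper, it is the closure of the set of
images of the lines `L' ≠ L` in `Y` that meet `L`. -/
def imageCurve (F : MvPolynomial (Fin 6) ℂ) (h : Fin 6 → ℂ) : Set TotO3 :=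
  zariskiClosure {q | ∃ (p : TotRep) (u v : Fin 4 → ℂ), ⟦p⟧ = q ∧
    IsLineInFibre F (base p) u v ∧
    IsLineOfCurve F h (Submodule.span ℂ {fibrePoint (base p) u, fibrePoint (base p) v}) ∧
    IsAlphaImage F (base p) u v (p.1 3)}

/-! ### Nodal curves on a smooth surface -/

/-- The affine chart of `T` around `p` on which the `i`-th coordinate is not zero, as a subset of
the hyperplane through `p` on which this coordinate is constant. -/
def chart (T : Set TotO3) (i : Fin 3) (p : TotRep) : Set (Fin 4 → ℂ) :=
  {r | r ∈ cone T ∧ r i.castSucc = p.1 i.castSucc}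

/-- The ideal of `T` in the local ring of the ambient affine space at `p`. -/
def localIdeal (T : Set TotO3) (i : Fin 3) (p : TotRep) : Ideal (LocalRingAt p.1) :=
  germ p.1 (vanishingIdeal ℂ (chart T i p))

/-- The curve `T` on the smooth surface `S` is smooth at `q`: modulo the ideal of `S`, the ideal of
`T` in the local ring at `q` is generated by an element of `𝔪 \ 𝔪²`. -/
def IsSmoothAt (S T : Set TotO3) (q : TotO3) : Prop :=
  ∀ (p : TotRep) (i : Fin 3), ⟦p⟧ = q → p.1 i.castSucc ≠ 0 →
    ∃ e : LocalRingAt p.1, localIdeal T i p = Ideal.span {e} ⊔ localIdeal S i p ∧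
      e ∈ IsLocalRing.maximalIdeal (LocalRingAt p.1) ∧
      e ∉ IsLocalRing.maximalIdeal (LocalRingAt p.1) ^ 2 ⊔ localIdeal S i p

/-- The curve `T` on the smooth surface `S` has a node (ordinary double point) at `q`: modulo the
ideal of `S`, there are local parameters `a, b` at `q` and a local equation `e` of `T` such that
`e ≡ a b` modulo `𝔪³`. -/
def IsNodeAt (S T : Set TotO3) (q : TotO3) : Prop :=
  ∀ (p : TotRep) (i : Fin 3), ⟦p⟧ = q → p.1 i.castSucc ≠ 0 →
    ∃ a b e : LocalRingAt p.1,
      IsLocalRing.maximalIdeal (LocalRingAt p.1) = Ideal.span {a, b} ⊔ localIdeal S i p ∧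
      localIdeal T i p = Ideal.span {e} ⊔ localIdeal S i p ∧
      e - a * b ∈ IsLocalRing.maximalIdeal (LocalRingAt p.1) ^ 3 ⊔ localIdeal S i p

/-- The singular points of the curve `T` on the smooth surface `S`. -/
def singularPoints (S T : Set TotO3) : Set TotO3 := {q | q ∈ T ∧ ¬ IsSmoothAt S T q}

/-- `T` is an irreducible curve on the smooth surface `S` with exactly `n` singular points, all of
which are nodes. -/
def IsNodalCurve (S T : Set TotO3) (n : ℕ) : Prop :=
  T ⊆ S ∧ (vanishingIdeal ℂ (cone T) : Ideal (MvPolynomial (Fin 4) ℂ)).IsPrime ∧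
    (singularPoints S T).encard = n ∧ ∀ q ∈ singularPoints S T, IsNodeAt S T q

end PlaneCubic

end

/-!
# Nodal curves on the double plane of a cubic fourfold containing a plane

Write `f` for the sextic `det M`, `g` for the quintic `nᵀ adj(M) n`, and `b = adj(M) n` for the pole of
the hyperplane with respect to the quadrics of the bundle. As `M` is symmetric,
`g · adj(M)ⱼⱼ = bⱼ² + f κⱼ` for some form `κⱼ` (`exists_quintic_mul`), and where `f` vanishes and is
smooth, some `adj(M)ⱼⱼ` does not vanish (`exists_adjugate_ne_zero`). So modulo `f` the quintic is locally
the square of `bⱼ` up to a unit, and the two curves are tangent wherever they meet: their intersection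
multiplicity is at least two. If it is at most two, then it is two and `f`, `bⱼ` are local parameters of
the plane (`intersectionMultiplicity_eq_two`, `dirDeriv_ne_zero_of_intersectionMultiplicity_le`).
By Bézout's theorem there are `6 · 5 / 2 = 15` intersection points. It is proved for curves which meet in
this way (`two_mul_ncard_common_zeros`) by a dimension count in the graded ring `ℂ[x, y, z] / (f, g)`,
with Max Noether's theorem `mem_span_pair_of_forall_exists` as the local-to-global step.

The curve `T = {w² = f, g = 0}` on the double plane is smooth where `w ≠ 0`. At a point with `w = 0` it
has the local equation `bⱼ² + w² κⱼ`, to leading order a product of two independent local parameters, as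
`κⱼ` does not vanish there. So `T` has exactly 15 singular points, all nodes, lying over `D₆ ∩ D_H`
(`isNodalCurve_of_isLocallySquare`, `mk_mem_singularPoints_iff`).

It remains to see that `T` is irreducible and that it is the image of the curve of lines. The quadrics
`Q_y` restrict to the line `L = P ∩ H` as a binary quadratic form whose coefficients are linear in `y`;
its discriminant is `δ = -κ₃`. If `T` were reducible, then `f` would be a square in the function field of
`D_H`, and so would be `δ`, as `b₃² = f δ` modulo `g`. The cone over the smooth curve `D_H` is normal,
hence `δ` would be the square of a linear form modulo `g` (`mem_span_pair_of_sq_mem`), and outright, as its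
degree is two. But then some point of `L` would lie on all the quadrics `Q_y`, and `X` would be singular
there (`isPrime_doubleIdeal_quintic`). A line in `Q_y ∩ H` forces the plane `H` to be tangent to `Q_y`, so
that the images of lines lie on `T`; conversely, over a general point of `D_H` the lines joining the pole
of `H` to the two points of `Q_y` on `L` map to the two points of `T`. As `T` is irreducible, it is the
closure of these (`imageCurve_eq`).

For a general cubic and hyperplane, smoothness and multiplicity at most two follow if certain forms,
whose coefficients are polynomials in those of the cubic and the hyperplane, have no common zero in
projective space: for the multiplicity, these are `f`, `g` and the `2 × 2` minors of the differentials
of `f` and `bⱼ`, multiplied by `adj(M)ⱼⱼ`. By elimination theory (`exists_eliminant`) each of these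
conditions is open, so that one example for each condition is enough (`IsGeneric.and`).
-/

noncomputable section

namespace PlaneCubic

/-! ### Zeros of polynomials in few variables -/

/-- The maximal ideal of the origin of affine `n`-space has height `n`. -/
theorem height_vanishingIdeal_zero (n : ℕ) :
    (vanishingIdeal ℂ {(0 : Fin n → ℂ)} : Ideal (MvPolynomial (Fin n) ℂ)).height = n := by
  have hdim : ringKrullDim (MvPolynomial (Fin n) ℂ) = n := by
    rw [ringKrullDim_of_isNoetherianRing]
    simp
  have : FiniteRingKrullDim (MvPolynomial (Fin n) ℂ) := by
    rw [finiteRingKrullDim_iff_ne_bot_and_top, hdim]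
    exact ⟨by simp, fun h => ENat.natCast_ne_top n (WithBot.coe_injective h)⟩
  obtain ⟨m, hm, hh⟩ := Ideal.exists_isMaximal_height (R := MvPolynomial (Fin n) ℂ)
  obtain ⟨x, rfl⟩ := isMaximal_iff_eq_vanishingIdeal_singleton.mp hm
  rw [hdim] at hh
  -- translation by `x` moves the origin to `x`
  have h1 : ∀ (a b : Fin n → ℂ), (∀ i, a i + b i = 0) →
      (aeval (R := ℂ) (fun i => X i + C (b i) : Fin n → MvPolynomial (Fin n) ℂ)).comp
      (aeval (R := ℂ) (fun i => X i + C (a i) : Fin n → MvPolynomial (Fin n) ℂ)) =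
        AlgHom.id ℂ _ := by
    intro a b hab
    ext i
    simp [add_assoc, ← C_add, add_comm (b i), hab]
  let e : MvPolynomial (Fin n) ℂ ≃ₐ[ℂ] MvPolynomial (Fin n) ℂ :=
    AlgEquiv.ofAlgHom (aeval fun i => X i + C (x i)) (aeval fun i => X i + C (-x i))
      (h1 _ _ (by simp)) (h1 _ _ (by simp))
  have h2 : (vanishingIdeal ℂ {x} : Ideal (MvPolynomial (Fin n) ℂ)) =
      (vanishingIdeal ℂ {(0 : Fin n → ℂ)}).comap e.toRingEquiv := by
    ext p
    have h3 : ∀ q : MvPolynomial (Fin n) ℂ, eval 0 (e q) = eval x q := by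
      intro q
      have : (aeval (0 : Fin n → ℂ)).comp e.toAlgHom = aeval (R := ℂ) x := by
        ext i
        simp [e]
      simpa [aeval_eq_eval] using congrArg (fun φ => φ q) this
    rw [Ideal.mem_comap, mem_vanishingIdeal_singleton_iff, mem_vanishingIdeal_singleton_iff,
      aeval_eq_eval, aeval_eq_eval]
    exact (h3 p).symm ▸ Iff.rfl
  rw [h2, RingEquiv.height_comap] at hh
  exact_mod_cast hh

/-- Fewer than `n` polynomials in `n` variables that generate a proper ideal have a common zero
other than the origin. -/
theorem exists_ne_zero_common_zero {n : ℕ} {s : Set (MvPolynomial (Fin n) ℂ)} (hs : s.Finite)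
    (hn : s.ncard < n) (hI : Ideal.span s ≠ ⊤) : ∃ v ≠ 0, ∀ p ∈ s, eval v p = 0 := by
  by_contra! hc
  obtain ⟨J, hJ⟩ := Ideal.nonempty_minimalPrimes hI
  have h1 : (vanishingIdeal ℂ {(0 : Fin n → ℂ)} : Ideal (MvPolynomial (Fin n) ℂ)) ≤
      (Ideal.span s).radical := by
    rw [← vanishingIdeal_zeroLocus_eq_radical (K := ℂ)]
    refine vanishingIdeal_anti_mono fun v hv => ?_
    by_contra h0
    obtain ⟨p, hp, hpv⟩ := hc v h0
    exact hpv (by simpa [aeval_eq_eval] using hv p (Ideal.subset_span hp))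
  have h2 := Ideal.height_le_card_of_mem_minimalPrimes_span hs hJ
  have h3 := Ideal.height_mono (h1.trans (hJ.1.1.radical_le_iff.mpr hJ.1.2))
  rw [height_vanishingIdeal_zero] at h3
  exact absurd (h3.trans h2) (by exact_mod_cast not_le.mpr hn)

/-! ### The grading of the polynomial ring -/

section Grading

variable {σ : Type*}

/-- The homomorphism `G ↦ G(t x) ∈ ℂ[x][t]`; the coefficient of `t ^ k` is the homogeneous component
of `G` of degree `k`. -/
def gradeHom (σ : Type*) : MvPolynomial σ ℂ →ₐ[ℂ] Polynomial (MvPolynomial σ ℂ) :=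
  aeval fun j => Polynomial.C (X j) * Polynomial.X

theorem coeff_gradeHom (G : MvPolynomial σ ℂ) (k : ℕ) :
    (gradeHom σ G).coeff k = homogeneousComponent k G := by
  induction G using MvPolynomial.monomial_add_induction_on generalizing k with
  | C a =>
    have : gradeHom σ (C a) = Polynomial.C (C a) := (gradeHom σ).commutes a
    rw [this, Polynomial.coeff_C, homogeneousComponent_of_mem (isHomogeneous_C σ a)]
  | monomial_add d c p _ hc hp =>
    have h : gradeHom σ (monomial d c) =
        Polynomial.C (monomial d c) * Polynomial.X ^ d.degree := by
      rw [gradeHom, aeval_monomial, monomial_eq]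
      simp only [mul_pow, Finsupp.prod, Finset.prod_mul_distrib, map_mul, map_prod, map_pow,
        Finset.prod_pow_eq_pow_sum, Finsupp.degree_apply, mul_assoc]
      rfl
    rw [map_add, Polynomial.coeff_add, hp, map_add, h, Polynomial.coeff_C_mul_X_pow,
      homogeneousComponent_of_mem (isHomogeneous_monomial c rfl)]

theorem gradeHom_of_isHomogeneous {G : MvPolynomial σ ℂ} {d : ℕ} (hG : G.IsHomogeneous d) :
    gradeHom σ G = Polynomial.C G * Polynomial.X ^ d := by
  ext1 k
  rw [coeff_gradeHom, homogeneousComponent_of_mem hG, Polynomial.coeff_C_mul_X_pow]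

theorem gradeHom_eq_zero_iff {G : MvPolynomial σ ℂ} : gradeHom σ G = 0 ↔ G = 0 := by
  refine ⟨fun h => ?_, fun h => by rw [h, map_zero]⟩
  rw [← sum_homogeneousComponent G]
  exact Finset.sum_eq_zero fun k _ => by rw [← coeff_gradeHom, h, Polynomial.coeff_zero]

theorem isHomogeneous_of_gradeHom_eq {G : MvPolynomial σ ℂ} {d : ℕ}
    (h : ∀ k, k ≠ d → (gradeHom σ G).coeff k = 0) : G.IsHomogeneous d := by
  rw [← sum_homogeneousComponent G]
  refine IsHomogeneous.sum _ _ _ fun k _ => ?_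
  by_cases hk : k = d
  · exact hk ▸ homogeneousComponent_isHomogeneous k G
  · rw [← coeff_gradeHom, h k hk]
    exact isHomogeneous_zero _ _ _

/-- The factors of a nonzero form are forms. -/
theorem _root_.MvPolynomial.IsHomogeneous.exists_of_mul {P Q : MvPolynomial σ ℂ} {d : ℕ}
    (h : (P * Q).IsHomogeneous d)
    (h0 : P * Q ≠ 0) : ∃ m, P.IsHomogeneous m := by
  have hP : gradeHom σ P ≠ 0 := fun h => h0 (by rw [gradeHom_eq_zero_iff.mp h, zero_mul])
  have hQ : gradeHom σ Q ≠ 0 := fun h => h0 (by rw [gradeHom_eq_zero_iff.mp h, mul_zero])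
  have h1 := gradeHom_of_isHomogeneous h
  rw [map_mul] at h1
  have h2 := congrArg Polynomial.natDegree h1
  have h3 := congrArg Polynomial.natTrailingDegree h1
  have h4 : (Polynomial.C (P * Q) * Polynomial.X ^ d).natTrailingDegree = d := by
    rw [Polynomial.natTrailingDegree_mul_X_pow (by simpa using h0),
      Polynomial.natTrailingDegree_C, zero_add]
  rw [Polynomial.natDegree_mul hP hQ, Polynomial.natDegree_C_mul_X_pow _ _ h0] at h2
  rw [Polynomial.natTrailingDegree_mul hP hQ, h4] at h3
  have h5 := Polynomial.natTrailingDegree_le_natDegree (gradeHom σ P)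
  have h6 := Polynomial.natTrailingDegree_le_natDegree (gradeHom σ Q)
  refine ⟨(gradeHom σ P).natDegree, isHomogeneous_of_gradeHom_eq fun k hk => ?_⟩
  rcases lt_or_gt_of_ne hk with hk | hk
  · exact Polynomial.coeff_eq_zero_of_lt_natTrailingDegree (by omega)
  · exact Polynomial.coeff_eq_zero_of_natDegree_lt hk

theorem _root_.MvPolynomial.IsHomogeneous.eval_smul {σ : Type*} {G : MvPolynomial σ ℂ} {d : ℕ} (hG : G.IsHomogeneous d)
    (c : ℂ) (v : σ → ℂ) : eval (c • v) G = c ^ d * eval v G := by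
  rw [eval_eq, eval_eq, Finset.mul_sum]
  refine Finset.sum_congr rfl fun m hm => ?_
  simp only [Pi.smul_apply, smul_eq_mul, mul_pow, Finset.prod_mul_distrib,
    Finset.prod_pow_eq_pow_sum]
  have : ∑ i ∈ m.support, m i = d := by
    exact (hG.degree_eq_sum_deg_support hm).symm
  rw [this]
  ring

theorem _root_.MvPolynomial.IsHomogeneous.eval_zero {σ : Type*} {G : MvPolynomial σ ℂ} {d : ℕ} (hG : G.IsHomogeneous d)
    (hd : d ≠ 0) : eval 0 G = 0 := by
  simpa [hd] using hG.eval_smul 0 0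

/-- A nonzero form of degree zero, or a form that does not vanish at the origin, is constant. -/
theorem _root_.MvPolynomial.IsHomogeneous.isUnit_of_eval_zero_ne {σ : Type*} {G : MvPolynomial σ ℂ} {d : ℕ}
    (hG : G.IsHomogeneous d) (h : eval 0 G ≠ 0) : IsUnit G := by
  have hd : d = 0 := by_contra fun hd => h (hG.eval_zero hd)
  subst hd
  have := homogeneousComponent_eq_self hG
  rw [homogeneousComponent_zero] at this
  rw [← this] at h ⊢
  exact (isUnit_iff_ne_zero.mpr (by simpa using h)).map C

end Grading

/-- Two forms in three variables that are not nonzero constants have a common zero in `ℙ²`. -/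
theorem exists_common_zero {P Q : MvPolynomial (Fin 3) ℂ} (hP : eval 0 P = 0) (hQ : eval 0 Q = 0) :
    ∃ v ≠ 0, eval v P = 0 ∧ eval v Q = 0 := by
  obtain ⟨v, hv, h⟩ := exists_ne_zero_common_zero (s := {P, Q}) (by simp)
    (lt_of_le_of_lt (Set.ncard_insert_le _ _) (by simp)) (by
      intro h
      have : Ideal.span {P, Q} ≤ RingHom.ker (eval (0 : Fin 3 → ℂ)) := by
        rw [Ideal.span_le]
        rintro _ (rfl | rfl)
        · exact hP
        · exact hQ
      rw [h] at this
      exact one_ne_zero ((map_one _).symm.trans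
        (RingHom.mem_ker.mp (this (Submodule.mem_top (x := 1))))))
  exact ⟨v, hv, h P (by simp), h Q (by simp)⟩

theorem ne_zero_of_isSmoothHypersurface {n : ℕ} [NeZero n] {f : MvPolynomial (Fin n) ℂ}
    (h : IsSmoothHypersurface f) : f ≠ 0 := by
  rintro rfl
  obtain ⟨i, hi⟩ := h (fun _ => 1) (fun h => one_ne_zero (congrFun h 0)) (by simp)
  simp at hi

/-- A smooth plane curve is irreducible: two components would meet, in singular points. -/
theorem irreducible_of_isSmoothHypersurface {f : MvPolynomial (Fin 3) ℂ} {d : ℕ}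
    (hf : f.IsHomogeneous d) (hd : d ≠ 0) (h : IsSmoothHypersurface f) : Irreducible f := by
  have hf0 := ne_zero_of_isSmoothHypersurface h
  refine ⟨fun hu => ?_, fun P Q hPQ => ?_⟩
  · have := hu.map (eval (0 : Fin 3 → ℂ))
    rw [hf.eval_zero hd] at this
    simp at this
  · by_contra! hc
    obtain ⟨m, hm⟩ := IsHomogeneous.exists_of_mul (hPQ ▸ hf) (hPQ ▸ hf0)
    obtain ⟨k, hk⟩ := IsHomogeneous.exists_of_mul (P := Q) (Q := P)
      (by rw [mul_comm]; exact hPQ ▸ hf) (by rw [mul_comm]; exact hPQ ▸ hf0)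
    have h1 : eval 0 P = 0 := by_contra fun h => hc.1 (hm.isUnit_of_eval_zero_ne h)
    have h2 : eval 0 Q = 0 := by_contra fun h => hc.2 (hk.isUnit_of_eval_zero_ne h)
    obtain ⟨v, hv, hvP, hvQ⟩ := exists_common_zero h1 h2
    obtain ⟨i, hi⟩ := h v hv (by simp [hPQ, hvP])
    exact hi (by simp [hPQ, Derivation.leibniz, hvP, hvQ])

/-! ### Complete intersections in the plane: the saturation lemma -/

/-- The linear form `x₀ - c x₁ - c² x₂`. -/
def sliceForm (c : ℂ) : MvPolynomial (Fin 3) ℂ := X 0 - C c * X 1 - C (c ^ 2) * X 2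

/-- Restriction to the plane `x₀ = c x₁ + c² x₂` in affine space, with coordinates `x₁, x₂`. -/
def sliceHom (c : ℂ) : MvPolynomial (Fin 3) ℂ →ₐ[ℂ] MvPolynomial (Fin 2) ℂ :=
  aeval ![C c * X 0 + C (c ^ 2) * X 1, X 0, X 1]

theorem sliceHom_sliceForm (c : ℂ) : sliceHom c (sliceForm c) = 0 := by
  simp only [sliceHom, sliceForm, map_sub, map_mul, aeval_X, algHom_C]
  simp [algebraMap_eq]

/-- A section of the restriction to a plane, modulo the equation of the plane. -/
theorem exists_sub_eq_sliceForm_mul (c : ℂ) (G : MvPolynomial (Fin 3) ℂ) :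
    ∃ K, G - aeval ![X 1, X 2] (sliceHom c G) = sliceForm c * K := by
  suffices h : ∀ G : MvPolynomial (Fin 3) ℂ,
      Ideal.Quotient.mkₐ ℂ (Ideal.span {sliceForm c}) G =
        Ideal.Quotient.mkₐ ℂ (Ideal.span {sliceForm c})
          (aeval (![X 1, X 2] : Fin 2 → MvPolynomial (Fin 3) ℂ) (sliceHom c G)) by
    have := (Ideal.Quotient.eq.mp (h G))
    exact Ideal.mem_span_singleton.mp this
  intro G
  have : Ideal.Quotient.mkₐ ℂ (Ideal.span {sliceForm c}) =
      ((Ideal.Quotient.mkₐ ℂ (Ideal.span {sliceForm c})).comp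
        (aeval (![X 1, X 2] : Fin 2 → MvPolynomial (Fin 3) ℂ))).comp (sliceHom c) := by
    ext i
    fin_cases i
    · refine Ideal.Quotient.eq.mpr (Ideal.mem_span_singleton.mpr (dvd_of_eq ?_))
      simp [sliceForm, sliceHom, algebraMap_eq]
      ring
    · simp [sliceHom]
    · simp [sliceHom]
  exact congrArg (fun φ => φ G) this

theorem sliceHom_eq_zero_iff {c : ℂ} {G : MvPolynomial (Fin 3) ℂ} :
    sliceHom c G = 0 ↔ sliceForm c ∣ G := by
  constructor
  · intro h
    obtain ⟨K, hK⟩ := exists_sub_eq_sliceForm_mul c G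
    rw [h, map_zero, sub_zero] at hK
    exact ⟨K, hK⟩
  · rintro ⟨K, rfl⟩
    rw [map_mul, sliceHom_sliceForm, zero_mul]

theorem sliceHom_surjective (c : ℂ) : Function.Surjective (sliceHom c) := by
  intro G
  refine ⟨aeval ![X 1, X 2] G, ?_⟩
  have : (sliceHom c).comp (aeval (![X 1, X 2] : Fin 2 → MvPolynomial (Fin 3) ℂ)) =
      AlgHom.id ℂ _ := by
    ext i
    fin_cases i <;> simp [sliceHom]
  exact congrArg (fun φ => φ G) this

theorem eval_sliceHom (c : ℂ) (G : MvPolynomial (Fin 3) ℂ) (v : Fin 2 → ℂ) :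
    eval v (sliceHom c G) = eval ![c * v 0 + c ^ 2 * v 1, v 0, v 1] G := by
  have : (aeval v).comp (sliceHom c) = aeval (R := ℂ) ![c * v 0 + c ^ 2 * v 1, v 0, v 1] := by
    ext i
    fin_cases i <;> simp [sliceHom]
  simpa [aeval_eq_eval] using congrArg (fun φ => φ G) this

/-- If `P = Q = 0` has no zero on the line `x₀ = c x₁ + c² x₂` in `ℙ²`, then the equation of this line
is a nonzerodivisor modulo `(P, Q)`. -/
theorem mem_span_pair_of_sliceForm_mul_mem {P Q : MvPolynomial (Fin 3) ℂ} {c : ℂ}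
    (h : ∀ v ≠ 0, eval v P = 0 → eval v Q = 0 → eval v (sliceForm c) ≠ 0)
    (hQ : eval 0 Q = 0) {e : MvPolynomial (Fin 3) ℂ} (he : sliceForm c * e ∈ Ideal.span {P, Q}) :
    e ∈ Ideal.span {P, Q} := by
  have hzero : ∀ w : Fin 2 → ℂ, w ≠ 0 → eval w (sliceHom c P) = 0 → eval w (sliceHom c Q) ≠ 0 := by
    intro w hw h1 h2
    rw [eval_sliceHom] at h1 h2
    refine h _ ?_ h1 h2 (by simp [sliceForm])
    intro h0
    apply hw
    ext i
    fin_cases i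
    · exact congrFun h0 1
    · exact congrFun h0 2
  -- Without common zero on the line, the restrictions are a regular sequence; so a syzygy between them is
  -- a multiple of the trivial one, and it lifts to a syzygy that can be subtracted.
  have hrel : IsRelPrime (sliceHom c P) (sliceHom c Q) := by
    intro d hdP hdQ
    by_contra hu
    obtain ⟨w, hw, hd⟩ := exists_ne_zero_common_zero (s := {d}) (by simp) (by simp)
      (by rwa [Ne, Ideal.span_singleton_eq_top])
    have hd := hd d rfl
    refine hzero w hw ?_ ?_
    · obtain ⟨k, hk⟩ := hdP
      rw [hk, map_mul, hd, zero_mul]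
    · obtain ⟨k, hk⟩ := hdQ
      rw [hk, map_mul, hd, zero_mul]
  have hP0 : sliceHom c P ≠ 0 := by
    intro h0
    rw [h0, isRelPrime_zero_left] at hrel
    have := hrel.map (eval 0)
    rw [eval_sliceHom] at this
    simp only [Pi.zero_apply, mul_zero, add_zero] at this
    rw [show ![(0 : ℂ), 0, 0] = 0 by ext i; fin_cases i <;> rfl, hQ] at this
    exact not_isUnit_zero this
  obtain ⟨A, B, hAB⟩ := Ideal.mem_span_pair.mp he
  have h1 : sliceHom c A * sliceHom c P + sliceHom c B * sliceHom c Q = 0 := by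
    rw [← map_mul, ← map_mul, ← map_add, hAB, map_mul, sliceHom_sliceForm, zero_mul]
  have h2 : sliceHom c P ∣ sliceHom c B := hrel.dvd_of_dvd_mul_right ⟨-sliceHom c A, by
    linear_combination h1⟩
  obtain ⟨k, hk⟩ := h2
  obtain ⟨K, rfl⟩ := sliceHom_surjective c k
  have h3 : sliceForm c ∣ B - P * K := sliceHom_eq_zero_iff.mp (by
    rw [map_sub, map_mul, hk, sub_self])
  have h4 : sliceForm c ∣ A + Q * K := sliceHom_eq_zero_iff.mp (by
    rw [map_add, map_mul]
    refine (mul_right_inj' hP0).mp ?_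
    rw [hk] at h1
    linear_combination h1)
  obtain ⟨B', hB⟩ := h3
  obtain ⟨A', hA⟩ := h4
  have hl : sliceForm c ≠ 0 := by
    intro h0
    have : eval ![1, 0, 0] (sliceForm c) = 0 := by rw [h0, map_zero]
    simp [sliceForm] at this
  refine Ideal.mem_span_pair.mpr ⟨A', B', ?_⟩
  refine (mul_right_inj' hl).mp ?_
  linear_combination hAB - P * hA - Q * hB

/-- A line in the plane that avoids finitely many points. -/
theorem exists_sliceForm_ne_zero (s : Set (Fin 3 → ℂ)) (hs : s.Finite) (h0 : 0 ∉ s) :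
    ∃ c, ∀ v ∈ s, eval v (sliceForm c) ≠ 0 := by
  classical
  let q : (Fin 3 → ℂ) → Polynomial ℂ := fun v =>
    Polynomial.C (v 0) - Polynomial.C (v 1) * Polynomial.X - Polynomial.C (v 2) * Polynomial.X ^ 2
  have hq : ∀ v ∈ s, q v ≠ 0 := by
    intro v hv h
    apply h0
    convert hv
    ext i
    have h1 := congrArg (fun p => Polynomial.coeff p i) h
    fin_cases i <;> simpa [q, Polynomial.coeff_X, Polynomial.coeff_C, Polynomial.coeff_X_pow,
      eq_comm] using h1
  have hprod : ∏ v ∈ hs.toFinset, q v ≠ 0 :=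
    Finset.prod_ne_zero_iff.mpr fun v hv => hq v (hs.mem_toFinset.mp hv)
  obtain ⟨c, hc⟩ := Polynomial.exists_eval_ne_zero_of_natDegree_lt_card _ hprod
    ((Cardinal.natCast_lt_aleph0).trans_le (Cardinal.aleph0_le_mk ℂ))
  refine ⟨c, fun v hv h => hc ?_⟩
  rw [Polynomial.eval_prod]
  refine Finset.prod_eq_zero (hs.mem_toFinset.mpr hv) ?_
  simp only [sliceForm, map_sub, map_mul, eval_X, eval_C] at h
  simp only [q, Polynomial.eval_sub, Polynomial.eval_mul, Polynomial.eval_C, Polynomial.eval_X,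
    Polynomial.eval_pow]
  linear_combination h

/-- Max Noether's theorem in the form used here: if the zeros of `P = Q = 0` in `ℙ²` are finitely many
points, then membership in `(P, Q)` is a local condition away from the origin. -/
theorem mem_span_pair_of_forall_exists {P Q : MvPolynomial (Fin 3) ℂ}
    (hQ : eval 0 Q = 0)
    (hfin : ∃ c, ∀ v ≠ 0, eval v P = 0 → eval v Q = 0 → eval v (sliceForm c) ≠ 0)
    {e : MvPolynomial (Fin 3) ℂ}
    (he : ∀ v ≠ 0, ∃ s, eval v s ≠ 0 ∧ s * e ∈ Ideal.span {P, Q}) :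
    e ∈ Ideal.span {P, Q} := by
  obtain ⟨c, hc⟩ := hfin
  let J : Ideal (MvPolynomial (Fin 3) ℂ) := (Ideal.span {P, Q}).colon {e}
  have hJ : ∀ s, s ∈ J ↔ s * e ∈ Ideal.span {P, Q} := fun s => by
    simp [J, Submodule.mem_colon_singleton]
  -- The ideal `J = (P, Q) : e` has no zeros but the origin, so it contains a power of the nonzerodivisor
  -- `sliceForm c`.
  have h1 : sliceForm c ∈ J.radical := by
    rw [← vanishingIdeal_zeroLocus_eq_radical (K := ℂ)]
    intro v hv
    by_cases h0 : v = 0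
    · simp [h0, sliceForm]
    · obtain ⟨s, hs, hse⟩ := he v h0
      exact absurd (by simpa [aeval_eq_eval] using hv s ((hJ s).mpr hse)) hs
  obtain ⟨N, hN⟩ := h1
  replace hN := (hJ _).mp hN
  induction N with
  | zero => simpa using hN
  | succ N ih =>
    refine ih (mem_span_pair_of_sliceForm_mul_mem hc hQ ?_)
    rwa [← mul_assoc, ← pow_succ']

/-! ### The Hilbert function of a complete intersection -/

theorem finrank_homogeneousSubmodule (d : ℕ) :
    Module.finrank ℂ (homogeneousSubmodule (Fin 3) ℂ d) = (d + 2).choose 2 := by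
  have h1 : (homogeneousSubmodule (Fin 3) ℂ d).map (basisMonomials (Fin 3) ℂ).repr.toLinearMap =
      Finsupp.supported ℂ ℂ (((Finset.univ : Finset (Fin 3)).finsuppAntidiag d : Finset _) :
        Set (Fin 3 →₀ ℕ)) := by
    have hdeg : ∀ m : Fin 3 →₀ ℕ, m ∈ (Finset.univ : Finset (Fin 3)).finsuppAntidiag d ↔
        m.degree = d := fun m => by
      rw [Finset.mem_finsuppAntidiag, Finsupp.degree_eq_sum]
      simp
    ext p
    rw [Finsupp.mem_supported, Submodule.mem_map]
    constructor
    · rintro ⟨G, hG, rfl⟩ m hm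
      refine (hdeg m).mpr (by_contra fun h => ?_)
      exact Finsupp.mem_support_iff.mp hm (hG.coeff_eq_zero h)
    · intro h
      refine ⟨(basisMonomials (Fin 3) ℂ).repr.symm p, fun m hm => ?_,
        LinearEquiv.apply_symm_apply _ _⟩
      have h2 := (hdeg m).mp (h (Finsupp.mem_support_iff.mpr hm))
      rwa [Finsupp.degree_eq_weight_one] at h2
  rw [← LinearEquiv.finrank_map_eq (basisMonomials (Fin 3) ℂ).repr, h1,
    (Finsupp.supportedEquivFinsupp (M := ℂ) (R := ℂ) _).finrank_eq, Module.finrank_finsupp_self,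
    Fintype.card_eq_nat_card, Nat.card_coe_set_eq, Set.ncard_coe_finset,
    Finset.card_finsuppAntidiag_nat_eq_choose, Finset.card_univ, Fintype.card_fin,
    show 3 + d - 1 = d + 2 by omega]
  exact Nat.choose_symm_add

instance (d : ℕ) : Module.Finite ℂ (homogeneousSubmodule (Fin 3) ℂ d) :=
  Module.Finite.iff_fg.mpr (homogeneousSubmodule_fg _ _ d)

theorem two_mul_choose_two (d : ℕ) : 2 * (d + 2).choose 2 = (d + 2) * (d + 1) := by
  induction d with
  | zero => rfl
  | succ d ih =>
    rw [show d + 1 + 2 = (d + 2) + 1 by ring, Nat.choose_succ_succ', Nat.choose_one_right, mul_add, ih]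
    ring

theorem homogeneousComponent_mul_of_isHomogeneous {n : ℕ} {P A : MvPolynomial (Fin n) ℂ} {m : ℕ}
    (hP : P.IsHomogeneous m) (k : ℕ) :
    homogeneousComponent (k + m) (A * P) = homogeneousComponent k A * P := by
  rw [← coeff_gradeHom, map_mul, gradeHom_of_isHomogeneous hP, ← mul_assoc,
    Polynomial.coeff_mul_X_pow, Polynomial.coeff_mul_C, coeff_gradeHom]

theorem _root_.MvPolynomial.IsHomogeneous.of_mul_left {P K : MvPolynomial (Fin 3) ℂ} {m k : ℕ}
    (hP : P.IsHomogeneous m) (hP0 : P ≠ 0) (h : (K * P).IsHomogeneous (k + m)) :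
    K.IsHomogeneous k := by
  have h1 := homogeneousComponent_mul_of_isHomogeneous (A := K) hP k
  rw [homogeneousComponent_eq_self h] at h1
  rw [mul_right_cancel₀ hP0 h1]
  exact homogeneousComponent_isHomogeneous k K

/-- The forms of degree `d` in the ideal `(P, Q)`. -/
def formsIn (P Q : MvPolynomial (Fin 3) ℂ) (d : ℕ) :
    Submodule ℂ (homogeneousSubmodule (Fin 3) ℂ d) :=
  ((Ideal.span {P, Q}).restrictScalars ℂ).comap (homogeneousSubmodule (Fin 3) ℂ d).subtype

/-- The Koszul complex of two coprime forms of degrees `m` and `n` shows that the Hilbert function of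
`ℂ[x, y, z] / (P, Q)` takes the value `m n` in large degrees. -/
theorem finrank_formsIn_add {P Q : MvPolynomial (Fin 3) ℂ} {m n : ℕ} (hP : P.IsHomogeneous m)
    (hQ : Q.IsHomogeneous n) (hP0 : P ≠ 0) (hQ0 : Q ≠ 0) (hPQ : IsRelPrime P Q) (k : ℕ) :
    Module.finrank ℂ (formsIn P Q (k + m + n)) + m * n =
      Module.finrank ℂ (homogeneousSubmodule (Fin 3) ℂ (k + m + n)) := by
  let S := fun d => homogeneousSubmodule (Fin 3) ℂ d
  -- The Koszul complex `0 → S_k → S_{k+n} × S_{k+m} → S_{k+m+n}`, with differentials `Θ` and `Ψ`.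
  let Ψ : (S (k + n) × S (k + m)) →ₗ[ℂ] S (k + m + n) :=
    { toFun := fun AB => ⟨AB.1.1 * P + AB.2.1 * Q, by
        refine IsHomogeneous.add ?_ ?_
        · have := AB.1.2.mul hP
          rwa [show k + n + m = k + m + n by ring] at this
        · exact AB.2.2.mul hQ⟩
      map_add' := fun a b => by
        ext1
        simp only [Prod.fst_add, Prod.snd_add, Submodule.coe_add]
        ring
      map_smul' := fun c a => by
        ext1
        simp only [Prod.smul_fst, Prod.smul_snd, Submodule.coe_smul, RingHom.id_apply, smul_add,
          smul_mul_assoc] }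
  let Θ : S k →ₗ[ℂ] (S (k + n) × S (k + m)) :=
    { toFun := fun K => (⟨K.1 * Q, K.2.mul hQ⟩, ⟨-(K.1 * P), (K.2.mul hP).neg⟩)
      map_add' := fun a b => by
        ext1 <;> ext1 <;> simp only [Prod.fst_add, Prod.snd_add, Submodule.coe_add] <;> ring
      map_smul' := fun c a => by
        ext1 <;> ext1 <;> simp }
  have hΘ : Function.Injective Θ := by
    intro a b hab
    have := congrArg (fun x => (x.1 : MvPolynomial (Fin 3) ℂ)) hab
    exact Subtype.ext (mul_right_cancel₀ hQ0 this)
  have hker : LinearMap.ker Ψ = LinearMap.range Θ := by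
    ext ⟨A, B⟩
    constructor
    · intro h
      have h : A.1 * P + B.1 * Q = 0 := congrArg Subtype.val (LinearMap.mem_ker.mp h)
      obtain ⟨K, hK⟩ : P ∣ B.1 := hPQ.dvd_of_dvd_mul_right ⟨-A.1, by linear_combination h⟩
      have hK' : (-K).IsHomogeneous k :=
        (IsHomogeneous.of_mul_left hP hP0 (by rw [mul_comm, ← hK]; exact B.2)).neg
      refine ⟨⟨-K, hK'⟩, ?_⟩
      ext1 <;> ext1
      · change -K * Q = A.1
        refine mul_right_cancel₀ hP0 ?_
        rw [hK] at h
        linear_combination -h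
      · change -(-K * P) = B.1
        linear_combination -hK
    · rintro ⟨K, hK⟩
      rw [LinearMap.mem_ker, ← hK]
      ext1
      change K.1 * Q * P + -(K.1 * P) * Q = 0
      ring
  have hrange : LinearMap.range Ψ = formsIn P Q (k + m + n) := by
    ext ⟨G, hG⟩
    constructor
    · rintro ⟨⟨A, B⟩, hAB⟩
      exact Ideal.mem_span_pair.mpr ⟨A.1, B.1, congrArg Subtype.val hAB⟩
    · intro h
      obtain ⟨A, B, hAB⟩ := Ideal.mem_span_pair.mp h
      refine ⟨(⟨_, homogeneousComponent_isHomogeneous (k + n) A⟩,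
        ⟨_, homogeneousComponent_isHomogeneous (k + m) B⟩), Subtype.ext ?_⟩
      change homogeneousComponent (k + n) A * P + homogeneousComponent (k + m) B * Q = G
      rw [← homogeneousComponent_mul_of_isHomogeneous hP,
        ← homogeneousComponent_mul_of_isHomogeneous hQ, show k + n + m = k + m + n by ring,
        ← map_add, hAB]
      exact homogeneousComponent_eq_self hG
  have h1 := LinearMap.finrank_range_add_finrank_ker Ψ
  rw [hrange, hker, LinearMap.finrank_range_of_inj hΘ, Module.finrank_prod,
    finrank_homogeneousSubmodule, finrank_homogeneousSubmodule, finrank_homogeneousSubmodule] at h1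
  rw [finrank_homogeneousSubmodule]
  have e1 := two_mul_choose_two k
  have e2 := two_mul_choose_two (k + m)
  have e3 := two_mul_choose_two (k + n)
  have e4 := two_mul_choose_two (k + m + n)
  have e5 : (k + m + n + 2) * (k + m + n + 1) + (k + 2) * (k + 1) =
    (k + m + 2) * (k + m + 1) + (k + n + 2) * (k + n + 1) + 2 * (m * n) := by ring
  linarith

/-! ### Values and derivatives of forms at finitely many points -/

/-- The derivative of a polynomial at `v` in the direction `τ`. -/
def dirDeriv {n : ℕ} (v τ : Fin n → ℂ) : MvPolynomial (Fin n) ℂ →ₗ[ℂ] ℂ where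
  toFun G := ∑ k, τ k * eval v (pderiv k G)
  map_add' a b := by simp [mul_add, Finset.sum_add_distrib]
  map_smul' c a := by simp [Finset.mul_sum, smul_eval, mul_left_comm]

theorem dirDeriv_apply {n : ℕ} (v τ : Fin n → ℂ) (G : MvPolynomial (Fin n) ℂ) :
    dirDeriv v τ G = ∑ k, τ k * eval v (pderiv k G) := rfl

@[simp] theorem dirDeriv_mul {n : ℕ} (v τ : Fin n → ℂ) (G K : MvPolynomial (Fin n) ℂ) :
    dirDeriv v τ (G * K) = dirDeriv v τ G * eval v K + eval v G * dirDeriv v τ K := by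
  simp only [dirDeriv_apply, Derivation.leibniz, smul_eq_mul, map_add, map_mul, mul_add,
    Finset.sum_add_distrib, Finset.sum_mul, Finset.mul_sum]
  rw [add_comm]
  congr 1 <;> exact Finset.sum_congr rfl fun _ _ => by ring

@[simp] theorem dirDeriv_X {n : ℕ} (v τ : Fin n → ℂ) (i : Fin n) : dirDeriv v τ (X i) = τ i := by
  rw [dirDeriv_apply, Finset.sum_eq_single i] <;> simp +contextual [pderiv_X, eq_comm]

@[simp] theorem dirDeriv_C {n : ℕ} (v τ : Fin n → ℂ) (c : ℂ) : dirDeriv v τ (C c) = 0 := by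
  simp [dirDeriv_apply]

theorem dirDeriv_sq {n : ℕ} (v τ : Fin n → ℂ) (G : MvPolynomial (Fin n) ℂ) :
    dirDeriv v τ (G ^ 2) = 2 * eval v G * dirDeriv v τ G := by
  rw [sq, dirDeriv_mul]
  ring

theorem dirDeriv_self {n d : ℕ} {G : MvPolynomial (Fin n) ℂ} (hG : G.IsHomogeneous d)
    (v : Fin n → ℂ) : dirDeriv v v G = d * eval v G := by
  have := congrArg (eval v) hG.sum_X_mul_pderiv
  simpa [dirDeriv_apply] using this

theorem dirDeriv_add_right {n : ℕ} (v τ τ' : Fin n → ℂ) (G : MvPolynomial (Fin n) ℂ) :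
    dirDeriv v (τ + τ') G = dirDeriv v τ G + dirDeriv v τ' G := by
  simp [dirDeriv_apply, add_mul, Finset.sum_add_distrib]

theorem dirDeriv_smul_right {n : ℕ} (v τ : Fin n → ℂ) (c : ℂ) (G : MvPolynomial (Fin n) ℂ) :
    dirDeriv v (c • τ) G = c * dirDeriv v τ G := by
  simp [dirDeriv_apply, Finset.mul_sum, mul_assoc]

theorem dirDeriv_single {n : ℕ} (v : Fin n → ℂ) (i : Fin n) (G : MvPolynomial (Fin n) ℂ) :
    dirDeriv v (Pi.single i 1) G = eval v (pderiv i G) := by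
  simp [dirDeriv_apply, Pi.single_apply]

/-- A linear form that vanishes at `u` but not at `v`. -/
theorem exists_linear_form {n : ℕ} {u v : Fin n → ℂ} (hu : u ≠ 0) (huv : ∀ c : ℂ, v ≠ c • u) :
    ∃ l : MvPolynomial (Fin n) ℂ, l.IsHomogeneous 1 ∧ eval u l = 0 ∧ eval v l ≠ 0 ∧
      ∀ w, dirDeriv u w l = eval w l := by
  obtain ⟨i, hi⟩ := Function.ne_iff.mp hu
  by_contra! hc
  refine huv (v i / u i) (funext fun j => ?_)
  by_contra hj
  have := hc (C (u i) * X j - C (u j) * X i)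
    ((isHomogeneous_C_mul_X _ _).sub (isHomogeneous_C_mul_X _ _)) (by simp; ring)
    (by
      simp only [map_sub, map_mul, eval_C, eval_X]
      intro h
      apply hj
      have hi : u i ≠ 0 := hi
      simp only [Pi.smul_apply, smul_eq_mul]
      field_simp
      linear_combination h)
  obtain ⟨w, hw⟩ := this
  exact hw (by simp [map_sub])

/-- Forms of large degree take prescribed values and derivatives at finitely many points. -/
theorem exists_form_values {ι : Type*} [Fintype ι] {v τ : ι → Fin 3 → ℂ} (hv : ∀ i, v i ≠ 0)
    (hvv : ∀ i j, i ≠ j → ∀ c : ℂ, v i ≠ c • v j) (hτ : ∀ i, ∀ c : ℂ, τ i ≠ c • v i) (r : ℕ)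
    (y y' : ι → ℂ) : ∃ G : MvPolynomial (Fin 3) ℂ, G.IsHomogeneous (r + 2 * Fintype.card ι) ∧
      ∀ i, eval (v i) G = y i ∧ dirDeriv (v i) (τ i) G = y' i := by
  classical
  have h1 : ∀ i j, ∃ l : MvPolynomial (Fin 3) ℂ, l.IsHomogeneous 1 ∧ eval (v i) l ≠ 0 ∧
      (i ≠ j → eval (v j) l = 0) := by
    intro i j
    by_cases hij : i = j
    · obtain ⟨a, ha⟩ := Function.ne_iff.mp (hv i)
      exact ⟨X a, isHomogeneous_X _ _, by simpa using ha, fun h => absurd hij h⟩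
    · obtain ⟨l, hl, hl1, hl2, -⟩ := exists_linear_form (hv j) (hvv i j hij)
      exact ⟨l, hl, hl2, fun _ => hl1⟩
  choose l hl hl1 hl2 using h1
  choose m hm hm1 hm2 hm3 using fun i => exists_linear_form (hv i) (hτ i)
  -- `E i` is nonzero at `v i` and vanishes to second order at the other points. The forms `l i i` and `m i`
  -- adjust the value and the derivative at `v i`.
  let E : ι → MvPolynomial (Fin 3) ℂ := fun i => l i i ^ r * ∏ j ∈ Finset.univ.erase i, l i j ^ 2
  have hE : ∀ i, (E i).IsHomogeneous (r + 2 * (Fintype.card ι - 1)) := by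
    intro i
    refine IsHomogeneous.mul (by simpa using (hl i i).pow r) ?_
    have := IsHomogeneous.prod (Finset.univ.erase i) (fun j => l i j ^ 2) (fun _ => 2)
      (fun j _ => by simpa using (hl i j).pow 2)
    simpa [Finset.card_erase_of_mem, mul_comm] using this
  have hE1 : ∀ i, eval (v i) (E i) ≠ 0 := by
    intro i
    simp only [E, map_mul, map_pow, map_prod]
    exact mul_ne_zero (pow_ne_zero _ (hl1 i i))
      (Finset.prod_ne_zero_iff.mpr fun j _ => pow_ne_zero _ (hl1 i j))
  have hE2 : ∀ i j, i ≠ j → ∃ K, E i = l i j ^ 2 * K := by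
    intro i j hij
    refine (Dvd.dvd.mul_left (Finset.dvd_prod_of_mem (fun j => l i j ^ 2) ?_) _)
    simp [hij.symm]
  let a : ι → ℂ := fun i => y i / eval (v i) (E i * l i i ^ 2)
  let b : ι → ℂ := fun i => (y' i - a i * dirDeriv (v i) (τ i) (E i * l i i ^ 2)) /
    (eval (v i) (E i * l i i) * eval (τ i) (m i))
  refine ⟨∑ i, E i * (C (a i) * l i i ^ 2 + C (b i) * (l i i * m i)), ?_, fun i => ?_⟩
  · refine IsHomogeneous.sum _ _ _ fun i _ => ?_
    have hc : 0 < Fintype.card ι := Fintype.card_pos_iff.mpr ⟨i⟩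
    rw [show r + 2 * Fintype.card ι = (r + 2 * (Fintype.card ι - 1)) + 2 by omega]
    refine (hE i).mul (IsHomogeneous.add ?_ ?_)
    · exact ((by simpa using (hl i i).pow 2 : (l i i ^ 2).IsHomogeneous 2)).C_mul _
    · exact ((hl i i).mul (hm i)).C_mul _
  · have h0 : ∀ k, k ≠ i → eval (v i) (E k * (C (a k) * l k k ^ 2 + C (b k) * (l k k * m k))) = 0 ∧
        dirDeriv (v i) (τ i) (E k * (C (a k) * l k k ^ 2 + C (b k) * (l k k * m k))) = 0 := by
      intro k hk
      obtain ⟨K, hK⟩ := hE2 k i hk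
      rw [hK]
      simp only [map_mul, map_pow, hl2 k i hk, dirDeriv_mul, dirDeriv_sq]
      constructor <;> ring
    rw [map_sum, map_sum, Finset.sum_eq_single i (fun k _ hk => (h0 k hk).1) (by simp),
      Finset.sum_eq_single i (fun k _ hk => (h0 k hk).2) (by simp)]
    have e1 := hE1 i
    have e2 := hl1 i i
    have e3 := hm2 i
    constructor
    · simp only [map_mul, map_add, map_pow, eval_C, hm1, a]
      field_simp
      ring
    · simp only [dirDeriv_mul, map_mul, map_add, map_pow, eval_C, hm1, hm3, dirDeriv_C, b]
      field_simp
      ring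

/-! ### Finiteness of intersections and normality of smooth plane curves -/

theorem exists_ne_smul {v : Fin 3 → ℂ} (hv : v ≠ 0) : ∃ τ : Fin 3 → ℂ, ∀ c : ℂ, τ ≠ c • v := by
  obtain ⟨i, hi⟩ := Function.ne_iff.mp hv
  refine ⟨Pi.single (i + 1) 1, fun c hc => ?_⟩
  have h1 := congrFun hc i
  have h2 := congrFun hc (i + 1)
  have h3 : i ≠ i + 1 := by fin_cases i <;> decide
  simp only [Pi.smul_apply, smul_eq_mul, Pi.single_eq_of_ne h3, Pi.single_eq_same] at h1 h2
  rcases mul_eq_zero.mp h1.symm with h | h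
  · simp [h] at h2
  · exact hi h

theorem eval_eq_zero_of_mem_span_pair {n : ℕ} {P Q G : MvPolynomial (Fin n) ℂ}
    (h : G ∈ Ideal.span {P, Q}) {v : Fin n → ℂ} (hP : eval v P = 0) (hQ : eval v Q = 0) :
    eval v G = 0 := by
  obtain ⟨A, B, rfl⟩ := Ideal.mem_span_pair.mp h
  simp [hP, hQ]

open Projectivization LinearAlgebra.Projectivization in
theorem ne_smul_of_rep {x y : ℙ ℂ (Fin 3 → ℂ)} (h : x ≠ y) (c : ℂ) : x.rep ≠ c • y.rep := by
  intro hc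
  apply h
  rw [← x.mk_rep, ← y.mk_rep, mk_eq_mk_iff']
  exact ⟨c, hc.symm⟩

open Projectivization LinearAlgebra.Projectivization in
/-- Coprime forms have finitely many common zeros in the projective plane, as the values of forms of
large degree at these points are independent linear functionals on a quotient of bounded dimension. -/
theorem finite_common_zeros {P Q : MvPolynomial (Fin 3) ℂ} {m n : ℕ} (hP : P.IsHomogeneous m)
    (hQ : Q.IsHomogeneous n) (hP0 : P ≠ 0) (hQ0 : Q ≠ 0) (hPQ : IsRelPrime P Q) :
    {x : ℙ ℂ (Fin 3 → ℂ) | eval x.rep P = 0 ∧ eval x.rep Q = 0}.Finite := by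
  by_contra hinf
  obtain ⟨t, ht, hcard⟩ := Set.Infinite.exists_subset_card_eq hinf (m * n + 1)
  choose τ hτ using fun i : t => exists_ne_smul (rep_nonzero i.1)
  let d := 2 * Fintype.card t + m + n
  -- Evaluation at `m n + 1` common zeros would be onto, but it factors through a space of dimension `m n`.
  let E : homogeneousSubmodule (Fin 3) ℂ d →ₗ[ℂ] (t → ℂ) :=
    { toFun := fun G i => eval i.1.rep G.1
      map_add' := fun a b => by ext i; simp
      map_smul' := fun c a => by ext i; simp [smul_eval] }
  have hE : Function.Surjective E := by
    intro y
    obtain ⟨G, hG, hGy⟩ := exists_form_values (v := fun i : t => i.1.rep) (τ := τ)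
      (fun i => rep_nonzero i.1) (fun i j hij c => ne_smul_of_rep (Subtype.coe_ne_coe.mpr hij) c)
      hτ (m + n) y 0
    rw [show m + n + 2 * Fintype.card t = d by ring] at hG
    refine ⟨⟨G, hG⟩, funext fun i => ?_⟩
    exact (hGy i).1
  have hker : formsIn P Q d ≤ LinearMap.ker E := by
    intro G hG
    have hG' : G.1 ∈ Ideal.span {P, Q} := hG
    refine LinearMap.mem_ker.mpr (funext fun i => ?_)
    have hi := ht (Finset.mem_coe.mpr i.2)
    exact eval_eq_zero_of_mem_span_pair hG' hi.1 hi.2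
  have h1 := LinearMap.finrank_range_add_finrank_ker E
  have h2 := Submodule.finrank_mono hker
  have h3 : Module.finrank ℂ (formsIn P Q d) + m * n =
      Module.finrank ℂ (homogeneousSubmodule (Fin 3) ℂ d) :=
    finrank_formsIn_add hP hQ hP0 hQ0 hPQ (2 * Fintype.card t)
  rw [LinearMap.range_eq_top.mpr hE, finrank_top, Module.finrank_fintype_fun_eq_card,
    Fintype.card_coe, hcard] at h1
  omega

open Projectivization LinearAlgebra.Projectivization in
theorem exists_sliceForm_of_isRelPrime {P Q : MvPolynomial (Fin 3) ℂ} {m n : ℕ}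
    (hP : P.IsHomogeneous m) (hQ : Q.IsHomogeneous n) (hP0 : P ≠ 0) (hQ0 : Q ≠ 0)
    (hPQ : IsRelPrime P Q) :
    ∃ c, ∀ v ≠ 0, eval v P = 0 → eval v Q = 0 → eval v (sliceForm c) ≠ 0 := by
  obtain ⟨c, hc⟩ := exists_sliceForm_ne_zero _
    ((finite_common_zeros hP hQ hP0 hQ0 hPQ).image Projectivization.rep) (by
      rintro ⟨x, -, hx⟩
      exact rep_nonzero x hx)
  refine ⟨c, fun v hv h1 h2 h3 => ?_⟩
  obtain ⟨a, ha⟩ := exists_smul_eq_mk_rep ℂ v hv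
  have ha : (a : ℂ) • v = (mk ℂ v hv).rep := ha
  refine hc _ ⟨mk ℂ v hv, ⟨?_, ?_⟩, rfl⟩ ?_
  · rw [← ha, hP.eval_smul, h1, mul_zero]
  · rw [← ha, hQ.eval_smul, h2, mul_zero]
  · simp only [sliceForm, map_sub, map_mul, eval_X, eval_C, ← ha, Pi.smul_apply,
      smul_eq_mul] at h3 ⊢
    linear_combination (a : ℂ) * h3

/-- The restriction of polynomials to the line through `v` and the origin. -/
def lineHom {n : ℕ} (v : Fin n → ℂ) : MvPolynomial (Fin n) ℂ →ₐ[ℂ] Polynomial ℂ :=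
  aeval fun j => Polynomial.C (v j) * Polynomial.X

theorem eval_lineHom {n : ℕ} (v : Fin n → ℂ) (c : ℂ) (G : MvPolynomial (Fin n) ℂ) :
    (lineHom v G).eval c = eval (c • v) G := by
  have : (Polynomial.aeval c).comp (lineHom v) = aeval (R := ℂ) (c • v) := by
    ext i
    simp [lineHom, mul_comm c]
  simpa [aeval_eq_eval] using congrArg (fun φ => φ G) this

theorem lineHom_eq_zero_iff {n : ℕ} {v : Fin n → ℂ} {G : MvPolynomial (Fin n) ℂ} :
    lineHom v G = 0 ↔ ∀ c : ℂ, eval (c • v) G = 0 := by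
  refine ⟨fun h c => by rw [← eval_lineHom, h, Polynomial.eval_zero], fun h => ?_⟩
  exact Polynomial.funext fun c => by rw [eval_lineHom, h, Polynomial.eval_zero]

/-- The ideal of a line through the origin is generated by linear forms. -/
theorem exists_sum_of_lineHom_eq_zero {n : ℕ} {v : Fin n → ℂ} {i : Fin n} (hi : v i ≠ 0)
    {G : MvPolynomial (Fin n) ℂ} (h : lineHom v G = 0) :
    ∃ α : Fin n → MvPolynomial (Fin n) ℂ, G = ∑ j, α j * (C (v i) * X j - C (v j) * X i) := by
  set I := Ideal.span (Set.range fun j => (C (v i) * X j - C (v j) * X i : MvPolynomial (Fin n) ℂ))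
    with hI
  have h1 : Ideal.Quotient.mkₐ ℂ I = (Polynomial.aeval (Ideal.Quotient.mkₐ ℂ I
      (C (v i)⁻¹ * X i))).comp (lineHom v) := by
    ext j
    have : Ideal.Quotient.mkₐ ℂ I (X j) = Ideal.Quotient.mkₐ ℂ I (C (v j) * (C (v i)⁻¹ * X i)) := by
      refine Ideal.Quotient.eq.mpr ?_
      have : (X j - C (v j) * (C (v i)⁻¹ * X i) : MvPolynomial (Fin n) ℂ) =
          C (v i)⁻¹ * (C (v i) * X j - C (v j) * X i) := by
        have : (C (v i)⁻¹ * C (v i) : MvPolynomial (Fin n) ℂ) = 1 := by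
          rw [← C_mul, inv_mul_cancel₀ hi, C_1]
        linear_combination -X j * this
      rw [this]
      exact I.mul_mem_left _ (Ideal.subset_span ⟨j, rfl⟩)
    rw [this]
    simp only [lineHom, AlgHom.comp_apply, aeval_X, map_mul, Polynomial.aeval_X]
    congr 1
    rw [Polynomial.aeval_C]
    rfl
  have h2 : G ∈ I := by
    have := congrArg (fun φ => φ G) h1
    simp only [AlgHom.comp_apply, h, map_zero] at this
    exact Ideal.Quotient.eq_zero_iff_mem.mp this
  obtain ⟨α, hα⟩ := (Ideal.mem_span_range_iff_exists_fun).mp h2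
  exact ⟨α, hα.symm⟩

/-- If a prime ideal `p` of a Noetherian domain is locally principal, then localization at `p` is
integrally closed, so that divisibility of squares implies divisibility locally at `p`. -/
theorem exists_dvd_mul_of_sq_dvd_sq {B : Type*} [CommRing B] [IsDomain B] [IsNoetherianRing B]
    {p : Ideal B} [p.IsPrime] {l : B} (hl : l ∈ p) (hp : ∀ y ∈ p, ∃ s ∉ p, l ∣ s * y) {a e : B}
    (h : a ^ 2 ∣ e ^ 2) : ∃ s ∉ p, a ∣ s * e := by
  have hunit : ∀ x, x ∉ p → IsUnit (algebraMap B (Localization.AtPrime p) x) := fun x hx =>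
    IsLocalization.map_units _ (⟨x, hx⟩ : p.primeCompl)
  have hprinc : IsLocalRing.maximalIdeal (Localization.AtPrime p) =
      Ideal.span {algebraMap B (Localization.AtPrime p) l} := by
    rw [← Localization.AtPrime.map_eq_maximalIdeal]
    refine le_antisymm ?_ ?_
    · rw [Ideal.map_le_iff_le_comap]
      intro y hy
      obtain ⟨s, hs, k, hk⟩ := hp y hy
      rw [Ideal.mem_comap, ← Ideal.unit_mul_mem_iff_mem _ (hunit s hs), ← map_mul, hk, map_mul]
      exact Ideal.mul_mem_right _ _ (Ideal.mem_span_singleton_self _)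
    · rw [Ideal.span_singleton_le_iff_mem]
      exact Ideal.mem_map_of_mem _ hl
  have htfae := (tfae_of_isNoetherianRing_of_isLocalRing_of_isDomain (Localization.AtPrime p)).out
    4 3 rfl rfl
  have hic : IsIntegrallyClosed (Localization.AtPrime p) := (htfae.mp ⟨⟨_, hprinc⟩⟩).1
  have hsq : algebraMap B (Localization.AtPrime p) a ^ 2 ∣
      algebraMap B (Localization.AtPrime p) e ^ 2 := by
    rw [← map_pow, ← map_pow]
    exact map_dvd _ h
  obtain ⟨x, hx⟩ := (IsIntegrallyClosed.pow_dvd_pow_iff two_ne_zero).mp hsq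
  obtain ⟨⟨b, s⟩, hbs⟩ := IsLocalization.surj p.primeCompl x
  refine ⟨s, s.2, b, ?_⟩
  apply IsLocalization.injective (Localization.AtPrime p) p.primeCompl_le_nonZeroDivisors
  rw [map_mul, map_mul, hx]
  linear_combination algebraMap B (Localization.AtPrime p) a * hbs

theorem exists_third_index {i k : Fin 3} (hki : k ≠ i) :
    ∃ j, ∀ f : Fin 3 → MvPolynomial (Fin 3) ℂ, ∑ x, f x = f i + f k + f j := by
  fin_cases i <;> fin_cases k <;> simp only [ne_eq, not_true_eq_false] at hki
  exacts [⟨2, fun f => by simp [Fin.sum_univ_three]⟩,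
    ⟨1, fun f => by simp [Fin.sum_univ_three]; ring⟩,
    ⟨2, fun f => by simp [Fin.sum_univ_three]; ring⟩,
    ⟨0, fun f => by simp [Fin.sum_univ_three]; ring⟩,
    ⟨1, fun f => by simp [Fin.sum_univ_three]; ring⟩,
    ⟨0, fun f => by simp [Fin.sum_univ_three]; ring⟩]

/-- On a smooth plane curve `g = 0`, the local ring at the generic point of the line over a point is
a discrete valuation ring. -/
theorem exists_mul_mem_of_sq_mem {g a e δ : MvPolynomial (Fin 3) ℂ} {d : ℕ}
    (hg : g.IsHomogeneous d) (hgi : Irreducible g) {v : Fin 3 → ℂ} (hv : v ≠ 0)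
    (hgv : eval v g = 0) (hsm : ∃ i, eval v (pderiv i g) ≠ 0)
    (h : δ * a ^ 2 - e ^ 2 ∈ Ideal.span {g}) :
    ∃ s, lineHom v s ≠ 0 ∧ s * e ∈ Ideal.span {a, g} := by
  obtain ⟨i, hi⟩ := Function.ne_iff.mp hv
  have hi : v i ≠ 0 := hi
  have hgφ : lineHom v g = 0 :=
    lineHom_eq_zero_iff.mpr fun c => by rw [hg.eval_smul, hgv, mul_zero]
  obtain ⟨α, hα⟩ := exists_sum_of_lineHom_eq_zero hi hgφ
  let l : Fin 3 → MvPolynomial (Fin 3) ℂ := fun j => C (v i) * X j - C (v j) * X i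
  have hl : ∀ j, eval v (l j) = 0 := fun j => by simp [l]; ring
  have hli : l i = 0 := by simp [l]
  -- one of the coefficients `α k`, `k ≠ i`, is invertible at `v`
  obtain ⟨k, hki, hk⟩ : ∃ k, k ≠ i ∧ eval v (α k) ≠ 0 := by
    by_contra! hc
    have h1 : ∀ τ, dirDeriv v τ g = 0 := by
      intro τ
      rw [hα, map_sum]
      refine Finset.sum_eq_zero fun j _ => ?_
      rw [dirDeriv_mul]
      change _ * eval v (l j) + _ * dirDeriv v τ (l j) = 0
      rw [hl j]
      by_cases hj : j = i
      · subst hj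
        rw [hli]
        simp
      · rw [hc j hj]
        ring
    obtain ⟨j, hj⟩ := hsm
    exact hj (by rw [← dirDeriv_single, h1])
  obtain ⟨j, hj⟩ := exists_third_index hki
  have : (Ideal.span {g}).IsPrime := (Ideal.span_singleton_prime hgi.ne_zero).mpr hgi.prime
  let π : MvPolynomial (Fin 3) ℂ →+* MvPolynomial (Fin 3) ℂ ⧸ Ideal.span {g} :=
    Ideal.Quotient.mk (Ideal.span {g})
  have hπg : π g = 0 := Ideal.Quotient.eq_zero_iff_mem.mpr (Ideal.mem_span_singleton_self g)
  -- The kernel of `φ` is the prime ideal of the line through `v` in the coordinate ring of the cone `g = 0`;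
  -- as `α k` is a unit there, the single linear form `l j` generates it locally.
  let φ : MvPolynomial (Fin 3) ℂ ⧸ Ideal.span {g} →+* Polynomial ℂ :=
    Ideal.Quotient.lift _ (lineHom v).toRingHom (by
      intro x hx
      obtain ⟨y, rfl⟩ := Ideal.mem_span_singleton.mp hx
      change lineHom v (g * y) = 0
      rw [map_mul, hgφ, zero_mul])
  have hmem : ∀ x, π x ∈ RingHom.ker φ ↔ lineHom v x = 0 := fun x => Iff.rfl
  have hp : (RingHom.ker φ).IsPrime := RingHom.ker_isPrime φ
  obtain ⟨s, hs, t, ht⟩ := exists_dvd_mul_of_sq_dvd_sq (p := RingHom.ker φ) (l := π (l j))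
    (a := π a) (e := π e)
    ((hmem _).mpr (lineHom_eq_zero_iff.mpr fun c => by simp [l]; ring)) (by
      intro y hy
      obtain ⟨y, rfl⟩ := Ideal.Quotient.mk_surjective y
      obtain ⟨β, rfl⟩ := exists_sum_of_lineHom_eq_zero hi ((hmem y).mp hy)
      refine ⟨π (α k), fun h => hk (by simpa using lineHom_eq_zero_iff.mp ((hmem _).mp h) 1),
        π (β j * α k - β k * α j), ?_⟩
      change π (α k) * π _ = _
      rw [← map_mul, ← map_mul]
      refine Ideal.Quotient.eq.mpr (Ideal.mem_span_singleton.mpr ⟨β k, ?_⟩)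
      have h1 := hα
      rw [hj] at h1 ⊢
      change g = α i * l i + α k * l k + α j * l j at h1
      change α k * (β i * l i + β k * l k + β j * l j) - _ = _
      rw [hli] at h1 ⊢
      linear_combination -β k * h1)
    ⟨π δ, by
      rw [← map_pow, ← map_pow, ← map_mul, mul_comm (a ^ 2)]
      exact (Ideal.Quotient.eq.mpr h).symm⟩
  obtain ⟨s, rfl⟩ := Ideal.Quotient.mk_surjective s
  obtain ⟨t, rfl⟩ := Ideal.Quotient.mk_surjective t
  refine ⟨s, hs, ?_⟩
  obtain ⟨K, hK⟩ := Ideal.mem_span_singleton.mp (Ideal.Quotient.eq.mp ht)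
  exact Ideal.mem_span_pair.mpr ⟨t, K, by linear_combination -hK⟩

theorem aeval_smul_of_isHomogeneous {G : MvPolynomial (Fin 3) ℂ} {d : ℕ} (hG : G.IsHomogeneous d)
    (c : ℂ) : aeval (fun j => C c * X j : Fin 3 → MvPolynomial (Fin 3) ℂ) G = C (c ^ d) * G := by
  refine funext fun v => ?_
  have : (aeval v).comp (aeval (fun j => C c * X j : Fin 3 → MvPolynomial (Fin 3) ℂ)) =
      aeval (R := ℂ) (c • v) := by
    ext i
    simp
  have h := congrArg (fun φ => φ G) this
  simp only [AlgHom.comp_apply, aeval_eq_eval] at h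
  change eval v _ = _ at h
  rw [h]
  change eval (c • v) G = _
  rw [hG.eval_smul]
  simp

/-- For forms, membership in `(P, Q)` at the generic point of the line over `v` implies membership in
a neighbourhood of `v`. -/
theorem exists_eval_ne_zero_of_lineHom_ne_zero {P Q e s : MvPolynomial (Fin 3) ℂ} {m n k : ℕ}
    (hP : P.IsHomogeneous m) (hQ : Q.IsHomogeneous n) (he : e.IsHomogeneous k) {v : Fin 3 → ℂ}
    (hs : lineHom v s ≠ 0) (h : s * e ∈ Ideal.span {P, Q}) :
    ∃ s', eval v s' ≠ 0 ∧ s' * e ∈ Ideal.span {P, Q} := by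
  obtain ⟨c, hc⟩ := Polynomial.exists_eval_ne_zero_of_natDegree_lt_card _
    (mul_ne_zero Polynomial.X_ne_zero hs)
    ((Cardinal.natCast_lt_aleph0).trans_le (Cardinal.aleph0_le_mk ℂ))
  rw [Polynomial.eval_mul, Polynomial.eval_X, eval_lineHom] at hc
  have hc0 : c ≠ 0 := left_ne_zero_of_mul hc
  -- Rescaling moves a point `c v` of the line with `s (c v) ≠ 0` to `v` and multiplies forms by constants.
  let ψ : MvPolynomial (Fin 3) ℂ →ₐ[ℂ] MvPolynomial (Fin 3) ℂ := aeval fun j => C c * X j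
  refine ⟨ψ s, ?_, ?_⟩
  · have : (aeval v).comp ψ = aeval (R := ℂ) (c • v) := by
      ext i
      simp [ψ]
    have h := congrArg (fun φ => φ s) this
    simp only [AlgHom.comp_apply, aeval_eq_eval] at h
    exact h ▸ right_ne_zero_of_mul hc
  · obtain ⟨A, B, hAB⟩ := Ideal.mem_span_pair.mp h
    have h1 := congrArg ψ hAB
    simp only [map_mul, map_add] at h1
    simp only [ψ, aeval_smul_of_isHomogeneous hP, aeval_smul_of_isHomogeneous hQ,
      aeval_smul_of_isHomogeneous he] at h1
    have h2 : (C ((c ^ k)⁻¹) * C (c ^ k) : MvPolynomial (Fin 3) ℂ) = 1 := by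
      rw [← C_mul, inv_mul_cancel₀ (pow_ne_zero _ hc0), C_1]
    refine Ideal.mem_span_pair.mpr ⟨C ((c ^ k)⁻¹) * ψ A * C (c ^ m), C ((c ^ k)⁻¹) * ψ B * C (c ^ n),
      ?_⟩
    linear_combination C ((c ^ k)⁻¹) * h1 + ψ s * e * h2

/-- Normality of the cone over a smooth plane curve `g = 0`, for square roots: if `δ a² ≡ e²` modulo
`g`, with forms `a` and `e` and `g ∤ a`, then `e` is a multiple of `a` modulo `g`. -/
theorem mem_span_pair_of_sq_mem {g a e δ : MvPolynomial (Fin 3) ℂ} {d m k : ℕ}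
    (hg : g.IsHomogeneous d) (hd : d ≠ 0) (hsm : IsSmoothHypersurface g) (ha : a.IsHomogeneous m)
    (he : e.IsHomogeneous k) (hga : ¬ g ∣ a) (h : δ * a ^ 2 - e ^ 2 ∈ Ideal.span {g}) :
    e ∈ Ideal.span {a, g} := by
  have hgi := irreducible_of_isSmoothHypersurface hg hd hsm
  have ha0 : a ≠ 0 := fun h => hga (h ▸ dvd_zero g)
  refine mem_span_pair_of_forall_exists (hg.eval_zero hd)
    (exists_sliceForm_of_isRelPrime ha hg ha0 hgi.ne_zero
      (hgi.isRelPrime_iff_not_dvd.mpr hga).symm) fun v hv => ?_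
  by_cases hgv : eval v g = 0
  · obtain ⟨s, hs, hse⟩ := exists_mul_mem_of_sq_mem hg hgi hv hgv (hsm v hv hgv) h
    exact exists_eval_ne_zero_of_lineHom_ne_zero ha hg he hs hse
  · exact ⟨g, hgv, Ideal.mul_mem_right _ _ (Ideal.subset_span (by simp))⟩

/-! ### Counting intersection points of multiplicity two -/

theorem dirDeriv_smul_left {n d : ℕ} {G : MvPolynomial (Fin n) ℂ} (hG : G.IsHomogeneous d)
    (c : ℂ) (v τ : Fin n → ℂ) : dirDeriv (c • v) τ G = c ^ (d - 1) * dirDeriv v τ G := by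
  simp only [dirDeriv_apply, Finset.mul_sum]
  refine Finset.sum_congr rfl fun k _ => ?_
  rw [(hG.pderiv (i := k)).eval_smul]
  ring

/-- The ideal of a line through the origin in affine three-space is generated by two linear forms. -/
theorem exists_line_equations {v : Fin 3 → ℂ} (hv : v ≠ 0) :
    ∃ l₁ l₂ : MvPolynomial (Fin 3) ℂ, (∀ c : ℂ, eval (c • v) l₁ = 0) ∧
      (∀ c : ℂ, eval (c • v) l₂ = 0) ∧ (∀ u w, dirDeriv u w l₁ = eval w l₁) ∧
      (∀ u w, dirDeriv u w l₂ = eval w l₂) ∧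
      (∀ w, eval w l₁ = 0 → eval w l₂ = 0 → ∃ c : ℂ, w = c • v) ∧
      ∀ G, (∀ c : ℂ, eval (c • v) G = 0) → ∃ A B, G = A * l₁ + B * l₂ := by
  obtain ⟨i, hi⟩ := Function.ne_iff.mp hv
  have hi : v i ≠ 0 := hi
  have hki : i + 1 ≠ i := by fin_cases i <;> decide
  obtain ⟨j, hj⟩ := exists_third_index hki
  let l : Fin 3 → MvPolynomial (Fin 3) ℂ := fun j => C (v i) * X j - C (v j) * X i
  have hl : ∀ j, ∀ c : ℂ, eval (c • v) (l j) = 0 := fun j c => by simp [l]; ring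
  have hd : ∀ j u w, dirDeriv u w (l j) = eval w (l j) := fun j u w => by simp [l]
  have hli : l i = 0 := by simp [l]
  refine ⟨l (i + 1), l j, hl _, hl _, hd _, hd _, fun w h1 h2 => ⟨w i / v i, ?_⟩, fun G hG => ?_⟩
  · have h3 : ∀ x, eval w (l x) = 0 := by
      intro x
      have hx : x = i ∨ x = i + 1 ∨ x = j := by
        have := hj (fun y => if y = x then 1 else 0)
        rw [Finset.sum_ite_eq' Finset.univ x, if_pos (Finset.mem_univ x)] at this
        by_contra! hc
        simp [hc.1.symm, hc.2.1.symm, hc.2.2.symm] at this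
      rcases hx with rfl | rfl | rfl
      · rw [hli, map_zero]
      · exact h1
      · exact h2
    ext x
    have h4 := h3 x
    simp only [l, map_sub, map_mul, eval_C, eval_X] at h4
    simp only [Pi.smul_apply, smul_eq_mul]
    field_simp
    linear_combination h4
  · obtain ⟨α, hα⟩ := exists_sum_of_lineHom_eq_zero hi (lineHom_eq_zero_iff.mpr hG)
    rw [hj] at hα
    refine ⟨α (i + 1), α j, ?_⟩
    change G = α i * l i + _ + _ at hα
    rw [hli] at hα
    linear_combination hα

/-- Let `f` and `g` be forms such that `(f, g) = (f, b²)` near `v`, where `b = 0` is transversal to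
`f = 0` at `v`. Then a form whose value and derivative along `f = 0` vanish at `v` belongs to the ideal
`(f, g)` near `v`. -/
theorem exists_mul_mem_of_dirDeriv_eq_zero {f b G : MvPolynomial (Fin 3) ℂ} {m k d : ℕ}
    (hf : f.IsHomogeneous m) (hb : b.IsHomogeneous k) (hG : G.IsHomogeneous d)
    {I : Ideal (MvPolynomial (Fin 3) ℂ)} (hfI : f ∈ I) (hbI : b ^ 2 ∈ I)
    {v τ : Fin 3 → ℂ} (hv : v ≠ 0) (hτ : ∀ c : ℂ, τ ≠ c • v)
    (hfv : eval v f = 0) (hbv : eval v b = 0) (hGv : eval v G = 0)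
    (hsm : ∃ w, dirDeriv v w f ≠ 0)
    (hfτ : dirDeriv v τ f = 0) (hbτ : dirDeriv v τ b ≠ 0) (hGτ : dirDeriv v τ G = 0) :
    ∃ s, eval v s ≠ 0 ∧ s * G ∈ I := by
  obtain ⟨l₁, l₂, hl₁, hl₂, hd₁, hd₂, hl, hgen⟩ := exists_line_equations hv
  obtain ⟨f₁, f₂, ef⟩ := hgen f fun c => by rw [hf.eval_smul, hfv, mul_zero]
  obtain ⟨b₁, b₂, eb⟩ := hgen b fun c => by rw [hb.eval_smul, hbv, mul_zero]
  obtain ⟨G₁, G₂, eG⟩ := hgen G fun c => by rw [hG.eval_smul, hGv, mul_zero]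
  have hder : ∀ (c : ℂ) (w : Fin 3 → ℂ) (A B : MvPolynomial (Fin 3) ℂ),
      dirDeriv (c • v) w (A * l₁ + B * l₂) =
        eval (c • v) A * eval w l₁ + eval (c • v) B * eval w l₂ := by
    intro c w A B
    simp [map_add, hl₁, hl₂, hd₁, hd₂]
  have hder1 := fun w A B => hder 1 w A B
  simp only [one_smul] at hder1
  -- The gradients of `f` and `G` in the coordinates `l₁, l₂` both annihilate `τ`, so they are proportional
  -- along the line through `v`.
  have hE : ∀ c : ℂ, eval (c • v) (f₁ * G₂ - f₂ * G₁) = 0 := by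
    intro c
    have h1 := dirDeriv_smul_left hf c v τ
    have h2 := dirDeriv_smul_left hG c v τ
    rw [hfτ, mul_zero, ef, hder] at h1
    rw [hGτ, mul_zero, eG, hder] at h2
    simp only [map_sub, map_mul]
    by_cases h3 : eval τ l₁ = 0
    · have h4 : eval τ l₂ ≠ 0 := fun h4 => by
        obtain ⟨c, hc⟩ := hl τ h3 h4
        exact hτ c hc
      refine (mul_eq_zero.mp ?_).resolve_right h4
      rw [h3] at h1 h2
      linear_combination eval (c • v) f₁ * h2 - eval (c • v) G₁ * h1
    · refine (mul_eq_zero.mp ?_).resolve_right h3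
      linear_combination eval (c • v) G₂ * h1 - eval (c • v) f₂ * h2
  obtain ⟨E₁, E₂, eE⟩ := hgen _ hE
  -- The Jacobian of `f` and `b` is invertible at `v`; by Cramer's rule, applied twice, its square times `G`
  -- lies in `(f, b²)`.
  have hΔ : eval v (f₁ * b₂ - f₂ * b₁) ≠ 0 := by
    intro h0
    simp only [map_sub, map_mul] at h0
    rw [ef, hder1] at hfτ
    rw [eb, hder1] at hbτ
    have h1 : eval v f₁ = 0 := by
      refine (mul_eq_zero.mp ?_).resolve_right hbτ
      linear_combination eval v b₁ * hfτ + eval τ l₂ * h0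
    have h2 : eval v f₂ = 0 := by
      refine (mul_eq_zero.mp ?_).resolve_right hbτ
      linear_combination eval v b₂ * hfτ - eval τ l₁ * h0
    obtain ⟨w, hw⟩ := hsm
    rw [ef, hder1, h1, h2] at hw
    simp at hw
  refine ⟨(f₁ * b₂ - f₂ * b₁) ^ 2, by rw [map_pow]; exact pow_ne_zero _ hΔ, ?_⟩
  have key : (f₁ * b₂ - f₂ * b₁) ^ 2 * G =
      ((f₁ * b₂ - f₂ * b₁) * (G₁ * b₂ - G₂ * b₁) + (E₁ * b₂ - E₂ * b₁) * b) * f +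
        (f₁ * E₂ - f₂ * E₁) * b ^ 2 := by
    have e1 : (f₁ * b₂ - f₂ * b₁) * G = (G₁ * b₂ - G₂ * b₁) * f + (f₁ * G₂ - f₂ * G₁) * b := by
      rw [ef, eb, eG]; ring
    have e2 : (f₁ * b₂ - f₂ * b₁) * (f₁ * G₂ - f₂ * G₁) =
        (E₁ * b₂ - E₂ * b₁) * f + (f₁ * E₂ - f₂ * E₁) * b := by
      rw [eE, ef, eb]; ring
    linear_combination (f₁ * b₂ - f₂ * b₁) * e1 + b * e2
  rw [key]
  exact I.add_mem (I.mul_mem_left _ hfI) (I.mul_mem_left _ hbI)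

open Projectivization LinearAlgebra.Projectivization in
/-- Bézout's theorem for two plane curves that meet with multiplicity two at every common point, where
multiplicity two means that `(f, g) = (f, b²)` locally, with `b = 0` transversal to `f = 0`. -/
theorem two_mul_ncard_common_zeros {f g : MvPolynomial (Fin 3) ℂ} {m n : ℕ}
    (hf : f.IsHomogeneous m) (hg : g.IsHomogeneous n) (hn : n ≠ 0) (hf0 : f ≠ 0) (hg0 : g ≠ 0)
    (hfg : IsRelPrime f g) (hsm : IsSmoothHypersurface f)
    (h : ∀ v ≠ 0, eval v f = 0 → eval v g = 0 → ∃ (b : MvPolynomial (Fin 3) ℂ) (k : ℕ)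
      (τ : Fin 3 → ℂ), b.IsHomogeneous k ∧ eval v b = 0 ∧ b ^ 2 ∈ Ideal.span {f, g} ∧
        (∀ c : ℂ, τ ≠ c • v) ∧ dirDeriv v τ f = 0 ∧ dirDeriv v τ g = 0 ∧ dirDeriv v τ b ≠ 0) :
    {x : ℙ ℂ (Fin 3 → ℂ) | eval x.rep f = 0 ∧ eval x.rep g = 0}.Finite ∧
    2 * {x : ℙ ℂ (Fin 3 → ℂ) | eval x.rep f = 0 ∧ eval x.rep g = 0}.ncard = m * n := by
  have hfin := finite_common_zeros hf hg hf0 hg0 hfg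
  refine ⟨hfin, ?_⟩
  set Z := {x : ℙ ℂ (Fin 3 → ℂ) | eval x.rep f = 0 ∧ eval x.rep g = 0} with hZ
  have := hfin.fintype
  choose b k τ hb hbv hbI hτ hτf hτg hτb using
    fun x : Z => h x.1.rep (rep_nonzero x.1) x.2.1 x.2.2
  let d := 2 * Fintype.card Z + m + n
  -- The map `E` to values and derivatives along `f = 0` is onto, and its kernel consists of the forms in
  -- `(f, g)`, whose codimension is `m n`.
  let E : homogeneousSubmodule (Fin 3) ℂ d →ₗ[ℂ] (Z → ℂ) × (Z → ℂ) :=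
    { toFun := fun G => (fun i => eval i.1.rep G.1, fun i => dirDeriv i.1.rep (τ i) G.1)
      map_add' := fun a b => by ext i <;> simp
      map_smul' := fun c a => by ext i <;> simp [smul_eval] }
  have hE : Function.Surjective E := by
    intro y
    obtain ⟨G, hG, hGy⟩ := exists_form_values (v := fun i : Z => i.1.rep) (τ := τ)
      (fun i => rep_nonzero i.1) (fun i j hij c => ne_smul_of_rep (Subtype.coe_ne_coe.mpr hij) c)
      hτ (m + n) y.1 y.2
    rw [show m + n + 2 * Fintype.card Z = d by ring] at hG
    refine ⟨⟨G, hG⟩, Prod.ext (funext fun i => ?_) (funext fun i => ?_)⟩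
    · exact (hGy i).1
    · exact (hGy i).2
  have hker : LinearMap.ker E = formsIn f g d := by
    ext G
    constructor
    · intro hG
      have hG := LinearMap.mem_ker.mp hG
      have hG1 : ∀ i : Z, eval i.1.rep G.1 = 0 := fun i => congrFun (congrArg Prod.fst hG) i
      have hG2 : ∀ i : Z, dirDeriv i.1.rep (τ i) G.1 = 0 :=
        fun i => congrFun (congrArg Prod.snd hG) i
      change G.1 ∈ Ideal.span {f, g}
      refine mem_span_pair_of_forall_exists (hg.eval_zero hn)
        (exists_sliceForm_of_isRelPrime hf hg hf0 hg0 hfg) fun v hv => ?_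
      by_cases hfv : eval v f = 0
      · by_cases hgv : eval v g = 0
        · obtain ⟨a, ha⟩ := exists_smul_eq_mk_rep ℂ v hv
          have ha : (a : ℂ) • v = (mk ℂ v hv).rep := ha
          let i : Z := ⟨mk ℂ v hv, by rw [← ha, hf.eval_smul, hfv, mul_zero], by
            rw [← ha, hg.eval_smul, hgv, mul_zero]⟩
          obtain ⟨w, hw⟩ := hsm i.1.rep (rep_nonzero i.1) i.2.1
          obtain ⟨s, hs, hsG⟩ := exists_mul_mem_of_dirDeriv_eq_zero hf (hb i) G.2
            (Ideal.subset_span (by simp)) (hbI i) (rep_nonzero i.1) (hτ i) i.2.1 (hbv i) (hG1 i)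
            ⟨Pi.single w 1, by rwa [dirDeriv_single]⟩ (hτf i) (hτb i) (hG2 i)
          refine exists_eval_ne_zero_of_lineHom_ne_zero hf hg G.2 (s := s) (fun h0 => hs ?_) hsG
          rw [← ha]
          exact lineHom_eq_zero_iff.mp h0 a
        · exact ⟨g, hgv, Ideal.mul_mem_right _ _ (Ideal.subset_span (by simp))⟩
      · exact ⟨f, hfv, Ideal.mul_mem_right _ _ (Ideal.subset_span (by simp))⟩
    · intro hG
      obtain ⟨A, B, hAB⟩ := Ideal.mem_span_pair.mp (show G.1 ∈ Ideal.span {f, g} from hG)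
      refine LinearMap.mem_ker.mpr (Prod.ext (funext fun i => ?_) (funext fun i => ?_))
      · change eval i.1.rep G.1 = 0
        rw [← hAB, map_add, map_mul, map_mul, i.2.1, i.2.2]
        ring
      · change dirDeriv i.1.rep (τ i) G.1 = 0
        rw [← hAB, map_add, dirDeriv_mul, dirDeriv_mul, i.2.1, i.2.2, hτf, hτg]
        ring
  have h1 := LinearMap.finrank_range_add_finrank_ker E
  have h3 : Module.finrank ℂ (formsIn f g d) + m * n =
      Module.finrank ℂ (homogeneousSubmodule (Fin 3) ℂ d) :=
    finrank_formsIn_add hf hg hf0 hg0 hfg (2 * Fintype.card Z)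
  rw [LinearMap.range_eq_top.mpr hE, finrank_top, Module.finrank_prod,
    Module.finrank_fintype_fun_eq_card, hker, Fintype.card_eq_nat_card,
    Nat.card_coe_set_eq] at h1
  omega

/-! ### Cubics containing the plane and their Gram matrices -/

/-- A quadratic form is determined by its second partial derivatives. -/
theorem exists_quadric_coeff {n : ℕ} {G : MvPolynomial (Fin n) ℂ} (hG : G.IsHomogeneous 2) :
    ∃ c : Fin n → Fin n → ℂ, G = ∑ j, ∑ k, C (c j k) * (X j * X k) := by
  have h1 := hG.sum_X_mul_pderiv
  have h2 : ∀ j, ∑ k, X k * pderiv k (pderiv j G) = 1 • pderiv j G := fun j =>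
    (hG.pderiv (i := j)).sum_X_mul_pderiv
  have h3 : ∀ j k, ∃ c, pderiv k (pderiv j G) = C c := fun j k => by
    have h : (pderiv k (pderiv j G)).IsHomogeneous 0 := (hG.pderiv (i := j)).pderiv (i := k)
    have h' := homogeneousComponent_eq_self h
    rw [homogeneousComponent_zero] at h'
    exact ⟨_, h'.symm⟩
  choose c hc using h3
  refine ⟨fun j k => 2⁻¹ * c j k, ?_⟩
  have h4 : (C 2⁻¹ : MvPolynomial (Fin n) ℂ) * 2 = 1 := by
    rw [← map_ofNat C 2, ← C_mul, inv_mul_cancel₀ (by norm_num), C_1]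
  rw [two_nsmul] at h1
  have h5 : ∑ j, ∑ k, C (2⁻¹ * c j k) * (X j * X k) = C 2⁻¹ * ∑ j, X j * pderiv j G := by
    rw [Finset.mul_sum]
    refine Finset.sum_congr rfl fun j _ => ?_
    rw [← one_smul ℕ (pderiv j G), ← h2, Finset.mul_sum, Finset.mul_sum]
    refine Finset.sum_congr rfl fun k _ => ?_
    rw [hc, C_mul]
    ring
  rw [h5, h1]
  linear_combination -G * h4

/-- A cubic form that vanishes on `P` is `x q₀ + y q₁ + z q₂` for quadratic forms `qᵢ`. -/
theorem exists_quadrics {F : MvPolynomial (Fin 6) ℂ} (hF : F ∈ cubicsContainingPlane) :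
    ∃ G : Fin 3 → MvPolynomial (Fin 6) ℂ, (∀ i, (G i).IsHomogeneous 2) ∧
      F = X 0 * G 0 + X 1 * G 1 + X 2 * G 2 := by
  obtain ⟨hF3, hFP⟩ := hF
  let I : Ideal (MvPolynomial (Fin 6) ℂ) := Ideal.span {X 0, X 1, X 2}
  let ρ : MvPolynomial (Fin 6) ℂ →ₐ[ℂ] MvPolynomial (Fin 6) ℂ := aeval ![0, 0, 0, X 3, X 4, X 5]
  have h1 : Ideal.Quotient.mkₐ ℂ I = (Ideal.Quotient.mkₐ ℂ I).comp ρ := by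
    ext i
    refine Ideal.Quotient.eq.mpr ?_
    fin_cases i
    · simpa [ρ] using Ideal.subset_span (by simp)
    · simpa [ρ] using Ideal.subset_span (by simp)
    · simpa [ρ] using Ideal.subset_span (by simp)
    all_goals simp [ρ]
  have h2 : ρ F = 0 := by
    refine funext fun v => ?_
    have : (aeval v).comp ρ = aeval (R := ℂ) ![0, 0, 0, v 3, v 4, v 5] := by
      ext i
      fin_cases i <;> simp [ρ]
    have h := congrArg (fun φ => φ F) this
    simp only [AlgHom.comp_apply, aeval_eq_eval] at h
    change eval v _ = _ at h
    rw [h, map_zero]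
    exact hFP _ rfl rfl rfl
  have h3 : F ∈ I := by
    have h := congrArg (fun φ => φ F) h1
    simp only [AlgHom.comp_apply, h2, map_zero] at h
    exact Ideal.Quotient.eq_zero_iff_mem.mp h
  obtain ⟨a, y, hy, h4⟩ := Ideal.mem_span_insert.mp h3
  obtain ⟨b, c, h5⟩ := Ideal.mem_span_pair.mp hy
  refine ⟨fun i => homogeneousComponent 2 (![a, b, c] i),
    fun i => homogeneousComponent_isHomogeneous _ _, ?_⟩
  have hX : ∀ (i : Fin 6) (A : MvPolynomial (Fin 6) ℂ),
      homogeneousComponent 3 (A * X i) = X i * homogeneousComponent 2 A := by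
    intro i A
    have h6 := coeff_gradeHom (A * X i) 3
    rw [map_mul, gradeHom_of_isHomogeneous (isHomogeneous_X ℂ i), ← mul_assoc,
      show 3 = 2 + 1 from rfl, Polynomial.coeff_mul_X_pow, Polynomial.coeff_mul_C,
      coeff_gradeHom] at h6
    rw [← h6, mul_comm]
  rw [← homogeneousComponent_eq_self hF3, h4, ← h5, map_add, map_add, hX, hX, hX]
  simp only [Matrix.cons_val_zero, Matrix.cons_val_one, Matrix.cons_val]
  ring

theorem eval_restrictT (y : Fin 3 → ℂ) (G : MvPolynomial (Fin 6) ℂ) :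
    eval y (restrictT G) = eval ![y 0, y 1, y 2, 0, 0, 0] G := by
  have : (aeval y).comp (aeval ![X 0, X 1, X 2, 0, 0, 0]) =
      aeval (R := ℂ) ![y 0, y 1, y 2, 0, 0, 0] := by
    ext i
    fin_cases i <;> simp
  have h := congrArg (fun φ => φ G) this
  simp only [AlgHom.comp_apply, aeval_eq_eval] at h
  exact h

theorem isHomogeneous_restrictT {G : MvPolynomial (Fin 6) ℂ} {d : ℕ} (hG : G.IsHomogeneous d) :
    (restrictT G).IsHomogeneous d := by
  have := hG.aeval (![X 0, X 1, X 2, 0, 0, 0] : Fin 6 → MvPolynomial (Fin 3) ℂ) (n := 1) (by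
    intro i
    fin_cases i
    · exact isHomogeneous_X _ _
    · exact isHomogeneous_X _ _
    · exact isHomogeneous_X _ _
    all_goals exact isHomogeneous_zero _ _ _)
  simpa [restrictT] using this

/-- Taylor expansion of a quadratic form in the variables `t₀, t₁, t₂`. -/
theorem quadric_expansion {G : MvPolynomial (Fin 6) ℂ} (hG : G.IsHomogeneous 2)
    (y : Fin 3 → ℂ) (u : Fin 4 → ℂ) :
    let w : Fin 6 → ℂ := ![y 0, y 1, y 2, 0, 0, 0]
    let t : Fin 6 → ℂ := ![0, 0, 0, u 0, u 1, u 2]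
    (∑ a, ∑ b, t a * t b * eval w (pderiv a (pderiv b G))) +
      2 * u 3 * (∑ a, t a * eval w (pderiv a G)) + 2 * u 3 ^ 2 * eval w G =
        2 * eval (fibrePoint y u) G := by
  intro w t
  obtain ⟨c, rfl⟩ := exists_quadric_coeff hG
  have hw : ∀ j, fibrePoint y u j = u 3 * w j + t j := by
    intro j
    fin_cases j <;> simp [fibrePoint, w, t]
  have h1 : ∀ b, pderiv b (∑ j, ∑ k, C (c j k) * (X j * X k : MvPolynomial (Fin 6) ℂ)) =
      ∑ j, (C (c b j) + C (c j b)) * X j := by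
    intro b
    simp only [map_sum, Derivation.leibniz, pderiv_C, pderiv_X, smul_eq_mul, mul_zero, add_zero,
      mul_add, Finset.sum_add_distrib, Pi.single_apply, add_mul]
    simp only [mul_ite, mul_one, mul_zero, Finset.sum_ite_eq',
      Finset.mem_univ, if_true]
    rw [add_comm]
    congr 1
    rw [Finset.sum_comm]
    simp
  have h2 : ∀ a b, pderiv a (∑ j, (C (c b j) + C (c j b)) * (X j : MvPolynomial (Fin 6) ℂ)) =
      C (c b a) + C (c a b) := by
    intro a b
    simp only [map_sum, Derivation.leibniz, pderiv_C, pderiv_X, smul_eq_mul, mul_zero, add_zero,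
      Pi.single_apply, map_add]
    simp
  simp only [h1, h2, map_sum, map_mul, map_add, eval_C, eval_X, hw]
  simp only [Finset.mul_sum]
  have e1 : ∑ a, ∑ b, t a * t b * (c b a + c a b) = ∑ a, ∑ b, 2 * (c a b * (t a * t b)) := by
    have : ∀ f : Fin 6 → Fin 6 → ℂ, ∑ a, ∑ b, (f a b + f b a) = ∑ a, ∑ b, 2 * f a b := by
      intro f
      simp only [Finset.sum_add_distrib, two_mul]
      congr 1
      exact Finset.sum_comm
    rw [← this]
    exact Finset.sum_congr rfl fun a _ => Finset.sum_congr rfl fun b _ => by ring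
  have e2 : ∑ a, ∑ b, 2 * u 3 * (t a * ((c a b + c b a) * w b)) =
      ∑ a, ∑ b, 2 * (c a b * (u 3 * (t a * w b + w a * t b))) := by
    have : ∀ f : Fin 6 → Fin 6 → ℂ, ∑ a, ∑ b, f a b = ∑ a, ∑ b, f b a := fun f => Finset.sum_comm
    have h3 : ∑ a, ∑ b, 2 * u 3 * (t a * (c b a * w b)) =
        ∑ a, ∑ b, 2 * u 3 * (t b * (c a b * w a)) := this _
    have h4 : ∑ a, ∑ b, 2 * u 3 * (t a * ((c a b + c b a) * w b)) =
        ∑ a, ∑ b, 2 * u 3 * (t a * (c a b * w b)) + ∑ a, ∑ b, 2 * u 3 * (t a * (c b a * w b)) := by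
      rw [← Finset.sum_add_distrib]
      refine Finset.sum_congr rfl fun a _ => ?_
      rw [← Finset.sum_add_distrib]
      exact Finset.sum_congr rfl fun b _ => by ring
    rw [h4, h3, ← Finset.sum_add_distrib]
    refine Finset.sum_congr rfl fun a _ => ?_
    rw [← Finset.sum_add_distrib]
    exact Finset.sum_congr rfl fun b _ => by ring
  rw [e1, e2, ← Finset.sum_add_distrib, ← Finset.sum_add_distrib]
  refine Finset.sum_congr rfl fun a _ => ?_
  rw [← Finset.sum_add_distrib, ← Finset.sum_add_distrib]
  exact Finset.sum_congr rfl fun b _ => by ring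

/-- The quadratic form of the fibre `Q_y`, for `F = x q₀ + y q₁ + z q₂`. -/
theorem form_self {G : Fin 3 → MvPolynomial (Fin 6) ℂ} (hG : ∀ i, (G i).IsHomogeneous 2)
    {F : MvPolynomial (Fin 6) ℂ} (hF : F = X 0 * G 0 + X 1 * G 1 + X 2 * G 2)
    (y : Fin 3 → ℂ) (u : Fin 4 → ℂ) :
    form F y u u = 2 * (y 0 * eval (fibrePoint y u) (G 0) + y 1 * eval (fibrePoint y u) (G 1) +
      y 2 * eval (fibrePoint y u) (G 2)) := by
  have h0 := quadric_expansion (hG 0) y u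
  have h1 := quadric_expansion (hG 1) y u
  have h2 := quadric_expansion (hG 2) y u
  simp only [Fin.sum_univ_six, Matrix.cons_val_zero, Matrix.cons_val_one, Matrix.cons_val,
    zero_mul, mul_zero, zero_add, add_zero] at h0 h1 h2
  have hX : ∀ (a i : Fin 6) (K : MvPolynomial (Fin 6) ℂ), i ≠ a →
      pderiv a (X i * K) = X i * pderiv a K := by
    intro a i K hai
    rw [Derivation.leibniz, pderiv_X_of_ne hai, smul_zero, add_zero, smul_eq_mul]
  subst hF
  simp (disch := decide) only [form, gram, dotProduct, Matrix.mulVec, Fin.sum_univ_four,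
    Matrix.map_apply, Matrix.of_apply, Matrix.cons_val', Matrix.cons_val_zero, Matrix.cons_val_one,
    Matrix.cons_val, Matrix.cons_val_fin_one, map_mul, eval_restrictT, hX, map_ofNat, map_add,
    eval_X]
  linear_combination y 0 * h0 + y 1 * h1 + y 2 * h2

/-- The equation of the quadric `Q_y` in the fibre coordinates. -/
theorem two_mul_eval_fibrePoint {F : MvPolynomial (Fin 6) ℂ} (hF : F ∈ cubicsContainingPlane)
    (y : Fin 3 → ℂ) (u : Fin 4 → ℂ) : 2 * eval (fibrePoint y u) F = u 3 * form F y u u := by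
  obtain ⟨G, hG, hFG⟩ := exists_quadrics hF
  rw [form_self hG hFG, hFG]
  simp only [map_add, map_mul, eval_X]
  simp only [fibrePoint, Matrix.cons_val_zero, Matrix.cons_val_one, Matrix.cons_val]
  ring

/-- If the point `t` of `P` lies on all the quadrics `Q_y`, then it is a singular point of `X`. -/
theorem not_isSmooth_of_form_eq_zero {F : MvPolynomial (Fin 6) ℂ} (hF : F ∈ cubicsContainingPlane)
    {t : Fin 3 → ℂ} (ht : t ≠ 0)
    (h : ∀ y, form F y ![t 0, t 1, t 2, 0] ![t 0, t 1, t 2, 0] = 0) :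
    ¬ IsSmoothHypersurface F := by
  intro hsm
  obtain ⟨G, hG, hFG⟩ := exists_quadrics hF
  let p : Fin 6 → ℂ := ![0, 0, 0, t 0, t 1, t 2]
  have hp : ∀ y, fibrePoint y ![t 0, t 1, t 2, 0] = p := fun y => by
    simp [fibrePoint, p]
  have hGp : ∀ i, eval p (G i) = 0 := by
    intro i
    have := h (Pi.single i 1)
    rw [form_self hG hFG, hp] at this
    fin_cases i <;> simpa using this
  obtain ⟨i, hi⟩ := hsm p (by
    intro h0
    apply ht
    ext i
    fin_cases i
    · exact congrFun h0 3
    · exact congrFun h0 4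
    · exact congrFun h0 5) (hF.2 p rfl rfl rfl)
  apply hi
  rw [hFG]
  simp only [map_add, Derivation.leibniz, smul_eq_mul, map_mul, eval_X, hGp]
  simp [p]

/-! ### Determinants of symmetric matrices -/

/-- A determinant is homogeneous if its entries are homogeneous of degrees `r i + c j`. -/
theorem isHomogeneous_det {k n : ℕ} {M : Matrix (Fin n) (Fin n) (MvPolynomial (Fin k) ℂ)}
    {r c : Fin n → ℕ} (h : ∀ i j, (M i j).IsHomogeneous (r i + c j)) :
    M.det.IsHomogeneous (∑ i, r i + ∑ i, c i) := by
  rw [Matrix.det_apply]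
  refine IsHomogeneous.sum _ _ _ fun σ _ => ?_
  have h1 : (∏ i, M (σ i) i).IsHomogeneous (∑ i, r i + ∑ i, c i) := by
    have := IsHomogeneous.prod Finset.univ (fun i => M (σ i) i) (fun i => r (σ i) + c i)
      (fun i _ => h _ _)
    rwa [Finset.sum_add_distrib, Equiv.sum_comp σ r] at this
  rcases Int.units_eq_one_or (Equiv.Perm.sign σ) with h2 | h2 <;> rw [h2]
  · rwa [one_smul]
  · rw [Units.neg_smul, one_smul]
    exact h1.neg

section Identities

variable {A : Type*} [CommRing A]

/-- The quadratic form `t ↦ tᵀ adj(M₃) t` of the upper left `3 × 3` block `M₃` of a symmetric matrix. -/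
def blockForm (M : Matrix (Fin 4) (Fin 4) A) (n : Fin 4 → A) : A :=
  ![n 0, n 1, n 2] ⬝ᵥ (M.submatrix Fin.castSucc Fin.castSucc).adjugate.mulVec ![n 0, n 1, n 2]

theorem blockForm_eq (M : Matrix (Fin 4) (Fin 4) A) (n : Fin 4 → A) :
    blockForm M n =
      n 0 * (n 0 * (M 1 1 * M 2 2 - M 1 2 * M 2 1) + n 1 * (M 0 2 * M 2 1 - M 0 1 * M 2 2) +
        n 2 * (M 0 1 * M 1 2 - M 0 2 * M 1 1)) +
      n 1 * (n 0 * (M 1 2 * M 2 0 - M 1 0 * M 2 2) + n 1 * (M 0 0 * M 2 2 - M 0 2 * M 2 0) +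
        n 2 * (M 0 2 * M 1 0 - M 0 0 * M 1 2)) +
      n 2 * (n 0 * (M 1 0 * M 2 1 - M 1 1 * M 2 0) + n 1 * (M 0 1 * M 2 0 - M 0 0 * M 2 1) +
        n 2 * (M 0 0 * M 1 1 - M 0 1 * M 1 0)) := by
  simp only [blockForm, Matrix.adjugate_fin_three, dotProduct, Matrix.mulVec, Fin.sum_univ_three,
    Matrix.submatrix_apply]
  simp
  ring

/-- Cofactors of a symmetric `4 × 4` matrix. -/
theorem adjugate_last (M : Matrix (Fin 4) (Fin 4) A) (hM : M.IsSymm) (n : Fin 4 → A) :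
    (n ⬝ᵥ M.adjugate.mulVec n) * M.adjugate 3 3 - (M.adjugate.mulVec n) 3 ^ 2 =
      M.det * blockForm M n := by
  have h10 : M 1 0 = M 0 1 := hM.apply 0 1
  have h20 : M 2 0 = M 0 2 := hM.apply 0 2
  have h30 : M 3 0 = M 0 3 := hM.apply 0 3
  have h21 : M 2 1 = M 1 2 := hM.apply 1 2
  have h31 : M 3 1 = M 1 3 := hM.apply 1 3
  have h32 : M 3 2 = M 2 3 := hM.apply 2 3
  have hadj : ∀ i j, M.adjugate i j = (-1) ^ (j + i : ℕ) *
      (M.submatrix j.succAbove i.succAbove).det := fun i j =>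
    Matrix.adjugate_fin_succ_eq_det_submatrix M i j
  rw [blockForm_eq]
  simp only [dotProduct, Matrix.mulVec, Fin.sum_univ_four, hadj, Matrix.det_succ_row_zero (n := 3),
    Matrix.det_fin_three, Matrix.submatrix_apply]
  simp [Fin.succAbove, h10, h20, h30, h21, h31, h32]
  ring

/-- The `2 × 2` minors of the adjugate matrix of a symmetric matrix are multiples of the determinant. -/
theorem exists_adjugate_minor (M : Matrix (Fin 4) (Fin 4) A) (hM : M.IsSymm) (n : Fin 4 → A)
    (j : Fin 4) : ∃ κ, (n ⬝ᵥ M.adjugate.mulVec n) * M.adjugate j j =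
      (M.adjugate.mulVec n) j ^ 2 + M.det * κ := by
  let e : Equiv.Perm (Fin 4) := Equiv.swap j 3
  have h := adjugate_last (M.submatrix e e) (hM.submatrix e) (n ∘ e)
  have he : e 3 = j := Equiv.swap_apply_right j 3
  rw [Matrix.adjugate_submatrix_equiv_self, Matrix.det_submatrix_equiv_self,
    Matrix.submatrix_apply, he] at h
  have hmul : (M.adjugate.submatrix e e).mulVec (n ∘ e) = M.adjugate.mulVec n ∘ e := by
    rw [Matrix.submatrix_mulVec_equiv]
    congr 2
    ext i
    simp
  have hdot : (n ∘ e) ⬝ᵥ (M.adjugate.mulVec n ∘ e) = n ⬝ᵥ M.adjugate.mulVec n := by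
    simp only [dotProduct, Function.comp_apply]
    exact Equiv.sum_comp e fun i => n i * M.adjugate.mulVec n i
  rw [hmul, hdot, Function.comp_apply, he] at h
  exact ⟨blockForm (M.submatrix e e) (n ∘ e), by linear_combination h⟩

end Identities

theorem dirDeriv_prod {k : ℕ} {ι : Type*} [DecidableEq ι] (v τ : Fin k → ℂ) (s : Finset ι)
    (p : ι → MvPolynomial (Fin k) ℂ) : dirDeriv v τ (∏ i ∈ s, p i) =
      ∑ i ∈ s, (∏ j ∈ s.erase i, eval v (p j)) * dirDeriv v τ (p i) := by
  induction s using Finset.induction_on with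
  | empty => simpa using dirDeriv_C v τ 1
  | insert a s ha ih =>
    rw [Finset.prod_insert ha, dirDeriv_mul, ih, Finset.sum_insert ha, Finset.erase_insert ha,
      Finset.mul_sum, map_prod, mul_comm]
    congr 1
    refine Finset.sum_congr rfl fun i hi => ?_
    have hai : a ≠ i := fun h => ha (h ▸ hi)
    rw [Finset.erase_insert_of_ne hai, Finset.prod_insert fun h => ha (Finset.mem_of_mem_erase h),
      mul_assoc]

/-- Jacobi's formula for the derivative of a determinant. -/
theorem dirDeriv_det {k n : ℕ} (v τ : Fin k → ℂ)
    (M : Matrix (Fin n) (Fin n) (MvPolynomial (Fin k) ℂ)) :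
    dirDeriv v τ M.det = ∑ j, ∑ i, eval v (M.adjugate j i) * dirDeriv v τ (M i j) := by
  have h1 : ∀ j, ∑ i, eval v (M.adjugate j i) * dirDeriv v τ (M i j) =
      ((M.map (eval v)).updateCol j fun i => dirDeriv v τ (M i j)).det := by
    intro j
    rw [← Matrix.cramer_apply, Matrix.cramer_eq_adjugate_mulVec,
      ← RingHom.mapMatrix_apply, ← RingHom.map_adjugate]
    rfl
  simp_rw [h1, Matrix.det_apply]
  rw [map_sum, Finset.sum_comm]
  refine Finset.sum_congr rfl fun σ _ => ?_
  rw [← Finset.smul_sum, Units.smul_def, Units.smul_def, map_zsmul, dirDeriv_prod]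
  congr 1
  refine Finset.sum_congr rfl fun j _ => ?_
  rw [← Finset.mul_prod_erase Finset.univ _ (Finset.mem_univ j), mul_comm]
  congr 1
  · simp
  · refine Finset.prod_congr rfl fun i hi => ?_
    rw [Matrix.updateCol_ne (Finset.ne_of_mem_erase hi)]
    rfl

/-! ### The discriminant curves of the quadric and conic bundles -/

theorem pderiv_comm {n : ℕ} (a b : Fin n) (G : MvPolynomial (Fin n) ℂ) :
    pderiv a (pderiv b G) = pderiv b (pderiv a G) := by
  induction G using MvPolynomial.induction_on' with
  | monomial u c =>
    simp only [pderiv_monomial]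
    rcases eq_or_ne a b with rfl | hab
    · rfl
    · rw [tsub_right_comm]
      congr 1
      simp [hab, hab.symm, mul_right_comm]
  | add p q hp hq => simp only [map_add, hp, hq]

theorem gram_isSymm (F : MvPolynomial (Fin 6) ℂ) : (gram F).IsSymm := by
  refine Matrix.IsSymm.ext fun i j => ?_
  fin_cases i <;> fin_cases j <;> simp [gram] <;> rw [pderiv_comm]

/-- The weights of the fibre coordinates `(t₀, t₁, t₂, s)`. -/
def fibreWeight : Fin 4 → ℕ := ![0, 0, 0, 1]

theorem isHomogeneous_gram {F : MvPolynomial (Fin 6) ℂ} (hF : F.IsHomogeneous 3) (i j : Fin 4) :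
    (gram F i j).IsHomogeneous ((1 + fibreWeight i) + fibreWeight j) := by
  have h2 : ∀ a b, (restrictT (pderiv a (pderiv b F))).IsHomogeneous 1 := fun a b =>
    isHomogeneous_restrictT ((hF.pderiv (i := b)).pderiv (i := a))
  have h1 : ∀ a, (restrictT (pderiv a F)).IsHomogeneous 2 := fun a =>
    isHomogeneous_restrictT (hF.pderiv (i := a))
  have h0 : (2 * restrictT F).IsHomogeneous 3 := by
    rw [← map_ofNat C 2]
    exact (isHomogeneous_restrictT hF).C_mul 2
  fin_cases i <;> fin_cases j <;> simp only [gram, fibreWeight] <;> simp <;>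
    with_reducible first | exact h2 _ _ | exact h1 _ | exact h0

theorem isHomogeneous_sextic {F : MvPolynomial (Fin 6) ℂ} (hF : F.IsHomogeneous 3) :
    (sextic F).IsHomogeneous 6 := by
  have := isHomogeneous_det (M := gram F) (fun i j => isHomogeneous_gram hF i j)
  simpa [sextic, Fin.sum_univ_four, fibreWeight] using this

theorem isHomogeneous_adjugate {F : MvPolynomial (Fin 6) ℂ} (hF : F.IsHomogeneous 3) (i j : Fin 4) :
    ((gram F).adjugate i j).IsHomogeneous (5 - fibreWeight i - fibreWeight j) := by
  have h1 := isHomogeneous_det (M := (gram F).submatrix j.succAbove i.succAbove)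
    (fun a b => isHomogeneous_gram hF (j.succAbove a) (i.succAbove b))
  rw [Matrix.adjugate_fin_succ_eq_det_submatrix]
  have h2 : ∑ a, (1 + fibreWeight (j.succAbove a)) + ∑ a, fibreWeight (i.succAbove a) =
      5 - fibreWeight i - fibreWeight j := by
    clear h1
    revert i j
    decide
  rw [h2] at h1
  rcases neg_one_pow_eq_or (MvPolynomial (Fin 3) ℂ) (j + i : ℕ) with h | h <;> rw [h]
  · rwa [one_mul]
  · rw [neg_one_mul]
    exact h1.neg

theorem isHomogeneous_normal (h : Fin 6 → ℂ) (i : Fin 4) :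
    (normal h i).IsHomogeneous (fibreWeight i) := by
  fin_cases i
  · exact isHomogeneous_C _ _
  · exact isHomogeneous_C _ _
  · exact isHomogeneous_C _ _
  · exact ((isHomogeneous_C_mul_X _ _).add (isHomogeneous_C_mul_X _ _)).add
      (isHomogeneous_C_mul_X _ _)

/-- The coordinates of `adj(M) n`, the pole of the plane `H` with respect to the quadric `Q_y`. -/
def pole (F : MvPolynomial (Fin 6) ℂ) (h : Fin 6 → ℂ) : Fin 4 → MvPolynomial (Fin 3) ℂ :=
  (gram F).adjugate.mulVec (normal h)

theorem isHomogeneous_pole {F : MvPolynomial (Fin 6) ℂ} (hF : F.IsHomogeneous 3) (h : Fin 6 → ℂ)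
    (j : Fin 4) : (pole F h j).IsHomogeneous (5 - fibreWeight j) := by
  refine IsHomogeneous.sum _ _ _ fun i _ => ?_
  have h1 := (isHomogeneous_adjugate hF j i).mul (isHomogeneous_normal h i)
  have h2 : 5 - fibreWeight j - fibreWeight i + fibreWeight i = 5 - fibreWeight j := by
    clear h1
    revert i j
    decide
  rwa [h2] at h1

theorem isHomogeneous_quintic {F : MvPolynomial (Fin 6) ℂ} (hF : F.IsHomogeneous 3)
    (h : Fin 6 → ℂ) : (quintic F h).IsHomogeneous 5 := by
  refine IsHomogeneous.sum _ _ _ fun i _ => ?_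
  have h1 := (isHomogeneous_normal h i).mul (isHomogeneous_pole hF h i)
  have h2 : fibreWeight i + (5 - fibreWeight i) = 5 := by
    clear h1
    revert i
    decide
  rwa [h2] at h1

/-- Modulo the sextic, the quintic is a square up to a minor of the Gram matrix. -/
theorem exists_quintic_mul (F : MvPolynomial (Fin 6) ℂ) (h : Fin 6 → ℂ) (j : Fin 4) :
    ∃ κ, quintic F h * (gram F).adjugate j j = pole F h j ^ 2 + sextic F * κ := by
  simp only [quintic, pole, sextic]
  exact exists_adjugate_minor _ (gram_isSymm F) (normal h) j

theorem exists_adjugate_ne_zero_of_isSymm {k : ℕ}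
    {M : Matrix (Fin 4) (Fin 4) (MvPolynomial (Fin k) ℂ)} (hM : M.IsSymm)
    (hsm : IsSmoothHypersurface M.det) {v : Fin k → ℂ} (hv : v ≠ 0)
    (hfv : eval v M.det = 0) : ∃ j, eval v (M.adjugate j j) ≠ 0 := by
  by_contra! hc
  have h1 : ∀ i j, eval v (M.adjugate j i) = 0 := by
    intro i j
    obtain ⟨κ, hκ⟩ := exists_adjugate_minor M hM (Pi.single i 1) j
    rw [Matrix.mulVec_single_one, single_one_dotProduct] at hκ
    have h2 := congrArg (eval v) hκ
    rw [map_mul, hc, mul_zero, map_add, map_mul, hfv, zero_mul, add_zero, map_pow] at h2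
    exact pow_eq_zero_iff two_ne_zero |>.mp h2.symm
  obtain ⟨i, hi⟩ := hsm v hv hfv
  apply hi
  rw [← dirDeriv_single, dirDeriv_det]
  exact Finset.sum_eq_zero fun j _ => Finset.sum_eq_zero fun i _ => by rw [h1, zero_mul]

/-- Along a smooth sextic the Gram matrix has corank one, and one of its principal cofactors is not
zero. -/
theorem exists_adjugate_ne_zero {F : MvPolynomial (Fin 6) ℂ}
    (hsm : IsSmoothHypersurface (sextic F)) {v : Fin 3 → ℂ} (hv : v ≠ 0)
    (hfv : eval v (sextic F) = 0) : ∃ j, eval v ((gram F).adjugate j j) ≠ 0 := by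
  rw [sextic] at hsm hfv
  exact exists_adjugate_ne_zero_of_isSymm (gram_isSymm F) hsm hv hfv

/-! ### Local rings of affine space: arcs and parameters -/

/-- The restriction of polynomials to the arc `v + s τ + s² σ`, as power series in `s`. -/
def arc {n : ℕ} (v τ σ : Fin n → ℂ) : MvPolynomial (Fin n) ℂ →ₐ[ℂ] PowerSeries ℂ :=
  aeval fun j => PowerSeries.C (v j) + PowerSeries.C (τ j) * PowerSeries.X +
    PowerSeries.C (σ j) * PowerSeries.X ^ 2

section Arc

variable {n : ℕ} (v τ σ : Fin n → ℂ)

theorem coeff_arc_X (j : Fin n) : PowerSeries.coeff 0 (arc v τ σ (X j)) = v j ∧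
    PowerSeries.coeff 1 (arc v τ σ (X j)) = τ j ∧ PowerSeries.coeff 2 (arc v τ σ (X j)) = σ j := by
  simp [arc, PowerSeries.coeff_C, PowerSeries.coeff_X_pow]

theorem arc_C (c : ℂ) : arc v τ σ (C c) = PowerSeries.C c :=
  (arc v τ σ).commutes c

theorem coeff_zero_arc (G : MvPolynomial (Fin n) ℂ) :
    PowerSeries.coeff 0 (arc v τ σ G) = eval v G := by
  induction G using MvPolynomial.induction_on with
  | C c => simp
  | add p q hp hq => rw [map_add, map_add, map_add, hp, hq]
  | mul_X p j hp =>
    simp only [map_mul, eval_X, PowerSeries.coeff_mul, Finset.Nat.antidiagonal_zero,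
      Finset.sum_singleton, hp, (coeff_arc_X v τ σ j).1]

theorem coeff_one_arc (G : MvPolynomial (Fin n) ℂ) :
    PowerSeries.coeff 1 (arc v τ σ G) = dirDeriv v τ G := by
  induction G using MvPolynomial.induction_on with
  | C c => simp
  | add p q hp hq => rw [map_add, map_add, map_add, hp, hq]
  | mul_X p j hp =>
    obtain ⟨h0, h1, -⟩ := coeff_arc_X v τ σ j
    simp only [map_mul, PowerSeries.coeff_mul, Finset.Nat.antidiagonal_succ,
      Finset.Nat.antidiagonal_zero, Finset.sum_cons, Finset.map_singleton,
      Finset.sum_singleton, Function.Embedding.prodMap, Function.Embedding.coeFn_mk, Prod.map,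
      Nat.succ_eq_add_one, zero_add, Function.Embedding.refl_apply, coeff_zero_arc, hp, h0, h1,
      dirDeriv_mul, dirDeriv_X, eval_X]
    ring

theorem coeff_two_arc (G : MvPolynomial (Fin n) ℂ) :
    PowerSeries.coeff 2 (arc v τ σ G) =
      PowerSeries.coeff 2 (arc v τ 0 G) + dirDeriv v σ G := by
  induction G using MvPolynomial.induction_on with
  | C c => simp
  | add p q hp hq => simp only [map_add, hp, hq]; ring
  | mul_X p j hp =>
    obtain ⟨h0, h1, h2⟩ := coeff_arc_X v τ σ j
    obtain ⟨k0, k1, k2⟩ := coeff_arc_X v τ 0 j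
    simp only [map_mul, PowerSeries.coeff_mul, Finset.Nat.antidiagonal_succ,
      Finset.Nat.antidiagonal_zero, Finset.sum_cons, Finset.map_singleton,
      Finset.map_cons, Finset.sum_singleton, Function.Embedding.prodMap,
      Function.Embedding.coeFn_mk, Prod.map, Nat.succ_eq_add_one, zero_add,
      Function.Embedding.refl_apply, coeff_zero_arc, coeff_one_arc,
      hp, h0, h1, h2, k0, k1, k2, Nat.reduceAdd,
      dirDeriv_mul, dirDeriv_X, eval_X, Pi.zero_apply]
    ring

theorem isUnit_arc {G : MvPolynomial (Fin n) ℂ} (h : eval v G ≠ 0) : IsUnit (arc v τ σ G) := by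
  rw [PowerSeries.isUnit_iff_constantCoeff, ← PowerSeries.coeff_zero_eq_constantCoeff_apply,
    coeff_zero_arc]
  exact h.isUnit

theorem mem_vanishingIdeal_iff_eval (G : MvPolynomial (Fin n) ℂ) :
    G ∈ (vanishingIdeal ℂ {v} : Ideal (MvPolynomial (Fin n) ℂ)) ↔ eval v G = 0 := by
  simp [mem_vanishingIdeal_iff, aeval_eq_eval]

theorem isUnit_algebraMap_localRingAt {G : MvPolynomial (Fin n) ℂ} (h : eval v G ≠ 0) :
    IsUnit (algebraMap _ (LocalRingAt v) G) :=
  IsLocalization.map_units (LocalRingAt v)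
    (⟨G, fun hG => h ((mem_vanishingIdeal_iff_eval v G).1 hG)⟩ :
      (vanishingIdeal ℂ {v} : Ideal (MvPolynomial (Fin n) ℂ)).primeCompl)

/-- The restriction to an arc through `v` of the elements of the local ring at `v`. -/
def localArc : LocalRingAt v →ₐ[ℂ] PowerSeries ℂ :=
  IsLocalization.liftAlgHom (M := (vanishingIdeal ℂ {v} :
    Ideal (MvPolynomial (Fin n) ℂ)).primeCompl) (f := arc v τ σ) fun y =>
      isUnit_arc v τ σ fun h => y.2 ((mem_vanishingIdeal_iff_eval v _).2 h)

@[simp] theorem localArc_algebraMap (G : MvPolynomial (Fin n) ℂ) :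
    localArc v τ σ (algebraMap _ _ G) = arc v τ σ G := by
  simp [localArc]

theorem algebraMap_mem_maximalIdeal {G : MvPolynomial (Fin n) ℂ} (h : eval v G = 0) :
    algebraMap _ (LocalRingAt v) G ∈ IsLocalRing.maximalIdeal (LocalRingAt v) := by
  rw [← Localization.AtPrime.map_eq_maximalIdeal]
  exact Ideal.mem_map_of_mem _ ((mem_vanishingIdeal_iff_eval v G).2 h)

theorem localArc_mem_of_mem_maximalIdeal {x : LocalRingAt v}
    (h : x ∈ IsLocalRing.maximalIdeal (LocalRingAt v)) :
    localArc v τ σ x ∈ Ideal.span {(PowerSeries.X : PowerSeries ℂ)} := by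
  rw [← Localization.AtPrime.map_eq_maximalIdeal] at h
  refine (Ideal.map_le_iff_le_comap (K := (Ideal.span {(PowerSeries.X : PowerSeries ℂ)}).comap
    (localArc v τ σ).toRingHom)).2 (fun G hG => ?_) h
  rw [mem_vanishingIdeal_iff_eval] at hG
  rw [Ideal.mem_comap, Ideal.mem_comap]
  change localArc v τ σ (algebraMap _ _ G) ∈ _
  rw [localArc_algebraMap, Ideal.mem_span_singleton, PowerSeries.X_dvd_iff,
    ← PowerSeries.coeff_zero_eq_constantCoeff_apply, coeff_zero_arc, hG]

/-- Taylor expansion to first order. -/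
theorem sub_mem_sq_vanishingIdeal (G : MvPolynomial (Fin n) ℂ) :
    G - C (eval v G) - ∑ j, C (eval v (pderiv j G)) * (X j - C (v j)) ∈
      (vanishingIdeal ℂ {v} : Ideal (MvPolynomial (Fin n) ℂ)) ^ 2 := by
  have hX : ∀ j, X j - C (v j) ∈ (vanishingIdeal ℂ {v} : Ideal (MvPolynomial (Fin n) ℂ)) :=
    fun j => (mem_vanishingIdeal_iff_eval v _).2 (by simp)
  induction G using MvPolynomial.induction_on with
  | C c => simp
  | add p q hp hq =>
    convert add_mem hp hq using 1
    simp only [map_add, add_mul, Finset.sum_add_distrib]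
    ring
  | mul_X p k hp =>
    have h1 : p * (X k - C (v k)) - C (eval v p) * (X k - C (v k)) ∈
        (vanishingIdeal ℂ {v} : Ideal (MvPolynomial (Fin n) ℂ)) ^ 2 := by
      rw [← sub_mul, pow_two]
      exact Ideal.mul_mem_mul ((mem_vanishingIdeal_iff_eval v _).2 (by simp)) (hX k)
    convert add_mem h1 (Ideal.mul_mem_left _ (C (v k)) hp) using 1
    have h2 : ∀ j, C (eval v (pderiv j (p * X k))) * (X j - C (v j)) =
        C (v k) * (C (eval v (pderiv j p)) * (X j - C (v j))) +
          C (eval v p) * ((Pi.single k 1 : Fin n → MvPolynomial (Fin n) ℂ) j *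
            (X j - C (v j))) := by
      intro j
      rcases eq_or_ne j k with rfl | hjk
      · simp [Derivation.leibniz]
        ring
      · simp [Derivation.leibniz, hjk, pderiv_X_of_ne hjk.symm]
        ring
    have h3 : ∑ j, (Pi.single k 1 : Fin n → MvPolynomial (Fin n) ℂ) j * (X j - C (v j)) =
        X k - C (v k) := by
      rw [Finset.sum_eq_single k (fun j _ hj => by simp [hj]) (by simp), Pi.single_eq_same, one_mul]
    simp only [h2, Finset.sum_add_distrib, ← Finset.mul_sum, h3, map_mul, eval_X]
    ring

/-- By Nakayama's lemma, functions whose differentials at `v` have no common kernel generate the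
maximal ideal of the local ring at `v`. -/
theorem germ_eq_maximalIdeal {I : Ideal (MvPolynomial (Fin n) ℂ)} (hI : ∀ G ∈ I, eval v G = 0)
    (h : ∀ τ, (∀ G ∈ I, dirDeriv v τ G = 0) → τ = 0) :
    germ v I = IsLocalRing.maximalIdeal (LocalRingAt v) := by
  let 𝔭 : Ideal (MvPolynomial (Fin n) ℂ) := vanishingIdeal ℂ {v}
  let grad : MvPolynomial (Fin n) ℂ →ₗ[ℂ] (Fin n → ℂ) :=
    LinearMap.pi fun j => dirDeriv v (Pi.single j 1)
  have hgrad : ∀ τ G, dirDeriv v τ G = ∑ j, grad G j * τ j := by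
    intro τ G
    rw [dirDeriv_apply]
    refine Finset.sum_congr rfl fun j _ => ?_
    simp only [grad, LinearMap.pi_apply, dirDeriv_single]
    ring
  have hW : Submodule.map grad (I.restrictScalars ℂ) = ⊤ := by
    by_contra hne
    obtain ⟨φ, hφ, hφW⟩ := Submodule.exists_le_ker_of_lt_top _ (lt_top_iff_ne_top.2 hne)
    apply hφ
    have hφ' : ∀ w, φ w = ∑ j, w j * φ (Pi.single j 1) := by
      intro w
      conv_lhs => rw [← Finset.univ_sum_single w]
      rw [map_sum]
      refine Finset.sum_congr rfl fun j _ => ?_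
      rw [← smul_eq_mul, ← map_smul, ← Pi.single_smul, smul_eq_mul, mul_one]
    have h0 := h (fun j => φ (Pi.single j 1)) fun G hG => by
      rw [hgrad, ← hφ']
      exact hφW (Submodule.mem_map_of_mem hG)
    refine LinearMap.ext fun w => ?_
    rw [hφ']
    exact Finset.sum_eq_zero fun j _ => by rw [congrFun h0 j]; exact mul_zero _
  have hle : 𝔭 ≤ I ⊔ 𝔭 * 𝔭 := by
    intro G hG
    obtain ⟨K, hK, hKG⟩ : grad G ∈ Submodule.map grad (I.restrictScalars ℂ) := hW ▸ trivial
    have h1 := sub_mem_sq_vanishingIdeal v (G - K)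
    rw [map_sub, (mem_vanishingIdeal_iff_eval v G).1 hG, hI K hK, sub_zero, C_0, sub_zero,
      Finset.sum_eq_zero, sub_zero, pow_two] at h1
    · have h2 := add_mem (show K ∈ I ⊔ 𝔭 * 𝔭 from Ideal.mem_sup_left hK)
        (Ideal.mem_sup_right h1)
      rwa [add_sub_cancel] at h2
    · intro j _
      have h2 : eval v (pderiv j G) = eval v (pderiv j K) := by
        have := congrFun hKG.symm j
        simpa [grad, dirDeriv_single] using this
      rw [map_sub, map_sub, h2, sub_self, C_0, zero_mul]
  have hmap : 𝔭.map (algebraMap _ (LocalRingAt v)) = IsLocalRing.maximalIdeal (LocalRingAt v) :=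
    Localization.AtPrime.map_eq_maximalIdeal
  refine le_antisymm ?_ ?_
  · rw [germ, Ideal.map_le_iff_le_comap]
    exact fun G hG => algebraMap_mem_maximalIdeal v (hI G hG)
  · refine Submodule.le_of_le_smul_of_le_jacobson_bot
      (I := IsLocalRing.maximalIdeal (LocalRingAt v)) ?_ ?_ ?_
    · exact (isNoetherianRing_iff_ideal_fg _).1 inferInstance _
    · exact (IsLocalRing.jacobson_eq_maximalIdeal ⊥ bot_ne_top).ge
    · have h1 := Ideal.map_mono (f := algebraMap _ (LocalRingAt v)) hle
      rwa [Ideal.map_sup, Ideal.map_mul, hmap] at h1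

end Arc

section Length

variable {n : ℕ} (v τ σ : Fin n → ℂ)

/-- Germs can be prescribed along an arc with nonzero velocity, up to any order. -/
theorem exists_coeff_localArc {j : Fin n} (hτ : τ j ≠ 0) (y : ℕ → ℂ) (k : ℕ) :
    ∃ x, ∀ m < k, PowerSeries.coeff m (localArc v τ σ x) = y m := by
  induction k with
  | zero => exact ⟨0, by simp⟩
  | succ k ih =>
    obtain ⟨x, hx⟩ := ih
    let x₀ : LocalRingAt v := algebraMap _ _ (X j - C (v j))
    have h0 : localArc v τ σ x₀ =
        PowerSeries.X * (PowerSeries.C (τ j) + PowerSeries.C (σ j) * PowerSeries.X) := by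
      rw [localArc_algebraMap, map_sub, arc_C, arc, aeval_X]
      ring
    have h1 : ∀ m ≤ k, PowerSeries.coeff m (localArc v τ σ (x₀ ^ k)) =
        if m = k then τ j ^ k else 0 := by
      intro m hm
      rw [map_pow, h0, mul_pow]
      split_ifs with hmk
      · subst hmk
        have := PowerSeries.coeff_X_pow_mul
          ((PowerSeries.C (τ j) + PowerSeries.C (σ j) * PowerSeries.X) ^ m) m 0
        rw [zero_add] at this
        rw [this]
        simp
      · rw [PowerSeries.coeff_X_pow_mul', if_neg (by omega)]
    refine ⟨x + ((y k - PowerSeries.coeff k (localArc v τ σ x)) / τ j ^ k) • x₀ ^ k,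
      fun m hm => ?_⟩
    rw [map_add, map_add, map_smul, map_smul, h1 m (by omega)]
    rcases eq_or_lt_of_le (Nat.lt_succ_iff.1 hm) with rfl | hmk
    · rw [if_pos rfl, smul_eq_mul, div_mul_cancel₀ _ (pow_ne_zero _ hτ)]
      ring
    · rw [if_neg hmk.ne, smul_zero, add_zero, hx m hmk]

/-- An arc on which the equations of a scheme vanish to order `k` bounds its length from below. -/
theorem le_length_of_arc {j : Fin n} (hτ : τ j ≠ 0) {s : Set (MvPolynomial (Fin n) ℂ)} {k : ℕ}
    (hs : ∀ G ∈ s, PowerSeries.X ^ k ∣ arc v τ σ G) :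
    (k : ℕ∞) ≤ Module.length ℂ (LocalRingAt v ⧸ germ v (Ideal.span s)) := by
  let φ : LocalRingAt v →ₗ[ℂ] (Fin k → ℂ) :=
    LinearMap.pi fun m => PowerSeries.coeff (m : ℕ) ∘ₗ (localArc v τ σ).toLinearMap
  have hker : (germ v (Ideal.span s)).restrictScalars ℂ ≤ LinearMap.ker φ := by
    have h1 : germ v (Ideal.span s) ≤
        (Ideal.span {(PowerSeries.X : PowerSeries ℂ) ^ k}).comap (localArc v τ σ).toRingHom := by
      rw [germ, Ideal.map_span, Ideal.span_le]
      rintro _ ⟨G, hG, rfl⟩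
      change localArc v τ σ (algebraMap _ _ G) ∈ Ideal.span {(PowerSeries.X : PowerSeries ℂ) ^ k}
      rw [localArc_algebraMap]
      exact Ideal.mem_span_singleton.2 (hs G hG)
    intro x hx
    have h2 := Ideal.mem_span_singleton.1 (h1 hx)
    rw [PowerSeries.X_pow_dvd_iff] at h2
    exact funext fun m => h2 m m.2
  let ψ := (Submodule.liftQ _ φ hker) ∘ₗ
    (Submodule.Quotient.restrictScalarsEquiv ℂ (germ v (Ideal.span s))).symm.toLinearMap
  have hψ : Function.Surjective ψ := by
    refine Function.Surjective.comp (g := Submodule.liftQ _ φ hker) (fun y => ?_)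
      (LinearEquiv.surjective _)
    obtain ⟨x, hx⟩ := exists_coeff_localArc v τ σ hτ
      (fun m => if h : m < k then y ⟨m, h⟩ else 0) k
    refine ⟨Submodule.Quotient.mk x, funext fun m => ?_⟩
    rw [Submodule.liftQ_apply]
    exact (hx m m.2).trans (dif_pos m.2)
  have h3 := Module.length_le_of_surjective ψ hψ
  rwa [Module.length_eq_finrank, Module.finrank_fin_fun] at h3

theorem sub_algebraMap_mem_maximalIdeal (x : LocalRingAt v) :
    ∃ c : ℂ, x - algebraMap ℂ _ c ∈ IsLocalRing.maximalIdeal (LocalRingAt v) := by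
  simp_rw [IsLocalRing.mem_maximalIdeal, mem_nonunits_iff]
  refine ⟨PowerSeries.constantCoeff (localArc v 0 0 x), fun h => ?_⟩
  have h1 := (h.map (localArc v 0 0)).map PowerSeries.constantCoeff
  rw [map_sub, AlgHom.commutes, map_sub] at h1
  simp at h1

/-- A scheme whose equations together with `b` generate the maximal ideal, and on which `b²` vanishes,
has length at most two. -/
theorem length_le_two {s : Set (MvPolynomial (Fin n) ℂ)} {b : MvPolynomial (Fin n) ℂ}
    (hb : algebraMap _ (LocalRingAt v) b ^ 2 ∈ germ v (Ideal.span s))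
    (hm : IsLocalRing.maximalIdeal (LocalRingAt v) ≤ germ v (Ideal.span (insert b s))) :
    Module.length ℂ (LocalRingAt v ⧸ germ v (Ideal.span s)) ≤ 2 := by
  set I := germ v (Ideal.span s) with hI
  set β := algebraMap _ (LocalRingAt v) b with hβ
  have hins : germ v (Ideal.span (insert b s)) = Ideal.span {β} ⊔ I := by
    rw [hI, germ, germ, Ideal.map_span, Ideal.map_span, Set.image_insert_eq, Ideal.span_insert]
  have hdec : ∀ x : LocalRingAt v, ∃ (c : ℂ) (z : LocalRingAt v), ∃ y ∈ I,
      x = algebraMap ℂ _ c + z * β + y := by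
    intro x
    obtain ⟨c, hc⟩ := sub_algebraMap_mem_maximalIdeal v x
    obtain ⟨w, hw, y, hy, hwy⟩ := Submodule.mem_sup.1 (hins ▸ hm hc)
    obtain ⟨z, rfl⟩ := Ideal.mem_span_singleton'.1 hw
    exact ⟨c, z, y, hy, by rw [add_assoc, hwy]; ring⟩
  let φ : (Fin 2 → ℂ) →ₗ[ℂ] (LocalRingAt v ⧸ I) :=
    (Ideal.Quotient.mkₐ ℂ I).toLinearMap ∘ₗ
      ((LinearMap.proj 0).smulRight 1 + (LinearMap.proj 1).smulRight β)
  have hφ : Function.Surjective φ := by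
    intro q
    obtain ⟨x, rfl⟩ := Ideal.Quotient.mk_surjective q
    obtain ⟨c, z, y, hy, hx⟩ := hdec x
    obtain ⟨c', z', y', hy', hz⟩ := hdec z
    refine ⟨![c, c'], ?_⟩
    have h1 : φ ![c, c'] = Ideal.Quotient.mk I (algebraMap ℂ _ c + algebraMap ℂ _ c' * β) := by
      simp [φ, Algebra.smul_def]
    rw [h1, Ideal.Quotient.eq]
    have h2 : algebraMap ℂ _ c + algebraMap ℂ _ c' * β - x = -(z' * β ^ 2 + β * y' + y) := by
      rw [hx, hz]
      ring
    rw [h2]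
    exact neg_mem (add_mem (add_mem (Ideal.mul_mem_left _ _ hb) (Ideal.mul_mem_left _ _ hy')) hy)
  refine (Module.length_le_of_surjective φ hφ).trans (le_of_eq ?_)
  rw [Module.length_eq_finrank, Module.finrank_fin_fun]
  rfl

end Length

/-! ### Curves touching along a square -/

theorem exists_tangent {n : ℕ} (v : Fin (n + 3) → ℂ) (i : Fin (n + 3))
    (f : MvPolynomial (Fin (n + 3)) ℂ) : ∃ τ ≠ 0, τ i = 0 ∧ dirDeriv v τ f = 0 := by
  let φ : (Fin (n + 3) → ℂ) →ₗ[ℂ] (Fin 2 → ℂ) :=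
    { toFun := fun τ => ![τ i, dirDeriv v τ f]
      map_add' := fun τ τ' => by simp [dirDeriv_add_right]
      map_smul' := fun c τ => by simp [dirDeriv_smul_right] }
  have h1 : LinearMap.ker φ ≠ ⊥ := LinearMap.ker_ne_bot_of_finrank_lt (by simp)
  obtain ⟨τ, hτ, hτ0⟩ := Submodule.exists_mem_ne_zero_of_ne_bot h1
  have h2 : ![τ i, dirDeriv v τ f] = 0 := hτ
  exact ⟨τ, hτ0, congrFun h2 0, congrFun h2 1⟩

/-- The differential of a smooth form does not vanish on the hyperplane `τᵢ = 0`, by Euler's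
formula. -/
theorem exists_dirDeriv_ne_zero {n d : ℕ} {f : MvPolynomial (Fin n) ℂ} (hf : f.IsHomogeneous d)
    {v : Fin n → ℂ} (hfv : eval v f = 0) (hsm : ∃ j, eval v (pderiv j f) ≠ 0) {i : Fin n}
    (hi : v i ≠ 0) : ∃ τ, τ i = 0 ∧ dirDeriv v τ f ≠ 0 := by
  obtain ⟨j, hj⟩ := hsm
  refine ⟨Pi.single j 1 + (-((Pi.single j 1 : Fin n → ℂ) i) / v i) • v, ?_, ?_⟩
  · simp only [Pi.add_apply, Pi.smul_apply, smul_eq_mul, div_mul_cancel₀ _ hi]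
    ring
  · rwa [dirDeriv_add_right, dirDeriv_smul_right, dirDeriv_self hf, hfv, mul_zero, mul_zero,
      add_zero, dirDeriv_single]

section Touching

variable {d : ℕ} {f g b u κ : MvPolynomial (Fin 3) ℂ} {v : Fin 3 → ℂ} {i : Fin 3}

theorem dirDeriv_eq_zero_of_sq (h : g * u = b ^ 2 + f * κ)
    (hfv : eval v f = 0) (hgv : eval v g = 0) :
    eval v b = 0 ∧ ∀ τ, dirDeriv v τ g * eval v u = dirDeriv v τ f * eval v κ := by
  have h1 := congrArg (eval v) h
  simp only [map_mul, map_add, map_pow, hfv, hgv, zero_mul, add_zero] at h1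
  have hb : eval v b = 0 := pow_eq_zero_iff two_ne_zero |>.mp h1.symm
  refine ⟨hb, fun τ => ?_⟩
  have h2 := congrArg (dirDeriv v τ) h
  rw [map_add, dirDeriv_sq, dirDeriv_mul, dirDeriv_mul, hb, hfv, hgv] at h2
  linear_combination h2

theorem X_pow_dvd_arc_coordinate {τ σ : Fin 3 → ℂ} (hτ : τ i = 0) (hσ : σ i = 0) (k : ℕ) :
    PowerSeries.X ^ k ∣ arc v τ σ (X i - C (v i)) := by
  simp [arc, hτ, hσ]

theorem X_sq_dvd_arc {τ : Fin 3 → ℂ} (σ : Fin 3 → ℂ) {G : MvPolynomial (Fin 3) ℂ}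
    (hG : eval v G = 0) (hτ : dirDeriv v τ G = 0) : PowerSeries.X ^ 2 ∣ arc v τ σ G := by
  rw [PowerSeries.X_pow_dvd_iff]
  intro m hm
  interval_cases m
  · rw [coeff_zero_arc, hG]
  · rw [coeff_one_arc, hτ]

/-- If `g` is a square modulo `f`, up to a unit, then `f` and `g` have the same tangents. -/
theorem two_le_intersectionMultiplicity (h : g * u = b ^ 2 + f * κ) (hu : eval v u ≠ 0)
    (hfv : eval v f = 0) (hgv : eval v g = 0) :
    2 ≤ intersectionMultiplicity f g i v := by
  obtain ⟨τ, hτ0, hτi, hτf⟩ := exists_tangent v i f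
  obtain ⟨j, hj⟩ := Function.ne_iff.1 hτ0
  refine le_length_of_arc v τ 0 (k := 2) hj ?_
  have hg := (dirDeriv_eq_zero_of_sq h hfv hgv).2 τ
  rw [hτf, zero_mul] at hg
  rintro G (rfl | rfl | rfl)
  · exact X_pow_dvd_arc_coordinate hτi rfl 2
  · exact X_sq_dvd_arc 0 hfv hτf
  · exact X_sq_dvd_arc 0 hgv ((mul_eq_zero.1 hg).resolve_right hu)

/-- If `g` is the square of `b` modulo `f`, up to a unit, and the multiplicity is at most two, then
`b` is a local parameter on the curve `f = 0`. -/
theorem dirDeriv_ne_zero_of_intersectionMultiplicity_le (hf : f.IsHomogeneous d)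
    (hsm : ∃ j, eval v (pderiv j f) ≠ 0) (hi : v i ≠ 0)
    (h : g * u = b ^ 2 + f * κ) (hu : eval v u ≠ 0)
    (hfv : eval v f = 0) (hgv : eval v g = 0)
    (hle : intersectionMultiplicity f g i v ≤ 2) {τ : Fin 3 → ℂ} (hτ0 : τ ≠ 0) (hτi : τ i = 0)
    (hτf : dirDeriv v τ f = 0) : dirDeriv v τ b ≠ 0 := by
  intro hτb
  obtain ⟨j, hj⟩ := Function.ne_iff.1 hτ0
  obtain ⟨σ₀, hσ₀i, hσ₀⟩ := exists_dirDeriv_ne_zero hf hfv hsm hi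
  -- the second order term of the arc is chosen such that the arc stays on `f = 0` to third order
  set σ : Fin 3 → ℂ := (-(PowerSeries.coeff 2 (arc v τ 0 f)) / dirDeriv v σ₀ f) • σ₀ with hσ
  have hσi : σ i = 0 := by simp [hσ, hσ₀i]
  have hσf : dirDeriv v σ f = -(PowerSeries.coeff 2 (arc v τ 0 f)) := by
    rw [hσ, dirDeriv_smul_right, div_mul_cancel₀ _ hσ₀]
  have h3f : PowerSeries.X ^ 3 ∣ arc v τ σ f := by
    rw [PowerSeries.X_pow_dvd_iff]
    intro m hm
    interval_cases m
    · rw [coeff_zero_arc, hfv]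
    · rw [coeff_one_arc, hτf]
    · rw [coeff_two_arc, hσf, add_neg_cancel]
  have h3g : PowerSeries.X ^ 3 ∣ arc v τ σ g := by
    have h1 := congrArg (arc v τ σ) h
    rw [map_mul, map_add, map_pow, map_mul] at h1
    have hb := X_sq_dvd_arc σ (dirDeriv_eq_zero_of_sq h hfv hgv).1 hτb
    rw [← (isUnit_arc v τ σ hu).dvd_mul_right, h1]
    refine dvd_add ((pow_dvd_pow _ (by norm_num : 3 ≤ 2 * 2)).trans ?_) (h3f.mul_right _)
    rw [pow_mul]
    exact pow_dvd_pow_of_dvd hb 2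
  have h4 : ((3 : ℕ) : ℕ∞) ≤ 2 := by
    refine le_trans (le_length_of_arc v τ σ (k := 3) hj ?_) hle
    rintro G (rfl | rfl | rfl)
    · exact X_pow_dvd_arc_coordinate hτi hσi 3
    · exact h3f
    · exact h3g
  exact absurd h4 (by decide)

/-- If `f` and `b` have independent differentials at a zero `v` of `f` and `g`, then the multiplicity is at
most two, since `f` and `b²` generate an ideal of colength two contained in `(f, g)`. -/
theorem intersectionMultiplicity_le_two (h : g * u = b ^ 2 + f * κ)
    (hfv : eval v f = 0) (hgv : eval v g = 0)
    (hτ : ∀ τ, τ i = 0 → dirDeriv v τ f = 0 → dirDeriv v τ b = 0 → τ = 0) :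
    intersectionMultiplicity f g i v ≤ 2 := by
  obtain ⟨hb, -⟩ := dirDeriv_eq_zero_of_sq h hfv hgv
  refine length_le_two v (b := b) ?_ (germ_eq_maximalIdeal v ?_ fun τ hτ' => hτ τ ?_ ?_ ?_).ge
  · rw [← map_pow, show b ^ 2 = u * g - κ * f by linear_combination -h]
    exact Ideal.mem_map_of_mem _ (sub_mem (Ideal.mul_mem_left _ _ (Ideal.subset_span (by simp)))
      (Ideal.mul_mem_left _ _ (Ideal.subset_span (by simp))))
  · intro G hG
    rw [← mem_vanishingIdeal_iff_eval]
    refine Ideal.span_le.2 ?_ hG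
    rintro G (rfl | rfl | rfl | rfl) <;> rw [SetLike.mem_coe, mem_vanishingIdeal_iff_eval]
    · exact hb
    · simp
    · exact hfv
    · exact hgv
  · have h1 := hτ' (X i - C (v i)) (Ideal.subset_span (by simp))
    rwa [sub_eq_add_neg, ← C_neg, map_add, dirDeriv_X, dirDeriv_C, add_zero] at h1
  · exact hτ' f (Ideal.subset_span (by simp))
  · exact hτ' b (Ideal.subset_span (by simp))

end Touching

section

open Projectivization
open scoped LinearAlgebra.Projectivization

/-- Modulo `f`, the form `g` is up to a unit the square of a form, locally at each common zero. -/
def IsLocallySquare (f g : MvPolynomial (Fin 3) ℂ) : Prop :=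
  ∀ v ≠ 0, eval v f = 0 → eval v g = 0 → ∃ (k : ℕ) (b u κ : MvPolynomial (Fin 3) ℂ),
    b.IsHomogeneous k ∧ g * u = b ^ 2 + f * κ ∧ eval v u ≠ 0

theorem isLocallySquare_quintic {F : MvPolynomial (Fin 6) ℂ} (hF : F.IsHomogeneous 3)
    (hsm : IsSmoothHypersurface (sextic F)) (h : Fin 6 → ℂ) :
    IsLocallySquare (sextic F) (quintic F h) := by
  intro v hv hfv _
  obtain ⟨j, hj⟩ := exists_adjugate_ne_zero hsm hv hfv
  obtain ⟨κ, hκ⟩ := exists_quintic_mul F h j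
  exact ⟨_, pole F h j, (gram F).adjugate j j, κ, isHomogeneous_pole hF h j, hκ, hj⟩

/-- The curves `f = 0` and `g = 0` meet with multiplicity at most two at every point of `ℙ²`. -/
def HasMultiplicityLeTwo (f g : MvPolynomial (Fin 3) ℂ) : Prop :=
  ∀ (v : Fin 3 → ℂ) (i : Fin 3), v i ≠ 0 → eval v f = 0 → eval v g = 0 →
    intersectionMultiplicity f g i v ≤ 2

section

variable {f g : MvPolynomial (Fin 3) ℂ} {m n : ℕ}

theorem ne_zero_of_apply_ne_zero {ι : Type*} {v : ι → ℂ} {i : ι} (h : v i ≠ 0) : v ≠ 0 :=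
  fun h0 => h (congrFun h0 i)

theorem isRelPrime_of_smooth (hf : f.IsHomogeneous m) (hg : g.IsHomogeneous n) (hm : m ≠ 0)
    (hn : n ≠ 0) (hmn : m ≠ n) (hfs : IsSmoothHypersurface f) (hgs : IsSmoothHypersurface g) :
    IsRelPrime f g := by
  have hfi := irreducible_of_isSmoothHypersurface hf hm hfs
  have hgi := irreducible_of_isSmoothHypersurface hg hn hgs
  rw [hfi.isRelPrime_iff_not_dvd]
  intro hdvd
  have has := hfi.associated_of_dvd hgi hdvd
  obtain ⟨u, hu⟩ := has
  obtain ⟨c, hc⟩ := MvPolynomial.isUnit_iff_eq_C_of_isReduced.1 u.isUnit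
  have h1 : g.IsHomogeneous m := by
    rw [← hu, hc.2, mul_comm]
    exact hf.C_mul c
  exact hmn (h1.inj_right hg hgi.ne_zero)

/-- Bézout's theorem: the two curves have `mn / 2` intersection points, as all multiplicities are two. -/
theorem two_mul_ncard_of_isLocallySquare (hf : f.IsHomogeneous m) (hg : g.IsHomogeneous n)
    (hm : m ≠ 0) (hn : n ≠ 0) (hmn : m ≠ n) (hfs : IsSmoothHypersurface f)
    (hgs : IsSmoothHypersurface g) (hsq : IsLocallySquare f g) (hle : HasMultiplicityLeTwo f g) :
    {x : ℙ ℂ (Fin 3 → ℂ) | eval x.rep f = 0 ∧ eval x.rep g = 0}.Finite ∧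
    2 * {x : ℙ ℂ (Fin 3 → ℂ) | eval x.rep f = 0 ∧ eval x.rep g = 0}.ncard = m * n := by
  refine two_mul_ncard_common_zeros hf hg hn (ne_zero_of_isSmoothHypersurface hfs)
    (ne_zero_of_isSmoothHypersurface hgs) (isRelPrime_of_smooth hf hg hm hn hmn hfs hgs) hfs
    fun v hv hfv hgv => ?_
  obtain ⟨k, b, u, κ, hb, h, hu⟩ := hsq v hv hfv hgv
  obtain ⟨i, hi⟩ := Function.ne_iff.1 hv
  obtain ⟨τ, hτ0, hτi, hτf⟩ := exists_tangent v i f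
  obtain ⟨hbv, hd⟩ := dirDeriv_eq_zero_of_sq h hfv hgv
  refine ⟨b, k, τ, hb, hbv, ?_, fun c hc => ?_, hτf, ?_, ?_⟩
  · rw [show b ^ 2 = u * g - κ * f by linear_combination -h]
    exact sub_mem (Ideal.mul_mem_left _ _ (Ideal.subset_span (by simp)))
      (Ideal.mul_mem_left _ _ (Ideal.subset_span (by simp)))
  · apply hτ0
    have hci : c * v i = 0 := by rw [← hτi, hc, Pi.smul_apply, smul_eq_mul]
    rw [hc, (mul_eq_zero.1 hci).resolve_right hi, zero_smul]
  · have := hd τ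
    rw [hτf, zero_mul] at this
    exact (mul_eq_zero.1 this).resolve_right hu
  · exact dirDeriv_ne_zero_of_intersectionMultiplicity_le hf (hfs v hv hfv) hi h hu hfv hgv
      (hle v i hi hfv hgv) hτ0 hτi hτf

theorem intersectionMultiplicity_eq_two (hsq : IsLocallySquare f g)
    (hle : HasMultiplicityLeTwo f g) {v : Fin 3 → ℂ} {i : Fin 3} (hi : v i ≠ 0)
    (hfv : eval v f = 0) (hgv : eval v g = 0) : intersectionMultiplicity f g i v = 2 := by
  obtain ⟨k, b, u, κ, -, h, hu⟩ := hsq v (ne_zero_of_apply_ne_zero hi) hfv hgv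
  exact le_antisymm (hle v i hi hfv hgv) (two_le_intersectionMultiplicity h hu hfv hgv)

end

end

/-! ### Weighted cones and their affine charts -/

/-- The action of scalars on the coordinates of the total space of `𝒪(3)`. -/
def act (c : ℂ) (p : Fin 4 → ℂ) : Fin 4 → ℂ := ![c * p 0, c * p 1, c * p 2, c ^ 3 * p 3]

/-- The ideal `J` defines a cone for the weights `1, 1, 1, 3`. -/
def IsWeightedIdeal (J : Ideal (MvPolynomial (Fin 4) ℂ)) : Prop :=
  ∀ c, ∀ p ∈ zeroLocus ℂ J, act c p ∈ zeroLocus ℂ J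

/-- The subset of the total space of `𝒪(3)` with equations `J`. -/
def locus (J : Ideal (MvPolynomial (Fin 4) ℂ)) : Set TotO3 :=
  {q | ∀ p : TotRep, ⟦p⟧ = q → p.1 ∈ zeroLocus ℂ J}

section Locus

variable {J : Ideal (MvPolynomial (Fin 4) ℂ)}

theorem exists_act_of_mk_eq {p q : TotRep} (h : (⟦p⟧ : TotO3) = ⟦q⟧) :
    ∃ c : ℂ, c ≠ 0 ∧ q.1 = act c p.1 :=
  Quotient.exact h

theorem mk_mem_locus (hJ : IsWeightedIdeal J) (p : TotRep) :
    ⟦p⟧ ∈ locus J ↔ p.1 ∈ zeroLocus ℂ J := by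
  refine ⟨fun h => h p rfl, fun h q hq => ?_⟩
  obtain ⟨c, -, hc⟩ := exists_act_of_mk_eq hq.symm
  rw [hc]
  exact hJ c _ h

theorem mem_cone_locus (hJ : IsWeightedIdeal J) (p : Fin 4 → ℂ) :
    p ∈ cone (locus J) ↔ ![p 0, p 1, p 2] ≠ 0 ∧ p ∈ zeroLocus ℂ J :=
  ⟨fun ⟨hp, h⟩ => ⟨hp, (mk_mem_locus hJ ⟨p, hp⟩).1 h⟩,
    fun ⟨hp, h⟩ => ⟨hp, (mk_mem_locus hJ ⟨p, hp⟩).2 h⟩⟩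

theorem base_ne_zero_of_apply_ne_zero {p : Fin 4 → ℂ} {i : Fin 3} (h : p i.castSucc ≠ 0) :
    ![p 0, p 1, p 2] ≠ 0 := by
  intro h0
  apply h
  have := congrFun h0 i
  fin_cases i <;> exact this

theorem exists_apply_ne_zero (p : TotRep) : ∃ i : Fin 3, p.1 i.castSucc ≠ 0 := by
  by_contra! h
  apply p.2
  funext i
  fin_cases i
  · exact h 0
  · exact h 1
  · exact h 2

theorem vanishingIdeal_zeroLocus_of_isPrime (hJp : J.IsPrime) :
    vanishingIdeal ℂ (zeroLocus ℂ J) = J := by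
  rw [vanishingIdeal_zeroLocus_eq_radical, hJp.radical]

theorem vanishingIdeal_cone_locus (hJ : IsWeightedIdeal J) (hJp : J.IsPrime) {p : Fin 4 → ℂ}
    (hp : p ∈ zeroLocus ℂ J) (hp0 : ![p 0, p 1, p 2] ≠ 0) :
    vanishingIdeal ℂ (cone (locus J)) = J := by
  refine le_antisymm (fun G hG => ?_) (fun G hG q hq => ((mem_cone_locus hJ q).1 hq).2 G hG)
  obtain ⟨i, hi⟩ := exists_apply_ne_zero ⟨p, hp0⟩
  have h1 : G * X i.castSucc ∈ J := by
    rw [← vanishingIdeal_zeroLocus_of_isPrime hJp]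
    intro q hq
    rw [map_mul, aeval_X]
    by_cases hqi : q i.castSucc = 0
    · rw [hqi, mul_zero]
    · rw [hG q ((mem_cone_locus hJ q).2 ⟨base_ne_zero_of_apply_ne_zero hqi, hq⟩), zero_mul]
  refine (hJp.mem_or_mem h1).resolve_right fun h2 => hi ?_
  have := hp _ h2
  rwa [aeval_X] at this

/-- Homogenization of `G` with respect to the `i`-th coordinate, on the chart where it is `c`. -/
theorem exists_homogenization (i : Fin 3) (c : ℂ) (G : MvPolynomial (Fin 4) ℂ) :
    ∃ (N : ℕ) (G' : MvPolynomial (Fin 4) ℂ),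
      (∀ r : Fin 4 → ℂ, r i.castSucc ≠ 0 →
        eval r G' = r i.castSucc ^ N * eval (act (c / r i.castSucc) r) G) ∧
      G' - C (c ^ N) * G ∈ Ideal.span {X i.castSucc - C c} := by
  have hXC : ∀ N : ℕ, X i.castSucc ^ N - C (c ^ N) ∈
      Ideal.span {(X i.castSucc - C c : MvPolynomial (Fin 4) ℂ)} := fun N => by
    rw [C_pow]
    exact Ideal.mem_span_singleton.2 (sub_dvd_pow_sub_pow _ _ N)
  induction G using MvPolynomial.induction_on with
  | C a => exact ⟨0, C a, by simp, by simp⟩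
  | add G H hG hH =>
    obtain ⟨N, G', hG1, hG2⟩ := hG
    obtain ⟨M, H', hH1, hH2⟩ := hH
    refine ⟨N + M, X i.castSucc ^ M * G' + X i.castSucc ^ N * H', fun r hr => ?_, ?_⟩
    · simp only [map_add, map_mul, map_pow, eval_X, hG1 r hr, hH1 r hr]
      ring
    · have h1 := add_mem (add_mem (Ideal.mul_mem_left _ (X i.castSucc ^ M) hG2)
        (Ideal.mul_mem_left _ (X i.castSucc ^ N) hH2))
        (add_mem (Ideal.mul_mem_left _ (C (c ^ N) * G) (hXC M))
          (Ideal.mul_mem_left _ (C (c ^ M) * H) (hXC N)))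
      convert h1 using 1
      simp only [pow_add, C_mul, C_pow]
      ring
  | mul_X G j hG =>
    obtain ⟨N, G', hG1, hG2⟩ := hG
    have key : ∀ k : ℕ, (∀ r : Fin 4 → ℂ, r i.castSucc ≠ 0 →
        r i.castSucc ^ k * act (c / r i.castSucc) r j = c ^ k * r j) →
        ∃ (N : ℕ) (G' : MvPolynomial (Fin 4) ℂ),
          (∀ r : Fin 4 → ℂ, r i.castSucc ≠ 0 →
            eval r G' = r i.castSucc ^ N * eval (act (c / r i.castSucc) r) (G * X j)) ∧
          G' - C (c ^ N) * (G * X j) ∈ Ideal.span {X i.castSucc - C c} := by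
      intro k hk
      refine ⟨N + k, G' * (C (c ^ k) * X j), fun r hr => ?_, ?_⟩
      · have := hk r hr
        simp only [map_mul, eval_C, eval_X, hG1 r hr]
        rw [← this]
        ring
      · convert Ideal.mul_mem_right (C (c ^ k) * X j) _ hG2 using 1
        simp only [pow_add, C_mul, C_pow]
        ring
    fin_cases j
    · exact key 1 fun r hr => by simp [act]; field_simp
    · exact key 1 fun r hr => by simp [act]; field_simp
    · exact key 1 fun r hr => by simp [act]; field_simp
    · exact key 3 fun r hr => by simp [act]; field_simp

/-- The ideal of an affine chart of a weighted cone. -/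
theorem vanishingIdeal_chart_locus (hJ : IsWeightedIdeal J) (hJp : J.IsPrime) {i : Fin 3}
    {p : TotRep} (hi : p.1 i.castSucc ≠ 0) :
    vanishingIdeal ℂ (chart (locus J) i p) =
      Ideal.span {X i.castSucc - C (p.1 i.castSucc)} ⊔ J := by
  set c := p.1 i.castSucc with hc
  refine le_antisymm (fun G hG => ?_) (sup_le ?_ fun G hG q hq => ?_)
  · obtain ⟨N, G', h1, h2⟩ := exists_homogenization i c G
    have h3 : X i.castSucc * G' ∈ J := by
      rw [← vanishingIdeal_zeroLocus_of_isPrime hJp]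
      intro r hr
      rw [map_mul, aeval_X, aeval_eq_eval]
      by_cases hri : r i.castSucc = 0
      · rw [hri, zero_mul]
      · have hci : act (c / r i.castSucc) r i.castSucc = c := by
          have : ∀ a : ℂ, act a r i.castSucc = a * r i.castSucc := by
            intro a
            fin_cases i <;> rfl
          rw [this, div_mul_cancel₀ _ hri]
        have h4 : act (c / r i.castSucc) r ∈ chart (locus J) i p := by
          refine ⟨(mem_cone_locus hJ _).2 ⟨base_ne_zero_of_apply_ne_zero (i := i) ?_, hJ _ _ hr⟩,
            hci⟩
          rwa [hci]
        have h5 := hG _ h4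
        rw [aeval_eq_eval] at h5
        rw [h1 r hri, h5, mul_zero, mul_zero]
    have h4 : C (c ^ (N + 1)) * G =
        (-(X i.castSucc * (G' - C (c ^ N) * G)) - (C (c ^ N) * G) * (X i.castSucc - C c)) +
          X i.castSucc * G' := by
      simp only [pow_succ, C_mul, C_pow]
      ring
    have h5 : C (c ^ (N + 1)) * G ∈ Ideal.span {X i.castSucc - C c} ⊔ J := by
      rw [h4]
      exact add_mem (Ideal.mem_sup_left (sub_mem (neg_mem (Ideal.mul_mem_left _ _ h2))
        (Ideal.mul_mem_left _ _ (Ideal.mem_span_singleton_self _)))) (Ideal.mem_sup_right h3)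
    have h6 : G = C ((c ^ (N + 1))⁻¹) * (C (c ^ (N + 1)) * G) := by
      rw [← mul_assoc, ← C_mul, inv_mul_cancel₀ (pow_ne_zero _ hi), C_1, one_mul]
    rw [h6]
    exact Ideal.mul_mem_left _ _ h5
  · rw [Ideal.span_le, Set.singleton_subset_iff]
    intro q hq
    rw [map_sub, aeval_X, aeval_C, hq.2, hc]
    exact sub_self _
  · exact ((mem_cone_locus hJ q).1 hq.1).2 G hG

theorem localIdeal_locus (hJ : IsWeightedIdeal J) (hJp : J.IsPrime) {i : Fin 3}
    {p : TotRep} (hi : p.1 i.castSucc ≠ 0) :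
    localIdeal (locus J) i p =
      germ p.1 (Ideal.span {X i.castSucc - C (p.1 i.castSucc)} ⊔ J) := by
  rw [localIdeal, vanishingIdeal_chart_locus hJ hJp hi]

end Locus

/-! ### Double planes and curves on them -/

/-- Pull back of polynomials from `ℂ³` to the total space of `𝒪(3)`. -/
def toTot : MvPolynomial (Fin 3) ℂ →ₐ[ℂ] MvPolynomial (Fin 4) ℂ := rename Fin.castSucc

theorem eval_toTot (p : Fin 4 → ℂ) (a : MvPolynomial (Fin 3) ℂ) :
    eval p (toTot a) = eval ![p 0, p 1, p 2] a := by
  rw [toTot, eval_rename]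
  congr 2
  funext i
  fin_cases i <;> rfl

/-- The equations `w² = f` and `a = 0` for `a` in `𝔮`. -/
def doubleIdeal (f : MvPolynomial (Fin 3) ℂ) (𝔮 : Ideal (MvPolynomial (Fin 3) ℂ)) :
    Ideal (MvPolynomial (Fin 4) ℂ) :=
  Ideal.span {X 3 ^ 2 - toTot f} ⊔ 𝔮.map toTot

section Double

variable {f : MvPolynomial (Fin 3) ℂ} {𝔮 : Ideal (MvPolynomial (Fin 3) ℂ)}

theorem exists_normal_form (f : MvPolynomial (Fin 3) ℂ) (G : MvPolynomial (Fin 4) ℂ) :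
    ∃ a b, G - (toTot a + X 3 * toTot b) ∈ Ideal.span {X 3 ^ 2 - toTot f} := by
  induction G using MvPolynomial.induction_on with
  | C c => exact ⟨C c, 0, by simp [toTot]⟩
  | add G H hG hH =>
    obtain ⟨a, b, h1⟩ := hG
    obtain ⟨a', b', h2⟩ := hH
    refine ⟨a + a', b + b', ?_⟩
    convert add_mem h1 h2 using 1
    simp only [map_add]
    ring
  | mul_X G j hG =>
    obtain ⟨a, b, h1⟩ := hG
    induction j using Fin.lastCases with
    | last =>
      refine ⟨f * b, a, ?_⟩
      convert add_mem (Ideal.mul_mem_right (X 3) _ h1)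
        (Ideal.mul_mem_left _ (toTot b) (Ideal.mem_span_singleton_self (X 3 ^ 2 - toTot f)))
        using 1
      simp only [map_mul, show Fin.last 3 = 3 from rfl]
      ring
    | cast j =>
      refine ⟨a * X j, b * X j, ?_⟩
      convert Ideal.mul_mem_right (X j.castSucc) _ h1 using 1
      simp only [map_mul, toTot, rename_X]
      ring

/-- Coordinates `a + b w` modulo `w² = f` and `𝔮`. -/
def toQuadratic (f : MvPolynomial (Fin 3) ℂ) (𝔮 : Ideal (MvPolynomial (Fin 3) ℂ)) :
    MvPolynomial (Fin 4) ℂ →ₐ[ℂ]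
      QuadraticAlgebra (MvPolynomial (Fin 3) ℂ ⧸ 𝔮) (Ideal.Quotient.mk 𝔮 f) 0 :=
  aeval (Fin.lastCases ⟨0, 1⟩ fun j => ⟨Ideal.Quotient.mk 𝔮 (X j), 0⟩)

theorem toQuadratic_toTot (a : MvPolynomial (Fin 3) ℂ) :
    toQuadratic f 𝔮 (toTot a) = ⟨Ideal.Quotient.mk 𝔮 a, 0⟩ := by
  have h : (toQuadratic f 𝔮).comp toTot =
      (IsScalarTower.toAlgHom ℂ (MvPolynomial (Fin 3) ℂ ⧸ 𝔮)
        (QuadraticAlgebra (MvPolynomial (Fin 3) ℂ ⧸ 𝔮) (Ideal.Quotient.mk 𝔮 f) 0)).comp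
        (Ideal.Quotient.mkₐ ℂ 𝔮) := by
    refine algHom_ext fun j => ?_
    simp [toTot, toQuadratic]
    rfl
  exact DFunLike.congr_fun h a

theorem toQuadratic_X : toQuadratic f 𝔮 (X 3) = ⟨0, 1⟩ := by
  rw [toQuadratic, aeval_X]
  exact Fin.lastCases_last

theorem ker_toQuadratic : RingHom.ker (toQuadratic f 𝔮) = doubleIdeal f 𝔮 := by
  have h1 : doubleIdeal f 𝔮 ≤ RingHom.ker (toQuadratic f 𝔮) := by
    refine sup_le ?_ (Ideal.map_le_iff_le_comap.2 fun a ha => ?_)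
    · rw [Ideal.span_le, Set.singleton_subset_iff, SetLike.mem_coe, RingHom.mem_ker, map_sub,
        map_pow, toQuadratic_X, toQuadratic_toTot]
      ext <;> simp [pow_two]
    · rw [Ideal.mem_comap, RingHom.mem_ker, toQuadratic_toTot, Ideal.Quotient.eq_zero_iff_mem.2 ha]
      rfl
  refine le_antisymm (fun G hG => ?_) h1
  obtain ⟨a, b, hab⟩ := exists_normal_form f G
  have hab' : G - (toTot a + X 3 * toTot b) ∈ doubleIdeal f 𝔮 := Ideal.mem_sup_left hab
  have h2 : toQuadratic f 𝔮 (toTot a + X 3 * toTot b) = 0 := by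
    have h3 := h1 hab'
    rw [RingHom.mem_ker] at hG h3
    rw [map_sub, hG, zero_sub, neg_eq_zero] at h3
    exact h3
  rw [map_add, map_mul, toQuadratic_toTot, toQuadratic_toTot, toQuadratic_X] at h2
  have h3 := congrArg QuadraticAlgebra.re h2
  have h4 := congrArg QuadraticAlgebra.im h2
  simp [Ideal.Quotient.eq_zero_iff_mem] at h3 h4
  rw [← sub_add_cancel G (toTot a + X 3 * toTot b)]
  exact add_mem hab' (add_mem (Ideal.mem_sup_right (Ideal.mem_map_of_mem _ h3))
    (Ideal.mul_mem_left _ _ (Ideal.mem_sup_right (Ideal.mem_map_of_mem _ h4))))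

/-- If `f` is not a square in the function field of `𝔮`, then the double cover `w² = f` of the zero
set of `𝔮` is irreducible. -/
theorem isPrime_doubleIdeal (h𝔮 : 𝔮.IsPrime) (h : ∀ a b, a ^ 2 - f * b ^ 2 ∈ 𝔮 → a ∈ 𝔮 ∧ b ∈ 𝔮) :
    (doubleIdeal f 𝔮).IsPrime := by
  have hnorm : ∀ z : QuadraticAlgebra (MvPolynomial (Fin 3) ℂ ⧸ 𝔮) (Ideal.Quotient.mk 𝔮 f) 0,
      QuadraticAlgebra.norm z = 0 → z = 0 := by
    intro z hz
    obtain ⟨a, ha⟩ := Ideal.Quotient.mk_surjective z.re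
    obtain ⟨b, hb⟩ := Ideal.Quotient.mk_surjective z.im
    have h1 : a ^ 2 - f * b ^ 2 ∈ 𝔮 := by
      rw [← Ideal.Quotient.eq_zero_iff_mem, ← hz, QuadraticAlgebra.norm_def, ← ha, ← hb]
      simp only [map_sub, map_pow, map_mul]
      ring
    obtain ⟨h2, h3⟩ := h a b h1
    ext
    · rw [← ha, Ideal.Quotient.eq_zero_iff_mem.2 h2]
      rfl
    · rw [← hb, Ideal.Quotient.eq_zero_iff_mem.2 h3]
      rfl
  rw [← ker_toQuadratic]
  refine ⟨fun ht => ?_, fun {G H} hGH => ?_⟩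
  · have h1 : (1 : MvPolynomial (Fin 4) ℂ) ∈ RingHom.ker (toQuadratic f 𝔮) := ht ▸ trivial
    rw [RingHom.mem_ker, map_one] at h1
    exact one_ne_zero h1
  · rw [RingHom.mem_ker, map_mul] at hGH
    have h1 := congrArg QuadraticAlgebra.norm hGH
    rw [map_mul, QuadraticAlgebra.norm_zero] at h1
    exact (mul_eq_zero.1 h1).imp (hnorm _) (hnorm _)

theorem isPrime_doubleIdeal_bot (hf : Irreducible f) : (doubleIdeal f ⊥).IsPrime := by
  refine isPrime_doubleIdeal Ideal.isPrime_bot fun a b h => ?_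
  rw [Ideal.mem_bot, sub_eq_zero] at h
  simp only [Ideal.mem_bot]
  have hp := hf.prime
  by_cases hb : b = 0
  · rw [hb, zero_pow two_ne_zero, mul_zero] at h
    exact ⟨pow_eq_zero_iff two_ne_zero |>.1 h, hb⟩
  · exfalso
    have ha : a ≠ 0 := by
      rintro rfl
      rw [zero_pow two_ne_zero] at h
      exact mul_ne_zero hp.ne_zero (pow_ne_zero 2 hb) h.symm
    have h1 := congrArg (emultiplicity f) h
    rw [emultiplicity_mul hp, emultiplicity_pow hp, emultiplicity_pow hp,
      (FiniteMultiplicity.of_not_isUnit hp.not_isUnit ha).emultiplicity_eq_multiplicity,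
      (FiniteMultiplicity.of_not_isUnit hp.not_isUnit hb).emultiplicity_eq_multiplicity,
      (FiniteMultiplicity.of_not_isUnit hp.not_isUnit hp.ne_zero).emultiplicity_eq_multiplicity,
      multiplicity_self] at h1
    norm_cast at h1
    omega

theorem mem_zeroLocus_doubleIdeal (p : Fin 4 → ℂ) : p ∈ zeroLocus ℂ (doubleIdeal f 𝔮) ↔
    p 3 ^ 2 = eval ![p 0, p 1, p 2] f ∧ ∀ a ∈ 𝔮, eval ![p 0, p 1, p 2] a = 0 := by
  constructor
  · intro h
    refine ⟨?_, fun a ha => ?_⟩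
    · have := h _ (Ideal.mem_sup_left (Ideal.mem_span_singleton_self _))
      rw [aeval_eq_eval, map_sub, map_pow, eval_X, eval_toTot] at this
      exact sub_eq_zero.1 this
    · have := h _ (Ideal.mem_sup_right (Ideal.mem_map_of_mem _ ha))
      rwa [aeval_eq_eval, eval_toTot] at this
  · rintro ⟨h1, h2⟩
    have : doubleIdeal f 𝔮 ≤ RingHom.ker (eval p) := by
      refine sup_le ?_ (Ideal.map_le_iff_le_comap.2 fun a ha => ?_)
      · rw [Ideal.span_le, Set.singleton_subset_iff, SetLike.mem_coe, RingHom.mem_ker, map_sub,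
          map_pow, eval_X, eval_toTot, h1, sub_self]
      · rw [Ideal.mem_comap, RingHom.mem_ker, eval_toTot, h2 a ha]
    intro G hG
    exact this hG

end Double

/-! ### Nodes of the double cover of a touching curve -/

section

open Projectivization
open scoped LinearAlgebra.Projectivization

theorem dirDeriv_toTot (p τ : Fin 4 → ℂ) (a : MvPolynomial (Fin 3) ℂ) :
    dirDeriv p τ (toTot a) = dirDeriv ![p 0, p 1, p 2] ![τ 0, τ 1, τ 2] a := by
  induction a using MvPolynomial.induction_on with
  | C c => simp [toTot]
  | add a b ha hb => simp only [map_add, ha, hb]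
  | mul_X a j ha =>
    rw [map_mul, dirDeriv_mul, dirDeriv_mul, ha, eval_toTot, eval_toTot]
    congr 2
    rw [toTot, rename_X, dirDeriv_X, dirDeriv_X]
    fin_cases j <;> rfl

theorem isWeightedIdeal_doubleIdeal {f : MvPolynomial (Fin 3) ℂ}
    {𝔮 : Ideal (MvPolynomial (Fin 3) ℂ)} (hf : f.IsHomogeneous 6)
    (h : ∀ (c : ℂ) (v : Fin 3 → ℂ), (∀ a ∈ 𝔮, eval v a = 0) → ∀ a ∈ 𝔮, eval (c • v) a = 0) :
    IsWeightedIdeal (doubleIdeal f 𝔮) := by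
  intro c p hp
  rw [mem_zeroLocus_doubleIdeal] at hp ⊢
  have h1 : ![act c p 0, act c p 1, act c p 2] = c • ![p 0, p 1, p 2] := by
    funext j
    fin_cases j <;> rfl
  rw [h1]
  refine ⟨?_, h c _ hp.2⟩
  rw [hf.eval_smul, ← hp.1]
  simp only [act, Matrix.cons_val]
  ring

theorem isWeightedIdeal_doubleIdeal_bot {f : MvPolynomial (Fin 3) ℂ} (hf : f.IsHomogeneous 6) :
    IsWeightedIdeal (doubleIdeal f ⊥) :=
  isWeightedIdeal_doubleIdeal hf fun c v _ a ha => by rw [Ideal.mem_bot.1 ha, map_zero]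

theorem forall_mem_span_singleton_eval {n : ℕ} (g : MvPolynomial (Fin n) ℂ) (v : Fin n → ℂ) :
    (∀ a ∈ Ideal.span {g}, eval v a = 0) ↔ eval v g = 0 := by
  refine ⟨fun h => h g (Ideal.mem_span_singleton_self g), fun h a ha => ?_⟩
  obtain ⟨b, rfl⟩ := Ideal.mem_span_singleton.1 ha
  rw [map_mul, h, zero_mul]

theorem isWeightedIdeal_doubleIdeal_span {f g : MvPolynomial (Fin 3) ℂ} {d : ℕ}
    (hf : f.IsHomogeneous 6) (hg : g.IsHomogeneous d) :
    IsWeightedIdeal (doubleIdeal f (Ideal.span {g})) :=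
  isWeightedIdeal_doubleIdeal hf fun c v hv => by
    rw [forall_mem_span_singleton_eval] at hv ⊢
    rw [hg.eval_smul, hv, mul_zero]

section LocalStructure

variable {f g : MvPolynomial (Fin 3) ℂ} {d : ℕ}

theorem localIdeal_double (hf : f.IsHomogeneous 6) (hS : (doubleIdeal f ⊥).IsPrime) {p : TotRep}
    {i : Fin 3} (hi : p.1 i.castSucc ≠ 0) :
    localIdeal (locus (doubleIdeal f ⊥)) i p =
      germ p.1 (Ideal.span {X i.castSucc - C (p.1 i.castSucc), X 3 ^ 2 - toTot f}) := by
  rw [localIdeal_locus (isWeightedIdeal_doubleIdeal_bot hf) hS hi, doubleIdeal, Ideal.map_bot,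
    sup_bot_eq, Ideal.span_insert]

theorem localIdeal_curve (hf : f.IsHomogeneous 6) (hg : g.IsHomogeneous d)
    (hS : (doubleIdeal f ⊥).IsPrime) (hT : (doubleIdeal f (Ideal.span {g})).IsPrime) {p : TotRep}
    {i : Fin 3} (hi : p.1 i.castSucc ≠ 0) :
    localIdeal (locus (doubleIdeal f (Ideal.span {g}))) i p =
      Ideal.span {algebraMap _ (LocalRingAt p.1) (toTot g)} ⊔
        localIdeal (locus (doubleIdeal f ⊥)) i p := by
  rw [localIdeal_locus (isWeightedIdeal_doubleIdeal_span hf hg) hT hi, localIdeal_double hf hS hi,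
    doubleIdeal, Ideal.map_span, Set.image_singleton, Ideal.span_insert, germ, germ, ← sup_assoc,
    sup_comm _ (Ideal.span {toTot g}), Ideal.map_sup, Ideal.map_span _ {toTot g},
    Set.image_singleton]

/-- The double cover of a smooth curve is smooth away from the branch curve. -/
theorem isSmoothAt_of_ne_zero (hf : f.IsHomogeneous 6) (hg : g.IsHomogeneous d)
    (hS : (doubleIdeal f ⊥).IsPrime) (hT : (doubleIdeal f (Ideal.span {g})).IsPrime)
    (hgs : IsSmoothHypersurface g) {q : TotO3} (hq : q ∈ locus (doubleIdeal f (Ideal.span {g})))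
    (hw : ∀ p : TotRep, ⟦p⟧ = q → p.1 3 ≠ 0) :
    IsSmoothAt (locus (doubleIdeal f ⊥)) (locus (doubleIdeal f (Ideal.span {g}))) q := by
  intro p i hp hi
  have hw := hw p hp
  obtain ⟨hfp, hgp⟩ := (mem_zeroLocus_doubleIdeal p.1).1 (hq p hp)
  rw [forall_mem_span_singleton_eval] at hgp
  set v : Fin 3 → ℂ := ![p.1 0, p.1 1, p.1 2] with hv
  have hvi : v i = p.1 i.castSucc := by fin_cases i <;> rfl
  refine ⟨_, localIdeal_curve hf hg hS hT hi,
    algebraMap_mem_maximalIdeal _ (by rw [eval_toTot, hgp]), fun hmem => ?_⟩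
  obtain ⟨τ, hτi, hτ⟩ := exists_dirDeriv_ne_zero hg hgp (hgs v p.2 hgp) (i := i) (hvi ▸ hi)
  -- the lift of `τ` to a tangent vector of the double plane
  set σ : Fin 4 → ℂ := ![τ 0, τ 1, τ 2, dirDeriv v τ f / (2 * p.1 3)] with hσ
  have hστ : ![σ 0, σ 1, σ 2] = τ := by
    funext j
    fin_cases j <;> rfl
  have hσi : σ i.castSucc = 0 := by
    rw [← hτi]
    fin_cases i <;> rfl
  have hle : IsLocalRing.maximalIdeal (LocalRingAt p.1) ^ 2 ⊔
      localIdeal (locus (doubleIdeal f ⊥)) i p ≤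
        (Ideal.span {(PowerSeries.X : PowerSeries ℂ) ^ 2}).comap (localArc p.1 σ 0).toRingHom := by
    refine sup_le ?_ ?_
    · refine (Ideal.pow_right_mono (show IsLocalRing.maximalIdeal (LocalRingAt p.1) ≤
        (Ideal.span {(PowerSeries.X : PowerSeries ℂ)}).comap (localArc p.1 σ 0).toRingHom from
        fun y hy => localArc_mem_of_mem_maximalIdeal p.1 σ 0 hy) 2).trans
        ((Ideal.le_comap_pow _ 2).trans (Ideal.comap_mono ?_))
      rw [Ideal.span_singleton_pow]
    · rw [localIdeal_double hf hS hi, germ, Ideal.map_span, Ideal.span_le]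
      rintro _ ⟨G, hG, rfl⟩
      change localArc p.1 σ 0 (algebraMap _ _ G) ∈
        Ideal.span {(PowerSeries.X : PowerSeries ℂ) ^ 2}
      rw [localArc_algebraMap, Ideal.mem_span_singleton, PowerSeries.X_pow_dvd_iff]
      have key : eval p.1 G = 0 ∧ dirDeriv p.1 σ G = 0 := by
        rcases hG with rfl | rfl
        · refine ⟨by simp, ?_⟩
          rw [sub_eq_add_neg, ← C_neg, map_add, dirDeriv_X, dirDeriv_C, add_zero, hσi]
        · refine ⟨by rw [map_sub, map_pow, eval_X, eval_toTot, hfp, sub_self], ?_⟩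
          rw [sub_eq_add_neg, ← neg_one_mul, ← C_1, ← C_neg, map_add, dirDeriv_sq, dirDeriv_mul,
            dirDeriv_toTot, hστ, dirDeriv_X, dirDeriv_C, eval_X, eval_C]
          simp only [hσ, Matrix.cons_val]
          field_simp
          ring
      intro m hm
      interval_cases m
      · rw [coeff_zero_arc, key.1]
      · rw [coeff_one_arc, key.2]
  have h1 : localArc p.1 σ 0 (algebraMap _ _ (toTot g)) ∈
      Ideal.span {(PowerSeries.X : PowerSeries ℂ) ^ 2} := hle hmem
  rw [localArc_algebraMap, Ideal.mem_span_singleton, PowerSeries.X_pow_dvd_iff] at h1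
  apply hτ
  rw [← h1 1 one_lt_two, coeff_one_arc, dirDeriv_toTot, hστ]

section Branch

variable {b u κ : MvPolynomial (Fin 3) ℂ} {p : TotRep} {i : Fin 3}

theorem algebraMap_equation_mem (hf : f.IsHomogeneous 6) (hS : (doubleIdeal f ⊥).IsPrime)
    (hi : p.1 i.castSucc ≠ 0) :
    algebraMap (MvPolynomial (Fin 4) ℂ) (LocalRingAt p.1) (X 3) ^ 2 - algebraMap _ _ (toTot f) ∈
      localIdeal (locus (doubleIdeal f ⊥)) i p := by
  rw [localIdeal_double hf hS hi, ← map_pow, ← map_sub]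
  exact Ideal.mem_map_of_mem _ (Ideal.subset_span (by simp))

/-- On the double plane, the equation `g u ≡ b² + w² κ` of the curve has order two at `w = b = 0`. -/
theorem not_isSmoothAt_of_branch (hf : f.IsHomogeneous 6) (hg : g.IsHomogeneous d)
    (hS : (doubleIdeal f ⊥).IsPrime) (hT : (doubleIdeal f (Ideal.span {g})).IsPrime)
    (hi : p.1 i.castSucc ≠ 0) (hw : p.1 3 = 0)
    (h : g * u = b ^ 2 + f * κ) (hu : eval (base p) u ≠ 0) (hb : eval (base p) b = 0) :
    ¬ IsSmoothAt (locus (doubleIdeal f ⊥)) (locus (doubleIdeal f (Ideal.span {g}))) ⟦p⟧ := by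
  intro hsm
  obtain ⟨e, he, -, hne⟩ := hsm p i rfl hi
  set 𝔪 := IsLocalRing.maximalIdeal (LocalRingAt p.1)
  set LS := localIdeal (locus (doubleIdeal f ⊥)) i p with hLS
  apply hne
  let φ := algebraMap (MvPolynomial (Fin 4) ℂ) (LocalRingAt p.1)
  have hgm : φ (toTot g) ∈ 𝔪 ^ 2 ⊔ LS := by
    have hunit : IsUnit (φ (toTot u)) :=
      isUnit_algebraMap_localRingAt p.1 (by rw [eval_toTot]; exact hu)
    rw [← Ideal.mul_unit_mem_iff_mem _ hunit]
    have h1 : φ (toTot g) * φ (toTot u) = φ (toTot b) ^ 2 + φ (X 3) ^ 2 * φ (toTot κ) -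
        φ (toTot κ) * (φ (X 3) ^ 2 - φ (toTot f)) := by
      rw [← map_mul, ← map_mul, h]
      simp only [map_add, map_mul, map_pow]
      ring
    rw [h1]
    refine sub_mem (Ideal.mem_sup_left (add_mem (Ideal.pow_mem_pow ?_ 2)
      (Ideal.mul_mem_right _ _ (Ideal.pow_mem_pow ?_ 2)))) (Ideal.mem_sup_right
        (Ideal.mul_mem_left _ _ (algebraMap_equation_mem hf hS hi)))
    · exact algebraMap_mem_maximalIdeal _ (by rw [eval_toTot]; exact hb)
    · exact algebraMap_mem_maximalIdeal _ (by rw [eval_X, hw])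
  have h2 : e ∈ localIdeal (locus (doubleIdeal f (Ideal.span {g}))) i p := by
    rw [he]
    exact Ideal.mem_sup_left (Ideal.mem_span_singleton_self e)
  rw [localIdeal_curve hf hg hS hT hi] at h2
  refine (sup_le ?_ le_sup_right : _ ≤ 𝔪 ^ 2 ⊔ LS) h2
  rw [Ideal.span_le, Set.singleton_subset_iff]
  exact hgm

/-- At a branch point where `κ` does not vanish and `f, b` are local parameters of the plane, `b` and `w`
are local parameters of the double plane, and `b² + w² κ` is the equation of a node. -/
theorem exists_node_of_branch (hf : f.IsHomogeneous 6) (hg : g.IsHomogeneous d)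
    (hS : (doubleIdeal f ⊥).IsPrime) (hT : (doubleIdeal f (Ideal.span {g})).IsPrime)
    (hi : p.1 i.castSucc ≠ 0) (hw : p.1 3 = 0) (hfp : eval (base p) f = 0)
    (h : g * u = b ^ 2 + f * κ) (hu : eval (base p) u ≠ 0) (hb : eval (base p) b = 0)
    (hκ : eval (base p) κ ≠ 0)
    (hτ : ∀ τ, τ i = 0 → dirDeriv (base p) τ f = 0 → dirDeriv (base p) τ b = 0 → τ = 0) :
    ∃ a b e : LocalRingAt p.1,
      IsLocalRing.maximalIdeal (LocalRingAt p.1) =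
        Ideal.span {a, b} ⊔ localIdeal (locus (doubleIdeal f ⊥)) i p ∧
      localIdeal (locus (doubleIdeal f (Ideal.span {g}))) i p =
        Ideal.span {e} ⊔ localIdeal (locus (doubleIdeal f ⊥)) i p ∧
      e - a * b ∈ IsLocalRing.maximalIdeal (LocalRingAt p.1) ^ 3 ⊔
        localIdeal (locus (doubleIdeal f ⊥)) i p := by
  -- With `η² = -κ(p)`, the local equation `g u ≡ b² + w² κ` is `(b + η w) (b - η w)` up to third order.
  obtain ⟨η, hη⟩ := IsAlgClosed.exists_pow_nat_eq (-(eval (base p) κ)) two_pos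
  have hη0 : η ≠ 0 := by
    rintro rfl
    exact hκ (by simpa using hη.symm)
  let φ := algebraMap (MvPolynomial (Fin 4) ℂ) (LocalRingAt p.1)
  have hX3 : φ (X 3) ∈ IsLocalRing.maximalIdeal (LocalRingAt p.1) :=
    algebraMap_mem_maximalIdeal _ (by rw [eval_X, hw])
  refine ⟨φ (toTot b + C η * X 3), φ (toTot b - C η * X 3), φ (toTot g * toTot u), ?_, ?_, ?_⟩
  · rw [localIdeal_double hf hS hi]
    have h1 : germ p.1 (Ideal.span {toTot b + C η * X 3, toTot b - C η * X 3} ⊔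
        Ideal.span {X i.castSucc - C (p.1 i.castSucc), X 3 ^ 2 - toTot f}) =
        IsLocalRing.maximalIdeal (LocalRingAt p.1) := by
      refine germ_eq_maximalIdeal p.1 ?_ fun τ hτ' => ?_
      · simp_rw [← mem_vanishingIdeal_iff_eval]
        change _ ≤ (vanishingIdeal ℂ {p.1} : Ideal (MvPolynomial (Fin 4) ℂ))
        refine sup_le ?_ ?_ <;> rw [Ideal.span_le] <;> rintro G (rfl | rfl) <;>
          rw [SetLike.mem_coe, mem_vanishingIdeal_iff_eval]
        · rw [map_add, eval_toTot, map_mul, eval_X, hw, mul_zero, add_zero]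
          exact hb
        · rw [map_sub, eval_toTot, map_mul, eval_X, hw, mul_zero, sub_zero]
          exact hb
        · simp
        · rw [map_sub, eval_toTot, map_pow, eval_X, hw, zero_pow two_ne_zero, zero_sub]
          exact neg_eq_zero.2 hfp
      · have k1 := hτ' (toTot b + C η * X 3) (Ideal.mem_sup_left (Ideal.subset_span (by simp)))
        have k2 := hτ' (toTot b - C η * X 3) (Ideal.mem_sup_left (Ideal.subset_span (by simp)))
        have k3 := hτ' (X i.castSucc - C (p.1 i.castSucc))
          (Ideal.mem_sup_right (Ideal.subset_span (by simp)))
        have k4 := hτ' (X 3 ^ 2 - toTot f) (Ideal.mem_sup_right (Ideal.subset_span (by simp)))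
        rw [map_add, dirDeriv_toTot, dirDeriv_mul, dirDeriv_C, eval_C, dirDeriv_X] at k1
        rw [sub_eq_add_neg, ← neg_mul, ← C_neg, map_add, dirDeriv_toTot, dirDeriv_mul, dirDeriv_C,
          eval_C, dirDeriv_X] at k2
        rw [sub_eq_add_neg, ← C_neg, map_add, dirDeriv_X, dirDeriv_C, add_zero] at k3
        rw [sub_eq_add_neg, ← neg_one_mul, ← C_1, ← C_neg, map_add, dirDeriv_sq, dirDeriv_mul,
            dirDeriv_toTot, dirDeriv_C, eval_X, eval_C, hw] at k4
        have hbase : base p = ![p.1 0, p.1 1, p.1 2] := rfl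
        rw [hbase] at hτ
        have k5 := hτ ![τ 0, τ 1, τ 2] (by rw [← k3]; fin_cases i <;> rfl)
          (by simpa using k4) (by linear_combination (k1 + k2) / 2)
        have k6 : η * τ 3 = 0 := by linear_combination (k1 - k2) / 2
        funext j
        fin_cases j
        · exact congrFun k5 0
        · exact congrFun k5 1
        · exact congrFun k5 2
        · exact (mul_eq_zero.1 k6).resolve_left hη0
    rw [← h1, germ, germ, Ideal.map_sup, Ideal.map_span, Set.image_pair]
  · rw [localIdeal_curve hf hg hS hT hi, map_mul]
    congr 1
    refine (Ideal.span_singleton_mul_right_unit ?_ _).symm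
    exact isUnit_algebraMap_localRingAt p.1 (by rw [eval_toTot]; exact hu)
  · have h1 : φ (toTot g * toTot u) - φ (toTot b + C η * X 3) * φ (toTot b - C η * X 3) =
        φ (X 3) ^ 2 * φ (toTot κ + C η ^ 2) -
          φ (toTot κ) * (φ (X 3) ^ 2 - φ (toTot f)) := by
      rw [← map_mul toTot, h]
      simp only [map_add, map_sub, map_mul, map_pow]
      ring
    rw [h1]
    refine sub_mem (Ideal.mem_sup_left ?_) (Ideal.mem_sup_right
      (Ideal.mul_mem_left _ _ (algebraMap_equation_mem hf hS hi)))
    rw [pow_succ _ 2]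
    refine Ideal.mul_mem_mul (Ideal.pow_mem_pow hX3 2) (algebraMap_mem_maximalIdeal _ ?_)
    rw [map_add, eval_toTot, map_pow, eval_C, hη]
    exact add_neg_cancel _

end Branch

end LocalStructure

end

section

open Projectivization
open scoped LinearAlgebra.Projectivization

section Nodal

variable {f g : MvPolynomial (Fin 3) ℂ} {d : ℕ}

theorem mk_mem_locus_span (hf : f.IsHomogeneous 6) (hg : g.IsHomogeneous d) (p : TotRep) :
    ⟦p⟧ ∈ locus (doubleIdeal f (Ideal.span {g})) ↔
      p.1 3 ^ 2 = eval (base p) f ∧ eval (base p) g = 0 := by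
  rw [mk_mem_locus (isWeightedIdeal_doubleIdeal_span hf hg), mem_zeroLocus_doubleIdeal,
    forall_mem_span_singleton_eval]
  rfl

theorem mk_mem_singularPoints_iff (hf : f.IsHomogeneous 6) (hg : g.IsHomogeneous d)
    (hS : (doubleIdeal f ⊥).IsPrime) (hT : (doubleIdeal f (Ideal.span {g})).IsPrime)
    (hgs : IsSmoothHypersurface g) (hsq : IsLocallySquare f g) (p : TotRep) :
    ⟦p⟧ ∈ singularPoints (locus (doubleIdeal f ⊥)) (locus (doubleIdeal f (Ideal.span {g}))) ↔
      p.1 3 = 0 ∧ eval (base p) f = 0 ∧ eval (base p) g = 0 := by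
  have hmem := mk_mem_locus_span hf hg p
  constructor
  · rintro ⟨h1, h2⟩
    have hw : p.1 3 = 0 := by
      by_contra hw
      refine h2 (isSmoothAt_of_ne_zero hf hg hS hT hgs h1 fun q hq => ?_)
      obtain ⟨c, hc, hqp⟩ := exists_act_of_mk_eq hq.symm
      rw [hqp]
      exact mul_ne_zero (pow_ne_zero 3 hc) hw
    have h3 := hmem.1 h1
    rw [hw, zero_pow two_ne_zero] at h3
    exact ⟨hw, h3.1.symm, h3.2⟩
  · rintro ⟨hw, hfp, hgp⟩
    refine ⟨hmem.2 ⟨by rw [hw, hfp, zero_pow two_ne_zero], hgp⟩, ?_⟩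
    obtain ⟨k, b, u, κ, -, h, hu⟩ := hsq (base p) p.2 hfp hgp
    obtain ⟨i, hi⟩ := exists_apply_ne_zero p
    exact not_isSmoothAt_of_branch hf hg hS hT hi hw h hu (dirDeriv_eq_zero_of_sq h hfp hgp).1

theorem isNodeAt_of_branch (hf : f.IsHomogeneous 6) (hg : g.IsHomogeneous d)
    (hS : (doubleIdeal f ⊥).IsPrime) (hT : (doubleIdeal f (Ideal.span {g})).IsPrime)
    (hfs : IsSmoothHypersurface f) (hgs : IsSmoothHypersurface g) (hsq : IsLocallySquare f g)
    (hle : HasMultiplicityLeTwo f g) {q : TotO3}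
    (hq : q ∈ singularPoints (locus (doubleIdeal f ⊥)) (locus (doubleIdeal f (Ideal.span {g})))) :
    IsNodeAt (locus (doubleIdeal f ⊥)) (locus (doubleIdeal f (Ideal.span {g}))) q := by
  intro p i hp hi
  rw [← hp, mk_mem_singularPoints_iff hf hg hS hT hgs hsq] at hq
  obtain ⟨hw, hfp, hgp⟩ := hq
  obtain ⟨k, b, u, κ, -, h, hu⟩ := hsq (base p) p.2 hfp hgp
  obtain ⟨hb, hd⟩ := dirDeriv_eq_zero_of_sq h hfp hgp
  have hbi : base p i ≠ 0 := by
    have : base p i = p.1 i.castSucc := by fin_cases i <;> rfl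
    rwa [this]
  refine exists_node_of_branch hf hg hS hT hi hw hfp h hu hb (fun hκ => ?_) fun τ hτi hτf hτb => ?_
  · obtain ⟨τ, -, hτ⟩ := exists_dirDeriv_ne_zero hg hgp (hgs (base p) p.2 hgp) hbi
    have := hd τ
    rw [hκ, mul_zero] at this
    exact mul_ne_zero hτ hu this
  · by_contra hτ0
    exact dirDeriv_ne_zero_of_intersectionMultiplicity_le hf (hfs _ p.2 hfp) hbi h hu hfp hgp
      (hle _ i hbi hfp hgp) hτ0 hτi hτf hτb

/-- The zero section over a point of the plane. -/
def zeroSection (x : ℙ ℂ (Fin 3 → ℂ)) : TotO3 :=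
  ⟦⟨![x.rep 0, x.rep 1, x.rep 2, 0], fun h => x.rep_nonzero (by
    funext j
    fin_cases j
    exacts [congrFun h 0, congrFun h 1, congrFun h 2])⟩⟧

theorem zeroSection_injective : Function.Injective zeroSection := by
  intro x y hxy
  obtain ⟨c, -, hc⟩ := exists_act_of_mk_eq hxy
  rw [← x.mk_rep, ← y.mk_rep, eq_comm, mk_eq_mk_iff']
  refine ⟨c, ?_⟩
  funext j
  fin_cases j
  exacts [(congrFun hc 0).symm, (congrFun hc 1).symm, (congrFun hc 2).symm]

/-- The double cover of a smooth curve which touches the smooth branch curve in each intersection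
point has nodes over these points and no other singularities. -/
theorem isNodalCurve_of_isLocallySquare (hf : f.IsHomogeneous 6) (hg : g.IsHomogeneous d)
    (hd : d ≠ 0) (hd6 : 6 ≠ d) (hT : (doubleIdeal f (Ideal.span {g})).IsPrime)
    (hfs : IsSmoothHypersurface f) (hgs : IsSmoothHypersurface g) (hsq : IsLocallySquare f g)
    (hle : HasMultiplicityLeTwo f g) {N : ℕ} (hN : 2 * N = 6 * d) :
    IsNodalCurve (locus (doubleIdeal f ⊥)) (locus (doubleIdeal f (Ideal.span {g}))) N := by
  have hS := isPrime_doubleIdeal_bot (irreducible_of_isSmoothHypersurface hf (by norm_num) hfs)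
  refine ⟨fun q hq p hp => ?_, ?_, ?_, fun q hq =>
    isNodeAt_of_branch hf hg hS hT hfs hgs hsq hle hq⟩
  · have h1 := (mem_zeroLocus_doubleIdeal _).1 (hq p hp)
    exact (mem_zeroLocus_doubleIdeal _).2 ⟨h1.1, fun a ha => by rw [Ideal.mem_bot.1 ha, map_zero]⟩
  · obtain ⟨v, hv, hfv, hgv⟩ := exists_common_zero (hf.eval_zero (by norm_num)) (hg.eval_zero hd)
    have hv3 : ![v 0, v 1, v 2] = v := by
      funext j
      fin_cases j <;> rfl
    rwa [vanishingIdeal_cone_locus (p := ![v 0, v 1, v 2, 0])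
      (isWeightedIdeal_doubleIdeal_span hf hg) hT]
    · rw [mem_zeroLocus_doubleIdeal, forall_mem_span_singleton_eval]
      simp only [Matrix.cons_val, hv3, hfv, hgv]
      simp
    · simpa only [Matrix.cons_val, hv3] using hv
  · have hset : singularPoints (locus (doubleIdeal f ⊥)) (locus (doubleIdeal f (Ideal.span {g}))) =
        zeroSection '' {x : ℙ ℂ (Fin 3 → ℂ) | eval x.rep f = 0 ∧ eval x.rep g = 0} := by
      ext q
      obtain ⟨p, rfl⟩ := Quotient.exists_rep q
      rw [mk_mem_singularPoints_iff hf hg hS hT hgs hsq]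
      constructor
      · rintro ⟨hw, hfp, hgp⟩
        obtain ⟨c, hc⟩ := exists_smul_eq_mk_rep ℂ (base p) p.2
        have hc : (c : ℂ) • base p = (mk ℂ (base p) p.2).rep := hc
        refine ⟨mk ℂ (base p) p.2, ⟨?_, ?_⟩, Quotient.sound (Setoid.symm ⟨c, c.ne_zero, ?_⟩)⟩
        · rw [← hc, hf.eval_smul, hfp, mul_zero]
        · rw [← hc, hg.eval_smul, hgp, mul_zero]
        · funext j
          fin_cases j
          exacts [(congrFun hc 0).symm, (congrFun hc 1).symm, (congrFun hc 2).symm,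
            (show (0 : ℂ) = (c : ℂ) ^ 3 * p.1 3 by rw [hw, mul_zero])]
      · rintro ⟨x, ⟨hfx, hgx⟩, hx⟩
        obtain ⟨c, -, hc⟩ := exists_act_of_mk_eq hx
        have hb : base p = c • x.rep := by
          funext j
          fin_cases j
          exacts [congrFun hc 0, congrFun hc 1, congrFun hc 2]
        refine ⟨?_, ?_, ?_⟩
        · rw [hc]
          simp [act]
        · rw [hb, hf.eval_smul, hfx, mul_zero]
        · rw [hb, hg.eval_smul, hgx, mul_zero]
    obtain ⟨hfin, hcard⟩ := two_mul_ncard_of_isLocallySquare hf hg (by norm_num) hd hd6 hfs hgs hsq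
      hle
    rw [hset, zeroSection_injective.encard_image, ← hfin.cast_ncard_eq]
    norm_cast
    omega

end Nodal

end

/-! ### Irreducibility of the double cover of the quintic -/

/-- If the form `f` of degree six is not the square of a homogeneous fraction modulo the form `g`, then
it is not a square modulo `g`. -/
theorem mem_span_of_sq_sub_mem {f g : MvPolynomial (Fin 3) ℂ} {d : ℕ} (hf : f.IsHomogeneous 6)
    (hg : g.IsHomogeneous d) (hgi : Irreducible g) (hfg : ¬ g ∣ f)
    (h : ∀ (n : ℕ) (a b : MvPolynomial (Fin 3) ℂ), a.IsHomogeneous (n + 3) → b.IsHomogeneous n →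
      a ^ 2 - f * b ^ 2 ∈ Ideal.span {g} → b ∈ Ideal.span {g})
    (a b : MvPolynomial (Fin 3) ℂ) (hab : a ^ 2 - f * b ^ 2 ∈ Ideal.span {g}) :
    a ∈ Ideal.span {g} ∧ b ∈ Ideal.span {g} := by
  set I := Ideal.span {g} with hI
  have hIp : I.IsPrime := (Ideal.span_singleton_prime hgi.ne_zero).2 hgi.prime
  let ρ : MvPolynomial (Fin 3) ℂ →+* Polynomial (MvPolynomial (Fin 3) ℂ ⧸ I) :=
    (Polynomial.mapRingHom (Ideal.Quotient.mk I)).comp (gradeHom (Fin 3)).toRingHom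
  have hρ : ∀ G k, (ρ G).coeff k = Ideal.Quotient.mk I (homogeneousComponent k G) := by
    intro G k
    rw [← coeff_gradeHom]
    exact Polynomial.coeff_map _ _
  have hρh : ∀ {G e}, G.IsHomogeneous e →
      ρ G = Polynomial.C (Ideal.Quotient.mk I G) * Polynomial.X ^ e := by
    intro G e hG
    have h1 : ρ G = Polynomial.map (Ideal.Quotient.mk I) (gradeHom (Fin 3) G) := rfl
    rw [h1, gradeHom_of_isHomogeneous hG, Polynomial.map_mul, Polynomial.map_C, Polynomial.map_pow,
      Polynomial.map_X]
  have hker : ∀ G ∈ I, ρ G = 0 := by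
    intro G hG
    obtain ⟨K, rfl⟩ := Ideal.mem_span_singleton.1 hG
    rw [map_mul, hρh hg, Ideal.Quotient.eq_zero_iff_mem.2 (Ideal.mem_span_singleton_self g), map_zero,
      zero_mul, zero_mul]
  have hker' : ∀ G, ρ G = 0 → G ∈ I := by
    intro G hG
    rw [← sum_homogeneousComponent G]
    refine sum_mem fun k _ => ?_
    rw [← Ideal.Quotient.eq_zero_iff_mem, ← hρ, hG, Polynomial.coeff_zero]
  have hrel : ρ a ^ 2 = Polynomial.C (Ideal.Quotient.mk I f) * Polynomial.X ^ 6 * ρ b ^ 2 := by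
    have := hker _ hab
    rwa [map_sub, map_pow, map_mul, map_pow, hρh hf, sub_eq_zero] at this
  have hf0 : Ideal.Quotient.mk I f ≠ 0 := fun h0 =>
    hfg (Ideal.mem_span_singleton.1 (Ideal.Quotient.eq_zero_iff_mem.1 h0))
  have hb : ρ b = 0 := by
    by_contra hb
    have hC : (Polynomial.C (Ideal.Quotient.mk I f) * Polynomial.X ^ 6 :
        Polynomial (MvPolynomial (Fin 3) ℂ ⧸ I)) ≠ 0 :=
      mul_ne_zero (Polynomial.C_ne_zero.2 hf0) (pow_ne_zero _ Polynomial.X_ne_zero)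
    have hdeg := congrArg Polynomial.natDegree hrel
    rw [Polynomial.natDegree_pow, Polynomial.natDegree_mul hC (pow_ne_zero 2 hb),
      Polynomial.natDegree_pow, Polynomial.natDegree_C_mul_X_pow _ _ hf0] at hdeg
    have hlc := congrArg Polynomial.leadingCoeff hrel
    rw [Polynomial.leadingCoeff_pow, Polynomial.leadingCoeff_mul, Polynomial.leadingCoeff_pow,
      Polynomial.leadingCoeff_C_mul_X_pow, Polynomial.leadingCoeff, Polynomial.leadingCoeff, hρ,
      hρ, show (ρ a).natDegree = (ρ b).natDegree + 3 by omega] at hlc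
    have h1 := h _ _ _ (homogeneousComponent_isHomogeneous ((ρ b).natDegree + 3) a)
      (homogeneousComponent_isHomogeneous (ρ b).natDegree b)
      (Ideal.Quotient.eq_zero_iff_mem.1 (by
        rw [map_sub, map_pow, map_mul, map_pow, hlc, sub_self]))
    apply hb
    rw [← Polynomial.leadingCoeff_eq_zero, Polynomial.leadingCoeff, hρ,
      Ideal.Quotient.eq_zero_iff_mem.2 h1]
  refine ⟨hker' a ?_, hker' b hb⟩
  rw [hb, zero_pow two_ne_zero, mul_zero] at hrel
  exact pow_eq_zero_iff two_ne_zero |>.1 hrel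

section Block

variable {A : Type*} [CommRing A]

/-- Gram determinants of pairs of vectors with cross product `(n₀, n₁, n₂)`. -/
theorem blockForm_eq_gram_det {M : Matrix (Fin 4) (Fin 4) A} (hM : M.IsSymm) {n : Fin 4 → A}
    {u v : Fin 3 → A} (h0 : u 1 * v 2 - u 2 * v 1 = n 0) (h1 : u 2 * v 0 - u 0 * v 2 = n 1)
    (h2 : u 0 * v 1 - u 1 * v 0 = n 2) :
    blockForm M n =
      (![u 0, u 1, u 2, 0] ⬝ᵥ M.mulVec ![u 0, u 1, u 2, 0]) *
        (![v 0, v 1, v 2, 0] ⬝ᵥ M.mulVec ![v 0, v 1, v 2, 0]) -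
      (![u 0, u 1, u 2, 0] ⬝ᵥ M.mulVec ![v 0, v 1, v 2, 0]) ^ 2 := by
  have h10 : M 1 0 = M 0 1 := hM.apply 0 1
  have h20 : M 2 0 = M 0 2 := hM.apply 0 2
  have h21 : M 2 1 = M 1 2 := hM.apply 1 2
  rw [blockForm_eq, ← h0, ← h1, ← h2]
  simp only [dotProduct, Matrix.mulVec, Fin.sum_univ_four, Matrix.cons_val, h10, h20, h21]
  ring

/-- Polarization of a symmetric form. -/
theorem dotProduct_mulVec_sub_smul {ι : Type*} [Fintype ι] {M : Matrix ι ι A} (hM : M.IsSymm)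
    (u v : ι → A) (c : A) : (v - c • u) ⬝ᵥ M.mulVec (v - c • u) =
      v ⬝ᵥ M.mulVec v - 2 * c * (u ⬝ᵥ M.mulVec v) + c ^ 2 * (u ⬝ᵥ M.mulVec u) := by
  have h1 : v ⬝ᵥ M.mulVec u = u ⬝ᵥ M.mulVec v := by
    rw [Matrix.dotProduct_mulVec, ← Matrix.mulVec_transpose, hM.eq, dotProduct_comm]
  simp only [Matrix.mulVec_sub, Matrix.mulVec_smul, sub_dotProduct, dotProduct_sub, smul_dotProduct,
    dotProduct_smul, smul_eq_mul, h1]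
  ring

end Block

theorem exists_cross_product {n : Fin 3 → ℂ} (hn : n ≠ 0) : ∃ u v : Fin 3 → ℂ,
    u 1 * v 2 - u 2 * v 1 = n 0 ∧ u 2 * v 0 - u 0 * v 2 = n 1 ∧ u 0 * v 1 - u 1 * v 0 = n 2 := by
  obtain ⟨i, hi⟩ := Function.ne_iff.1 hn
  fin_cases i
  · refine ⟨![-n 1 / n 0, 1, 0], ![-n 2, 0, n 0], ?_⟩
    have : n 0 ≠ 0 := hi
    simp [div_mul_cancel₀ _ this]
  · refine ⟨![0, -n 2 / n 1, 1], ![n 1, -n 0, 0], ?_⟩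
    have : n 1 ≠ 0 := hi
    simp [div_mul_cancel₀ _ this]
  · refine ⟨![1, 0, -n 0 / n 2], ![0, n 2, -n 1], ?_⟩
    have : n 2 ≠ 0 := hi
    simp [div_mul_cancel₀ _ this]

/-- A binary quadratic form whose coefficients are linear forms and whose discriminant is a square has
a constant zero. -/
theorem exists_constant_zero {k : ℕ} {α β γ l : MvPolynomial (Fin k) ℂ} (hα : α.IsHomogeneous 1)
    (hβ : β.IsHomogeneous 1) (hl : l.IsHomogeneous 1)
    (h : β ^ 2 - α * γ = l ^ 2) : α = 0 ∨ ∃ c : ℂ, γ - 2 * C c * β + C c ^ 2 * α = 0 := by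
  rcases eq_or_ne α 0 with h0 | h0
  · exact Or.inl h0
  right
  have hirr : Irreducible α := by
    refine irreducible_of_totalDegree_eq_one (hα.totalDegree h0) fun x hx => ?_
    obtain ⟨i, hi⟩ := ne_zero_iff.1 h0
    exact (ne_zero_of_dvd_ne_zero hi (hx i)).isUnit
  -- up to the sign of `l`, the prime element `α` divides `β - l`
  have key : ∀ l : MvPolynomial (Fin k) ℂ, l.IsHomogeneous 1 → β ^ 2 - α * γ = l ^ 2 → α ∣ β - l →
      ∃ c : ℂ, γ - 2 * C c * β + C c ^ 2 * α = 0 := by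
    rintro l hl h ⟨q, hq⟩
    have hq0 : ∃ c, q = C c := by
      by_cases hbl : β - l = 0
      · refine ⟨0, ?_⟩
        rw [hbl, eq_comm, mul_eq_zero] at hq
        rw [hq.resolve_left h0, C_0]
      · have h1 := congrArg totalDegree hq
        have hq1 : q ≠ 0 := fun h => hbl (by rw [hq, h, mul_zero])
        rw [totalDegree_mul_of_isDomain h0 hq1, (hβ.sub hl).totalDegree hbl,
          hα.totalDegree h0] at h1
        exact ⟨_, totalDegree_eq_zero_iff_eq_C.1 (by omega)⟩
    obtain ⟨c, rfl⟩ := hq0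
    refine ⟨c, mul_left_cancel₀ h0 ?_⟩
    linear_combination -h + (β + l - C c * α) * hq
  rcases hirr.prime.dvd_or_dvd (show α ∣ (β - l) * (β - -l) from ⟨γ, by linear_combination h⟩) with
    h1 | h1
  · exact key l hl h h1
  · exact key (-l) hl.neg (by rw [neg_sq]; exact h) h1

section Sextic

variable {F : MvPolynomial (Fin 6) ℂ} {h : Fin 6 → ℂ}

/-- The form of the quadric `Q_y` on constant vectors, as a polynomial in `y`. -/
def constForm (F : MvPolynomial (Fin 6) ℂ) (u v : Fin 3 → ℂ) : MvPolynomial (Fin 3) ℂ :=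
  ![C (u 0), C (u 1), C (u 2), 0] ⬝ᵥ (gram F).mulVec ![C (v 0), C (v 1), C (v 2), 0]

theorem constForm_eq (F : MvPolynomial (Fin 6) ℂ) (u v : Fin 3 → ℂ) : constForm F u v =
    C (u 0) * (gram F 0 0 * C (v 0) + gram F 0 1 * C (v 1) + gram F 0 2 * C (v 2)) +
    C (u 1) * (gram F 1 0 * C (v 0) + gram F 1 1 * C (v 1) + gram F 1 2 * C (v 2)) +
    C (u 2) * (gram F 2 0 * C (v 0) + gram F 2 1 * C (v 1) + gram F 2 2 * C (v 2)) := by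
  unfold constForm
  generalize gram F = M
  simp [dotProduct, Matrix.mulVec, Fin.sum_univ_four]

theorem isHomogeneous_constForm (hF : F.IsHomogeneous 3) (u v : Fin 3 → ℂ) :
    (constForm F u v).IsHomogeneous 1 := by
  have key : ∀ i j : Fin 4, fibreWeight i = 0 → fibreWeight j = 0 → ∀ a b : ℂ,
      (C a * (gram F i j * C b)).IsHomogeneous 1 := by
    intro i j hi hj a b
    have h1 := isHomogeneous_gram hF i j
    rw [hi, hj] at h1
    rw [mul_comm (gram F i j)]
    exact (h1.C_mul b).C_mul a
  rw [constForm_eq]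
  simp only [mul_add]
  refine IsHomogeneous.add (IsHomogeneous.add ?_ ?_) ?_ <;>
    exact ((key _ _ rfl rfl _ _).add (key _ _ rfl rfl _ _)).add (key _ _ rfl rfl _ _)

theorem eval_constForm (F : MvPolynomial (Fin 6) ℂ) (u v y : Fin 3 → ℂ) :
    eval y (constForm F u v) = form F y ![u 0, u 1, u 2, 0] ![v 0, v 1, v 2, 0] := by
  unfold constForm form
  generalize gram F = M
  simp [dotProduct, Matrix.mulVec, Fin.sum_univ_four]

theorem blockForm_gram_eq {u v : Fin 3 → ℂ} (h0 : u 1 * v 2 - u 2 * v 1 = h 3)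
    (h1 : u 2 * v 0 - u 0 * v 2 = h 4) (h2 : u 0 * v 1 - u 1 * v 0 = h 5) :
    blockForm (gram F) (normal h) =
      constForm F u u * constForm F v v - constForm F u v ^ 2 :=
  blockForm_eq_gram_det (gram_isSymm F) (u := fun i => C (u i)) (v := fun i => C (v i))
    (by simp only [← C_mul, ← C_sub, h0]; rfl) (by simp only [← C_mul, ← C_sub, h1]; rfl)
    (by simp only [← C_mul, ← C_sub, h2]; rfl)

theorem quintic_relation (F : MvPolynomial (Fin 6) ℂ) (h : Fin 6 → ℂ) :
    quintic F h * (gram F).adjugate 3 3 - pole F h 3 ^ 2 =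
      sextic F * blockForm (gram F) (normal h) := by
  unfold quintic pole sextic
  exact adjugate_last _ (gram_isSymm F) _

/-- A hyperplane containing the plane has a singular quintic. -/
theorem normal_ne_zero_of_isSmooth (hF : F.IsHomogeneous 3)
    (hgs : IsSmoothHypersurface (quintic F h)) : ![h 3, h 4, h 5] ≠ 0 := by
  intro h0
  have hirr := irreducible_of_isSmoothHypersurface (isHomogeneous_quintic hF h) (by norm_num) hgs
  have hn : ∀ i, fibreWeight i = 0 → normal h i = 0 := by
    have e0 := congrFun h0 0
    have e1 := congrFun h0 1
    have e2 := congrFun h0 2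
    simp only [Matrix.cons_val, Pi.zero_apply] at e0 e1 e2
    intro i hi
    fin_cases i
    · exact (congrArg C e0).trans C_0
    · exact (congrArg C e1).trans C_0
    · exact (congrArg C e2).trans C_0
    · exact absurd hi one_ne_zero
  have hq : quintic F h = normal h 3 * (normal h 3 * (gram F).adjugate 3 3) := by
    unfold quintic
    generalize gram F = M at *
    simp only [dotProduct, Matrix.mulVec, Fin.sum_univ_four, hn 0 rfl, hn 1 rfl, hn 2 rfl]
    ring
  have hnu : ¬ IsUnit (normal h 3) := fun hu => by
    have h1 := hu.map (eval (0 : Fin 3 → ℂ))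
    rw [(isHomogeneous_normal h 3).eval_zero (by decide)] at h1
    exact not_isUnit_zero h1
  rcases hirr.isUnit_or_isUnit hq with h1 | h1
  · exact hnu h1
  · exact hnu (isUnit_of_mul_isUnit_left h1)

theorem cross_ne_zero (hh : ![h 3, h 4, h 5] ≠ 0) {u v : Fin 3 → ℂ}
    (h0 : u 1 * v 2 - u 2 * v 1 = h 3) (h1 : u 2 * v 0 - u 0 * v 2 = h 4)
    (h2 : u 0 * v 1 - u 1 * v 0 = h 5) : u ≠ 0 ∧ ∀ c : ℂ, v - c • u ≠ 0 := by
  refine ⟨?_, fun c h3 => hh ?_⟩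
  · rintro rfl
    apply hh
    simp only [Pi.zero_apply, zero_mul, sub_zero] at h0 h1 h2
    simp [← h0, ← h1, ← h2]
  · have h4 : v = c • u := sub_eq_zero.1 h3
    simp only [h4, Pi.smul_apply, smul_eq_mul] at h0 h1 h2
    ext j
    fin_cases j
    · change h 3 = 0
      linear_combination -h0
    · change h 4 = 0
      linear_combination -h1
    · change h 5 = 0
      linear_combination -h2

/-- The discriminant of the restriction of the quadrics `Q_y` to the line `L` is not a square, since
otherwise `X` would be singular at a point of `L`. -/
theorem constForm_disc_ne_sq (hF : F ∈ cubicsContainingPlane) (hs : IsSmoothHypersurface F)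
    (hh : ![h 3, h 4, h 5] ≠ 0) {u v : Fin 3 → ℂ}
    (h0 : u 1 * v 2 - u 2 * v 1 = h 3) (h1 : u 2 * v 0 - u 0 * v 2 = h 4)
    (h2 : u 0 * v 1 - u 1 * v 0 = h 5) : constForm F u u ≠ 0 ∧
      ∀ l : MvPolynomial (Fin 3) ℂ, l.IsHomogeneous 1 →
        constForm F u v ^ 2 - constForm F u u * constForm F v v ≠ l ^ 2 := by
  obtain ⟨hu0, hvu⟩ := cross_ne_zero hh h0 h1 h2
  have hα0 : constForm F u u ≠ 0 := fun h3 => not_isSmooth_of_form_eq_zero hF hu0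
    (fun y => by rw [← eval_constForm, h3, map_zero]) hs
  refine ⟨hα0, fun l hl hsq => ?_⟩
  obtain ⟨c, hc⟩ := (exists_constant_zero (isHomogeneous_constForm hF.1 u u)
    (isHomogeneous_constForm hF.1 u v) hl hsq).resolve_left hα0
  refine not_isSmooth_of_form_eq_zero hF (hvu c) (fun y => ?_) hs
  have h3 : constForm F (v - c • u) (v - c • u) =
      constForm F v v - 2 * C c * constForm F u v + C c ^ 2 * constForm F u u := by
    have h4 := dotProduct_mulVec_sub_smul (gram_isSymm F) ![C (u 0), C (u 1), C (u 2), 0]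
      ![C (v 0), C (v 1), C (v 2), 0] (C c)
    have h5 : ![C (v 0), C (v 1), C (v 2), 0] - (C c : MvPolynomial (Fin 3) ℂ) •
        (![C (u 0), C (u 1), C (u 2), 0] : Fin 4 → MvPolynomial (Fin 3) ℂ) =
        ![C ((v - c • u) 0), C ((v - c • u) 1), C ((v - c • u) 2), 0] := by
      ext1 j
      fin_cases j <;> simp
    rwa [h5] at h4
  rw [← eval_constForm, h3, hc, map_zero]

theorem eq_zero_of_isHomogeneous_of_dvd {n k d : ℕ} {g G : MvPolynomial (Fin n) ℂ}
    (hg : g.IsHomogeneous d) (hG : G.IsHomogeneous k) (hkd : k < d) (h : g ∣ G) : G = 0 := by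
  by_contra hne
  obtain ⟨q, rfl⟩ := h
  have hg0 := left_ne_zero_of_mul hne
  have h5 := hG.totalDegree hne
  rw [totalDegree_mul_of_isDomain hg0 (right_ne_zero_of_mul hne), hg.totalDegree hg0] at h5
  omega

/-- If the sextic were a square on the quintic, then the discriminant of the conic bundle restricted to
the line `L` would be a square, and `X` would be singular at a point of `L`. -/
theorem isPrime_doubleIdeal_quintic (hF : F ∈ cubicsContainingPlane) (hs : IsSmoothPair F)
    (hgs : IsSmoothHypersurface (quintic F h)) :
    (doubleIdeal (sextic F) (Ideal.span {quintic F h})).IsPrime := by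
  have hf := isHomogeneous_sextic hF.1
  have hg := isHomogeneous_quintic hF.1 h
  have hgi := irreducible_of_isSmoothHypersurface hg (by norm_num) hgs
  have hfg : ¬ quintic F h ∣ sextic F :=
    hgi.isRelPrime_iff_not_dvd.1
      (isRelPrime_of_smooth hg hf (by norm_num) (by norm_num) (by norm_num) hgs hs.2)
  have hrel := quintic_relation F h
  have hp3 := isHomogeneous_pole hF.1 h 3
  obtain ⟨u, v, h0, h1, h2⟩ := exists_cross_product (normal_ne_zero_of_isSmooth hF.1 hgs)
  simp only [Matrix.cons_val] at h0 h1 h2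
  have hdelta := blockForm_gram_eq (F := F) h0 h1 h2
  have hα := isHomogeneous_constForm hF.1 u u
  have hβ := isHomogeneous_constForm hF.1 u v
  have hγ := isHomogeneous_constForm hF.1 v v
  set f := sextic F
  set g := quintic F h
  set α := constForm F u u
  set β := constForm F u v
  set γ := constForm F v v
  set δ := β ^ 2 - α * γ with hδ
  set e := pole F h 3
  have hIp : (Ideal.span {g}).IsPrime := (Ideal.span_singleton_prime hgi.ne_zero).2 hgi.prime
  have hmem : ∀ {G}, G ∈ Ideal.span {g} ↔ g ∣ G := Ideal.mem_span_singleton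
  refine isPrime_doubleIdeal hIp (mem_span_of_sq_sub_mem hf hg hgi hfg fun n a b ha hb hab => ?_)
  by_contra hgb
  rw [hmem] at hab hgb
  have hga : ¬ g ∣ a := by
    intro hga
    have h3 : g ∣ f * b ^ 2 := by
      have := (hga.mul_right a).sub hab
      rwa [← pow_two, sub_sub_cancel] at this
    exact (hgi.prime.dvd_or_dvd h3).elim hfg fun h4 => hgb (hgi.prime.dvd_of_dvd_pow h4)
  -- Modulo `g`, the relation of the cofactors reads `e² ≡ f δ`, so `a² ≡ f b²` makes `δ` a square as well.
  have hsq : δ * a ^ 2 - (e * b) ^ 2 ∈ Ideal.span {g} := by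
    rw [hmem]
    obtain ⟨c, hc⟩ := hab
    refine ⟨δ * c - (gram F).adjugate 3 3 * b ^ 2, ?_⟩
    rw [hdelta] at hrel
    linear_combination δ * hc + b ^ 2 * hrel
  have heb : (e * b).IsHomogeneous (4 + n) := hp3.mul hb
  have hmem2 := mem_span_pair_of_sq_mem hg (by norm_num) hgs ha heb hga hsq
  obtain ⟨l, m, hlm⟩ := Ideal.mem_span_pair.1 hmem2
  -- the homogeneous component of degree one of the quotient
  set l' := homogeneousComponent 1 l
  have hl' : l'.IsHomogeneous 1 := homogeneousComponent_isHomogeneous 1 l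
  have hdvd : g ∣ e * b - l' * a := by
    have h3 := congrArg (homogeneousComponent (4 + n)) hlm
    rw [homogeneousComponent_eq_self heb, map_add, show 4 + n = 1 + (n + 3) by ring,
      homogeneousComponent_mul_of_isHomogeneous ha] at h3
    have h4 : g ∣ homogeneousComponent (1 + (n + 3)) (m * g) := by
      by_cases hn5 : 5 ≤ 1 + (n + 3)
      · obtain ⟨k, hk⟩ := Nat.exists_eq_add_of_le' hn5
        rw [hk, homogeneousComponent_mul_of_isHomogeneous hg]
        exact dvd_mul_left _ _
      · have hz : homogeneousComponent (1 + (n + 3)) (m * g) = 0 := by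
          rw [← coeff_gradeHom, map_mul, gradeHom_of_isHomogeneous hg, ← mul_assoc,
            Polynomial.coeff_mul_X_pow', if_neg hn5]
        rw [hz]
        exact dvd_zero _
    rw [← h3, add_sub_cancel_left]
    exact h4
  have hδl : g ∣ (δ - l' ^ 2) * a ^ 2 := by
    have h3 := (hmem.1 hsq).add (hdvd.mul_right (e * b + l' * a))
    convert h3 using 1
    ring
  have hδl' : δ - l' ^ 2 = 0 := by
    by_contra hne
    have h3 := (hgi.prime.dvd_or_dvd hδl).resolve_right fun h4 => hga (hgi.prime.dvd_of_dvd_pow h4)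
    have h4 : (δ - l' ^ 2).IsHomogeneous 2 :=
      ((hβ.pow 2).sub (hα.mul hγ)).sub (hl'.pow 2)
    exact hne (eq_zero_of_isHomogeneous_of_dvd hg h4 (by norm_num) h3)
  exact (constForm_disc_ne_sq hF hs.1 (normal_ne_zero_of_isSmooth hF.1 hgs) h0 h1 h2).2 l' hl'
    (sub_eq_zero.1 hδl')

end Sextic

/-! ### Lines in quadric surfaces -/

section Isotropic

variable {N : Matrix (Fin 4) (Fin 4) ℂ} {u v : Fin 4 → ℂ}

/-- Two independent vectors are part of a basis. -/
theorem exists_det_ne_zero (h : LinearIndependent ℂ ![u, v]) :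
    ∃ a b : Fin 4 → ℂ, (Matrix.of ![a, b, u, v]).det ≠ 0 := by
  obtain ⟨b, hb⟩ := exists_linearIndependent_cons_of_lt_finrank h (by simp)
  obtain ⟨a, ha⟩ := exists_linearIndependent_cons_of_lt_finrank hb (by simp)
  refine ⟨a, b, ?_⟩
  have h1 : LinearIndependent ℂ (Matrix.of ![a, b, u, v]).row := ha
  rw [Matrix.linearIndependent_rows_iff_isUnit, Matrix.isUnit_iff_isUnit_det] at h1
  exact h1.ne_zero

theorem isSymm_dotProduct_mulVec {A ι : Type*} [CommRing A] [Fintype ι] {M : Matrix ι ι A}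
    (hM : M.IsSymm) (u v : ι → A) : v ⬝ᵥ M.mulVec u = u ⬝ᵥ M.mulVec v := by
  rw [Matrix.dotProduct_mulVec, ← Matrix.mulVec_transpose, hM.eq, dotProduct_comm]

theorem mul_mul_transpose_apply (N E : Matrix (Fin 4) (Fin 4) ℂ) (i j : Fin 4) :
    (E * N * E.transpose) i j = E i ⬝ᵥ N.mulVec (E j) :=
  Matrix.mul_mul_apply E N E.transpose i j

/-- The determinant of a quadratic form with a totally isotropic plane. -/
theorem det_eq_sq_of_isotropic (hN : N.IsSymm) (huu : u ⬝ᵥ N.mulVec u = 0)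
    (huv : u ⬝ᵥ N.mulVec v = 0) (hvv : v ⬝ᵥ N.mulVec v = 0) (a b : Fin 4 → ℂ) :
    (Matrix.of ![a, b, u, v]).det ^ 2 * N.det =
      (a ⬝ᵥ N.mulVec u * b ⬝ᵥ N.mulVec v - a ⬝ᵥ N.mulVec v * b ⬝ᵥ N.mulVec u) ^ 2 := by
  set E := Matrix.of ![a, b, u, v] with hE
  have hK := mul_mul_transpose_apply N E
  have hdet : (E * N * E.transpose).det = E.det ^ 2 * N.det := by
    rw [Matrix.det_mul, Matrix.det_mul, Matrix.det_transpose]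
    ring
  rw [← hdet]
  set K := E * N * E.transpose
  have h22 : K 2 2 = 0 := (hK 2 2).trans huu
  have h23 : K 2 3 = 0 := (hK 2 3).trans huv
  have h33 : K 3 3 = 0 := (hK 3 3).trans hvv
  have hs : ∀ i j, K j i = K i j := fun i j => by
    rw [hK, hK, isSymm_dotProduct_mulVec hN]
  have h02 : a ⬝ᵥ N.mulVec u = K 0 2 := (hK 0 2).symm
  have h03 : a ⬝ᵥ N.mulVec v = K 0 3 := (hK 0 3).symm
  have h12 : b ⬝ᵥ N.mulVec u = K 1 2 := (hK 1 2).symm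
  have h13 : b ⬝ᵥ N.mulVec v = K 1 3 := (hK 1 3).symm
  rw [h02, h03, h12, h13]
  simp only [Matrix.det_succ_row_zero (n := 3), Matrix.det_fin_three, Matrix.submatrix_apply,
    Fin.sum_univ_four]
  simp [Fin.succAbove, hs 0 1, hs 0 2, hs 0 3, hs 1 2, hs 1 3, hs 2 3, h22, h23, h33]
  ring

/-- A plane containing a line of a quadric surface is a tangent plane. -/
theorem dotProduct_adjugate_eq_zero_of_isotropic (hN : N.IsSymm)
    (hli : LinearIndependent ℂ ![u, v]) (huu : u ⬝ᵥ N.mulVec u = 0)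
    (huv : u ⬝ᵥ N.mulVec v = 0) (hvv : v ⬝ᵥ N.mulVec v = 0) {n : Fin 4 → ℂ} (hu : u ⬝ᵥ n = 0)
    (hv : v ⬝ᵥ n = 0) : n ⬝ᵥ N.adjugate.mulVec n = 0 := by
  obtain ⟨a, b, hdet⟩ := exists_det_ne_zero hli
  set E := Matrix.of ![a, b, u, v] with hE
  have hK := mul_mul_transpose_apply N E
  have hadj : E.mulVec n ⬝ᵥ (E * N * E.transpose).adjugate.mulVec (E.mulVec n) =
      E.det ^ 2 * (n ⬝ᵥ N.adjugate.mulVec n) := by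
    rw [Matrix.adjugate_mul_distrib, Matrix.adjugate_mul_distrib, ← Matrix.mulVec_mulVec,
      ← Matrix.mulVec_mulVec, Matrix.mulVec_mulVec _ E.adjugate, Matrix.adjugate_mul,
      Matrix.smul_mulVec, Matrix.one_mulVec, Matrix.mulVec_smul, Matrix.mulVec_smul,
      dotProduct_smul, dotProduct_comm, Matrix.dotProduct_mulVec, ← Matrix.mulVec_transpose,
      Matrix.mulVec_mulVec, Matrix.mul_adjugate, Matrix.det_transpose, Matrix.smul_mulVec,
      Matrix.one_mulVec, smul_dotProduct, dotProduct_comm]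
    simp only [smul_eq_mul]
    ring
  set K := E * N * E.transpose
  have h22 : K 2 2 = 0 := (hK 2 2).trans huu
  have h23 : K 2 3 = 0 := (hK 2 3).trans huv
  have h33 : K 3 3 = 0 := (hK 3 3).trans hvv
  have h32 : K 3 2 = 0 := by
    rw [hK, isSymm_dotProduct_mulVec hN]
    exact huv
  have hn2 : E.mulVec n 2 = 0 := hu
  have hn3 : E.mulVec n 3 = 0 := hv
  have hKadj : ∀ i j : Fin 4, K.adjugate i j = (-1) ^ (j + i : ℕ) *
      (K.submatrix j.succAbove i.succAbove).det := fun i j =>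
    Matrix.adjugate_fin_succ_eq_det_submatrix K i j
  have h0 : E.mulVec n ⬝ᵥ K.adjugate.mulVec (E.mulVec n) = 0 := by
    rw [dotProduct, Fin.sum_univ_four, hn2, hn3]
    simp only [Matrix.mulVec, dotProduct, Fin.sum_univ_four, hKadj, Matrix.det_fin_three,
      Matrix.submatrix_apply] at hn2 hn3 ⊢
    simp [Fin.succAbove, h22, h23, h32, h33, hn2, hn3]
  rw [h0] at hadj
  exact (mul_eq_zero.1 hadj.symm).resolve_left (pow_ne_zero 2 hdet)

/-- The ruling of a line is determined by two vectors which together with the line span the space. -/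
theorem ruling_eq_of_isotropic (hN : N.IsSymm) (huu : u ⬝ᵥ N.mulVec u = 0)
    (huv : u ⬝ᵥ N.mulVec v = 0) (hvv : v ⬝ᵥ N.mulVec v = 0) {a₀ b₀ : Fin 4 → ℂ}
    (hdet : (Matrix.of ![a₀, b₀, u, v]).det ≠ 0) {w : ℂ}
    (hw : a₀ ⬝ᵥ N.mulVec u * b₀ ⬝ᵥ N.mulVec v - a₀ ⬝ᵥ N.mulVec v * b₀ ⬝ᵥ N.mulVec u =
      w * (Matrix.of ![a₀, b₀, u, v]).det) (a b : Fin 4 → ℂ) :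
    a ⬝ᵥ N.mulVec u * b ⬝ᵥ N.mulVec v - a ⬝ᵥ N.mulVec v * b ⬝ᵥ N.mulVec u =
      w * (Matrix.of ![a, b, u, v]).det := by
  set E := Matrix.of ![a₀, b₀, u, v] with hE
  have hcoord : ∀ a : Fin 4 → ℂ, ∃ x : Fin 4 → ℂ, a = Matrix.vecMul x E := fun a =>
    ⟨Matrix.vecMul a E⁻¹, by
      rw [Matrix.vecMul_vecMul, Matrix.nonsing_inv_mul _ (Ne.isUnit hdet), Matrix.vecMul_one]⟩
  obtain ⟨x, hx⟩ := hcoord a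
  obtain ⟨y, hy⟩ := hcoord b
  have hB : ∀ (x : Fin 4 → ℂ) (c : Fin 4 → ℂ), Matrix.vecMul x E ⬝ᵥ c =
      x 0 * a₀ ⬝ᵥ c + x 1 * b₀ ⬝ᵥ c + x 2 * u ⬝ᵥ c + x 3 * v ⬝ᵥ c := by
    intro x c
    rw [← Matrix.dotProduct_mulVec, dotProduct, Fin.sum_univ_four]
    rfl
  have hmat : Matrix.of ![a, b, u, v] = Matrix.of ![x, y, ![0, 0, 1, 0], ![0, 0, 0, 1]] * E := by
    refine funext fun i => ?_
    rw [Matrix.mul_apply_eq_vecMul]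
    fin_cases i
    · exact hx
    · exact hy
    · funext j
      simp [Matrix.vecMul, dotProduct, Fin.sum_univ_four, hE]
    · funext j
      simp [Matrix.vecMul, dotProduct, Fin.sum_univ_four, hE]
  have hdet2 : (Matrix.of ![x, y, ![0, 0, 1, 0], ![0, 0, 0, 1]]).det = x 0 * y 1 - x 1 * y 0 := by
    simp [Matrix.det_succ_row_zero, Fin.sum_univ_succ, Fin.succAbove]
    ring
  have hvu : v ⬝ᵥ N.mulVec u = 0 := by rw [isSymm_dotProduct_mulVec hN, huv]
  rw [hmat, Matrix.det_mul, hdet2, hx, hy]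
  simp only [hB, huu, huv, hvv, hvu]
  linear_combination (x 0 * y 1 - x 1 * y 0) * hw

end Isotropic

/-! ### The image of the curve of lines -/

section ImageCurve

variable {F : MvPolynomial (Fin 6) ℂ} {h : Fin 6 → ℂ} {y : Fin 3 → ℂ}

theorem dotProduct_fibrePoint (h : Fin 6 → ℂ) (y : Fin 3 → ℂ) (u : Fin 4 → ℂ) :
    h ⬝ᵥ fibrePoint y u = u ⬝ᵥ fun i => eval y (normal h i) := by
  simp [dotProduct, fibrePoint, normal, Fin.sum_univ_succ]
  ring

theorem fibrePoint_add_smul (y : Fin 3 → ℂ) (u v : Fin 4 → ℂ) (s t : ℂ) :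
    fibrePoint y (s • u + t • v) = s • fibrePoint y u + t • fibrePoint y v := by
  funext j
  fin_cases j <;> simp [fibrePoint] <;> ring

theorem isSymm_map_gram (F : MvPolynomial (Fin 6) ℂ) (y : Fin 3 → ℂ) :
    ((gram F).map (eval y)).IsSymm :=
  (gram_isSymm F).map _

theorem eval_sextic (F : MvPolynomial (Fin 6) ℂ) (y : Fin 3 → ℂ) :
    eval y (sextic F) = ((gram F).map (eval y)).det := by
  unfold sextic
  rw [RingHom.map_det, RingHom.mapMatrix_apply]

theorem eval_pole (F : MvPolynomial (Fin 6) ℂ) (h : Fin 6 → ℂ) (y : Fin 3 → ℂ) (j : Fin 4) :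
    eval y (pole F h j) =
      ((gram F).map (eval y)).adjugate.mulVec (fun i => eval y (normal h i)) j := by
  unfold pole
  rw [RingHom.map_mulVec, ← RingHom.mapMatrix_apply, ← RingHom.mapMatrix_apply,
    RingHom.map_adjugate]
  rfl

theorem eval_quintic (F : MvPolynomial (Fin 6) ℂ) (h : Fin 6 → ℂ) (y : Fin 3 → ℂ) :
    eval y (quintic F h) = (fun i => eval y (normal h i)) ⬝ᵥ
      ((gram F).map (eval y)).adjugate.mulVec fun i => eval y (normal h i) := by
  unfold quintic
  rw [RingHom.map_dotProduct, ← RingHom.mapMatrix_apply, ← RingHom.map_adjugate]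
  congr 1
  funext j
  exact RingHom.map_mulVec _ _ _ _

/-- Every line counted by the curve lies over a point of the quintic. -/
theorem eval_eq_zero_of_isLine {p : TotRep} {u v : Fin 4 → ℂ}
    (hl : IsLineInFibre F (base p) u v)
    (hc : IsLineOfCurve F h (Submodule.span ℂ {fibrePoint (base p) u, fibrePoint (base p) v}))
    (hα : IsAlphaImage F (base p) u v (p.1 3)) :
    p.1 3 ^ 2 = eval (base p) (sextic F) ∧ eval (base p) (quintic F h) = 0 := by
  obtain ⟨hli, huu, huv, hvv⟩ := hl
  have hN := isSymm_map_gram F (base p)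
  constructor
  · obtain ⟨a, b, hdet⟩ := exists_det_ne_zero hli
    have h1 := det_eq_sq_of_isotropic hN huu huv hvv a b
    have h2 : _ = _ := hα a b
    unfold form at h2
    rw [h2, mul_pow, mul_comm, ← eval_sextic] at h1
    exact (mul_right_cancel₀ (pow_ne_zero 2 hdet) h1).symm
  · rw [eval_quintic]
    refine dotProduct_adjugate_eq_zero_of_isotropic hN hli huu huv hvv ?_ ?_
    · rw [← dotProduct_fibrePoint]
      exact (hc.2.1 _ (Submodule.subset_span (by simp))).2
    · rw [← dotProduct_fibrePoint]
      exact (hc.2.1 _ (Submodule.subset_span (by simp))).2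

theorem isLineOfCurve_span (hF : F ∈ cubicsContainingPlane) (hy : y ≠ 0) {r e : Fin 4 → ℂ}
    (he3 : e 3 = 0) (he : e ≠ 0) (hr3 : r 3 ≠ 0) (hrr : form F y r r = 0)
    (hre : form F y r e = 0) (hee : form F y e e = 0)
    (hr : r ⬝ᵥ (fun i => eval y (normal h i)) = 0) (hen : e ⬝ᵥ (fun i => eval y (normal h i)) = 0) :
    IsLineInFibre F y r e ∧ IsLineOfCurve F h (Submodule.span ℂ {fibrePoint y r, fibrePoint y e}) := by
  obtain ⟨i, hi⟩ := Function.ne_iff.1 hy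
  obtain ⟨j, hj⟩ := Function.ne_iff.1 he
  -- linear combinations of the two vectors, before and after passing to `ℂ⁶`
  have hpair : ∀ s t : ℂ, s * r 3 = 0 → t * e j = 0 → s = 0 ∧ t = 0 := fun s t h1 h2 =>
    ⟨(mul_eq_zero.1 h1).resolve_right hr3, (mul_eq_zero.1 h2).resolve_right hj⟩
  have hli : LinearIndependent ℂ ![r, e] := by
    rw [LinearIndependent.pair_iff]
    intro s t hst
    have h3 := congrFun hst 3
    simp only [Pi.add_apply, Pi.smul_apply, smul_eq_mul, he3, mul_zero, add_zero,
      Pi.zero_apply] at h3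
    have hs := (mul_eq_zero.1 h3).resolve_right hr3
    have h4 := congrFun hst j
    simp only [hs, zero_smul, zero_add, Pi.smul_apply, smul_eq_mul, Pi.zero_apply] at h4
    exact hpair s t h3 h4
  have hinj : ∀ u : Fin 4 → ℂ, fibrePoint y u = 0 → u = 0 := by
    intro u hu
    have h3 : u 3 = 0 := by
      have : u 3 * y i = 0 := by
        fin_cases i
        exacts [congrFun hu 0, congrFun hu 1, congrFun hu 2]
      exact (mul_eq_zero.1 this).resolve_right hi
    funext k
    fin_cases k
    exacts [congrFun hu 3, congrFun hu 4, congrFun hu 5, h3]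
  have hli6 : LinearIndependent ℂ ![fibrePoint y r, fibrePoint y e] := by
    rw [LinearIndependent.pair_iff] at hli ⊢
    intro s t hst
    rw [← fibrePoint_add_smul] at hst
    exact hli s t (hinj _ hst)
  refine ⟨⟨hli, hrr, hre, hee⟩, ?_, fun v hv => ?_, fun hL => ?_, fun hbot => ?_⟩
  · have := finrank_span_eq_card hli6
    rwa [Matrix.range_cons_cons_empty, Fintype.card_fin] at this
  · obtain ⟨s, t, rfl⟩ := Submodule.mem_span_pair.1 hv
    rw [← fibrePoint_add_smul]
    constructor
    · have h1 := two_mul_eval_fibrePoint hF y (s • r + t • e)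
      have h2 : form F y (s • r + t • e) (s • r + t • e) = 0 := by
        have her : form F y e r = 0 := by
          unfold form at *
          rw [isSymm_dotProduct_mulVec (isSymm_map_gram F y), hre]
        unfold form at *
        simp only [Matrix.mulVec_add, Matrix.mulVec_smul, add_dotProduct, dotProduct_add,
          smul_dotProduct, dotProduct_smul, hrr, hre, her, hee, smul_zero, add_zero]
      rw [h2, mul_zero] at h1
      exact (mul_eq_zero.1 h1).resolve_left two_ne_zero
    · rw [dotProduct_fibrePoint, add_dotProduct, smul_dotProduct, smul_dotProduct, hr, hen,
        smul_zero, smul_zero, add_zero]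
  · have h1 : fibrePoint y r ∈ lineL h := hL ▸ Submodule.subset_span (by simp)
    have : r 3 * y i = 0 := by
      fin_cases i
      exacts [h1.1, h1.2.1, h1.2.2.1]
    exact mul_ne_zero hr3 hi this
  · have h1 : fibrePoint y e ∈ Submodule.span ℂ {fibrePoint y r, fibrePoint y e} ⊓ lineL h := by
      refine ⟨Submodule.subset_span (by simp), ?_, ?_, ?_, ?_⟩
      · simp [fibrePoint, he3]
      · simp [fibrePoint, he3]
      · simp [fibrePoint, he3]
      · rw [dotProduct_fibrePoint, hen]
    rw [hbot] at h1
    exact he (hinj e h1)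

/-- The pole `r` of a tangent plane `n = 0` of a smooth quadric is a point of the quadric, and the zeros
`e` of the quadratic form on the line spanned by `u` and `v` in this plane lie on the two lines of the
quadric through `r`. -/
theorem exists_ruling {N : Matrix (Fin 4) (Fin 4) ℂ} (hN : N.IsSymm) {n : Fin 4 → ℂ}
    {u v : Fin 3 → ℂ} (h0 : u 1 * v 2 - u 2 * v 1 = n 0) (h1 : u 2 * v 0 - u 0 * v 2 = n 1)
    (h2 : u 0 * v 1 - u 1 * v 0 = n 2) (hdet : N.det ≠ 0)
    (hg : n ⬝ᵥ N.adjugate.mulVec n = 0) (hr3 : N.adjugate.mulVec n 3 ≠ 0)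
    (hα : ![u 0, u 1, u 2, 0] ⬝ᵥ N.mulVec ![u 0, u 1, u 2, 0] ≠ 0)
    (hv : ∀ c : ℂ, v - c • u ≠ 0)
    (hrel : N.adjugate.mulVec n 3 ^ 2 = -N.det * blockForm N n) {w : ℂ} (hw : w ^ 2 = N.det) :
    ∃ e : Fin 4 → ℂ, e 3 = 0 ∧ e ≠ 0 ∧ e ⬝ᵥ n = 0 ∧
      N.adjugate.mulVec n ⬝ᵥ N.mulVec (N.adjugate.mulVec n) = 0 ∧
      N.adjugate.mulVec n ⬝ᵥ N.mulVec e = 0 ∧ e ⬝ᵥ N.mulVec e = 0 ∧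
      ∀ a b : Fin 4 → ℂ, a ⬝ᵥ N.mulVec (N.adjugate.mulVec n) * b ⬝ᵥ N.mulVec e -
        a ⬝ᵥ N.mulVec e * b ⬝ᵥ N.mulVec (N.adjugate.mulVec n) =
          w * (Matrix.of ![a, b, N.adjugate.mulVec n, e]).det := by
  have hNr : N.mulVec (N.adjugate.mulVec n) = N.det • n := by
    rw [Matrix.mulVec_mulVec, Matrix.mul_adjugate, Matrix.smul_mulVec, Matrix.one_mulVec]
  have hn0 : n ≠ 0 := by
    rintro rfl
    rw [Matrix.mulVec_zero] at hr3
    exact hr3 rfl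
  have hw0 : w ≠ 0 := by
    rintro rfl
    exact hdet (by rw [← hw, zero_pow two_ne_zero])
  rw [blockForm_eq_gram_det hN h0 h1 h2] at hrel
  have hU : ∀ x : Fin 4 → ℂ, ![u 0, u 1, u 2, 0] ⬝ᵥ x = u 0 * x 0 + u 1 * x 1 + u 2 * x 2 := by
    intro x
    simp [dotProduct, Fin.sum_univ_four]
  have hV : ∀ x : Fin 4 → ℂ, ![v 0, v 1, v 2, 0] ⬝ᵥ x = v 0 * x 0 + v 1 * x 1 + v 2 * x 2 := by
    intro x
    simp [dotProduct, Fin.sum_univ_four]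
  have hUn : ![u 0, u 1, u 2, 0] ⬝ᵥ n = 0 := by
    rw [hU, ← h0, ← h1, ← h2]
    ring
  have hVn : ![v 0, v 1, v 2, 0] ⬝ᵥ n = 0 := by
    rw [hV, ← h0, ← h1, ← h2]
    ring
  have hsymm := isSymm_dotProduct_mulVec hN ![u 0, u 1, u 2, 0] ![v 0, v 1, v 2, 0]
  have hne : ∀ s α : ℂ, α ≠ 0 → s • ![u 0, u 1, u 2, 0] + α • ![v 0, v 1, v 2, 0] ≠ 0 := by
    intro s α hα h
    apply hv (-s / α)
    have hc : ∀ a b : ℂ, s * a + α * b = 0 → b - -s / α * a = 0 := by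
      intro a b hab
      field_simp
      linear_combination hab
    funext j
    fin_cases j
    · simpa using hc _ _ (by simpa using congrFun h 0)
    · simpa using hc _ _ (by simpa using congrFun h 1)
    · simpa using hc _ _ (by simpa using congrFun h 2)
  have hdetM : ∀ (b r : Fin 4 → ℂ) (s α : ℂ), n ⬝ᵥ r = 0 →
      (Matrix.of ![![u 0, u 1, u 2, 0], b, r,
        s • ![u 0, u 1, u 2, 0] + α • ![v 0, v 1, v 2, 0]]).det = α * r 3 * b ⬝ᵥ n := by
    intro b r s α hr
    simp only [dotProduct, Fin.sum_univ_four, ← h0, ← h1, ← h2] at hr ⊢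
    simp [Matrix.det_succ_row_zero, Fin.sum_univ_succ, Fin.succAbove]
    linear_combination (-(α * b 3)) * hr
  generalize N.adjugate.mulVec n = r at *
  set U : Fin 4 → ℂ := ![u 0, u 1, u 2, 0]
  set V : Fin 4 → ℂ := ![v 0, v 1, v 2, 0]
  set α := U ⬝ᵥ N.mulVec U
  set β := U ⬝ᵥ N.mulVec V
  set γ := V ⬝ᵥ N.mulVec V
  -- the sign of the square root of the discriminant selects the ruling
  set δ := -(r 3) / w with hδ
  have hδ2 : δ ^ 2 = β ^ 2 - α * γ := by
    rw [hδ, div_pow, hw, div_eq_iff hdet, neg_sq, hrel]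
    ring
  have hδw : δ * w = -(r 3) := div_mul_cancel₀ _ hw0
  set e := (δ - β) • U + α • V with he
  have hUe : U ⬝ᵥ N.mulVec e = δ * α := by
    rw [he, Matrix.mulVec_add, Matrix.mulVec_smul, Matrix.mulVec_smul, dotProduct_add,
      dotProduct_smul, dotProduct_smul, smul_eq_mul, smul_eq_mul]
    ring
  have hVe : V ⬝ᵥ N.mulVec e = (δ - β) * β + α * γ := by
    rw [he, Matrix.mulVec_add, Matrix.mulVec_smul, Matrix.mulVec_smul, dotProduct_add,
      dotProduct_smul, dotProduct_smul, smul_eq_mul, smul_eq_mul, hsymm]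
  have hen : e ⬝ᵥ n = 0 := by
    rw [he, add_dotProduct, smul_dotProduct, smul_dotProduct, hUn, hVn, smul_zero, smul_zero,
      add_zero]
  have hrn : r ⬝ᵥ n = 0 := by rw [dotProduct_comm, hg]
  have hrr : r ⬝ᵥ N.mulVec r = 0 := by rw [hNr, dotProduct_smul, hrn, smul_zero]
  have hre : r ⬝ᵥ N.mulVec e = 0 := by
    rw [← isSymm_dotProduct_mulVec hN, hNr, dotProduct_smul, hen, smul_zero]
  have hee : e ⬝ᵥ N.mulVec e = 0 := by
    rw [he, add_dotProduct, smul_dotProduct, smul_dotProduct, ← he, hUe, hVe, smul_eq_mul,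
      smul_eq_mul]
    linear_combination α * hδ2
  obtain ⟨k, hk⟩ := Function.ne_iff.1 hn0
  have hk : n k ≠ 0 := hk
  have hdet0 := hdetM (Pi.single k 1) r (δ - β) α hg
  rw [← he, single_one_dotProduct] at hdet0
  refine ⟨e, ?_, hne _ _ hα, hen, hrr, hre, hee, ruling_eq_of_isotropic hN hrr hre hee (a₀ := U)
    (b₀ := Pi.single k 1) ?_ ?_⟩
  · simp [he, U, V]
  · rw [hdet0]
    exact mul_ne_zero (mul_ne_zero hα hr3) hk
  · have hkn : Pi.single k 1 ⬝ᵥ n = n k := single_one_dotProduct _ _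
    rw [hdet0, hUe, hNr, dotProduct_smul, hUn, dotProduct_smul, hkn, ← hw]
    simp only [smul_eq_mul]
    linear_combination (-(α * w * n k)) * hδw

/-- Over a general point of the quintic, the line joining the pole of `H` to a zero of `Q_y` on `L` is a
line of the curve, and the two zeros correspond to the two rulings. -/
theorem exists_line (hF : F ∈ cubicsContainingPlane) {u v : Fin 3 → ℂ}
    (h0 : u 1 * v 2 - u 2 * v 1 = h 3) (h1 : u 2 * v 0 - u 0 * v 2 = h 4)
    (h2 : u 0 * v 1 - u 1 * v 0 = h 5) (hh : ![h 3, h 4, h 5] ≠ 0) (hy : y ≠ 0) {w : ℂ}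
    (hw : w ^ 2 = eval y (sextic F)) (hg : eval y (quintic F h) = 0)
    (hf0 : eval y (sextic F) ≠ 0) (hp0 : eval y (pole F h 3) ≠ 0)
    (hα0 : eval y (constForm F u u) ≠ 0) :
    ∃ r e : Fin 4 → ℂ, IsLineInFibre F y r e ∧
      IsLineOfCurve F h (Submodule.span ℂ {fibrePoint y r, fibrePoint y e}) ∧
      IsAlphaImage F y r e w := by
  have hN := isSymm_map_gram F y
  have hadj := adjugate_last _ hN fun i => eval y (normal h i)
  rw [eval_quintic] at hg
  rw [eval_sextic] at hw hf0
  rw [eval_pole] at hp0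
  rw [eval_constForm] at hα0
  rw [hg] at hadj
  obtain ⟨e, he3, he0, hen, hrr, hre, hee, hruling⟩ := exists_ruling hN
    (n := fun i => eval y (normal h i)) (h0.trans (eval_C _).symm) (h1.trans (eval_C _).symm)
    (h2.trans (eval_C _).symm) hf0 hg hp0 hα0 (cross_ne_zero hh h0 h1 h2).2
    (by linear_combination -hadj) hw
  obtain ⟨k1, k2⟩ := isLineOfCurve_span (h := h) hF hy he3 he0 hp0 hrr hre hee
    (by rw [dotProduct_comm]; exact hg) hen
  exact ⟨_, e, k1, k2, hruling⟩

/-- The image of the curve of lines is the inverse image of the quintic in the double plane. -/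
theorem imageCurve_eq (hF : F ∈ cubicsContainingPlane) (hs : IsSmoothPair F)
    (hgs : IsSmoothHypersurface (quintic F h)) :
    imageCurve F h = locus (doubleIdeal (sextic F) (Ideal.span {quintic F h})) := by
  have hJ := isPrime_doubleIdeal_quintic hF hs hgs
  have hW := isWeightedIdeal_doubleIdeal_span (isHomogeneous_sextic hF.1)
    (isHomogeneous_quintic hF.1 h)
  have hf := isHomogeneous_sextic hF.1
  have hg := isHomogeneous_quintic hF.1 h
  have hgi := irreducible_of_isSmoothHypersurface hg (by norm_num) hgs
  have hfg : ¬ quintic F h ∣ sextic F :=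
    hgi.isRelPrime_iff_not_dvd.1
      (isRelPrime_of_smooth hg hf (by norm_num) (by norm_num) (by norm_num) hgs hs.2)
  have hh := normal_ne_zero_of_isSmooth hF.1 hgs
  obtain ⟨u, v, h0, h1, h2⟩ := exists_cross_product hh
  simp only [Matrix.cons_val] at h0 h1 h2
  obtain ⟨hα0, hdisc⟩ := constForm_disc_ne_sq hF hs.1 hh h0 h1 h2
  have hα := isHomogeneous_constForm hF.1 u u
  -- The lines are constructed over points of the quintic where the sextic, the last coordinate of the pole
  -- and `constForm F u u` do not vanish; none of these is divisible by the quintic.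
  have hrel := quintic_relation F h
  rw [blockForm_gram_eq h0 h1 h2] at hrel
  have hβγ : (constForm F u u * constForm F v v - constForm F u v ^ 2).IsHomogeneous 2 :=
    (hα.mul (isHomogeneous_constForm hF.1 v v)).sub ((isHomogeneous_constForm hF.1 u v).pow 2)
  have hpole : ¬ quintic F h ∣ pole F h 3 := by
    intro hdvd
    have h3 : quintic F h ∣
        sextic F * (constForm F u u * constForm F v v - constForm F u v ^ 2) := by
      rw [← hrel]
      exact (dvd_mul_right _ _).sub (hdvd.trans (dvd_pow_self _ two_ne_zero))
    have h4 := eq_zero_of_isHomogeneous_of_dvd hg hβγ (by norm_num)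
      ((hgi.prime.dvd_or_dvd h3).resolve_left hfg)
    exact hdisc 0 (isHomogeneous_zero _ _ _) (by linear_combination -h4)
  have hαg : ¬ quintic F h ∣ constForm F u u := fun hdvd =>
    hα0 (eq_zero_of_isHomogeneous_of_dvd hg hα (by norm_num) hdvd)
  set k := sextic F * pole F h 3 * constForm F u u with hk
  have hkg : ¬ quintic F h ∣ k := fun hdvd =>
    (hgi.prime.dvd_or_dvd hdvd).elim (fun hd => (hgi.prime.dvd_or_dvd hd).elim hfg hpole) hαg
  unfold imageCurve
  set A : Set TotO3 := {q | ∃ (p : TotRep) (u v : Fin 4 → ℂ), ⟦p⟧ = q ∧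
    IsLineInFibre F (base p) u v ∧
    IsLineOfCurve F h (Submodule.span ℂ {fibrePoint (base p) u, fibrePoint (base p) v}) ∧
    IsAlphaImage F (base p) u v (p.1 3)} with hA
  have hvan : vanishingIdeal ℂ (cone A) =
      doubleIdeal (sextic F) (Ideal.span {quintic F h}) := by
    refine le_antisymm (fun G hG => ?_) fun G hG p hp => ?_
    · -- If `G` vanishes at the images of the lines constructed above, then `k G` vanishes on the whole
      -- curve `w² = f`, `g = 0`; its ideal is prime and does not contain `k`.
      have h3 : toTot k * G ∈ doubleIdeal (sextic F) (Ideal.span {quintic F h}) := by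
        rw [← vanishingIdeal_zeroLocus_of_isPrime hJ]
        intro p hp
        rw [map_mul, aeval_eq_eval, eval_toTot]
        rw [mem_zeroLocus_doubleIdeal, forall_mem_span_singleton_eval] at hp
        by_cases hkp : eval ![p 0, p 1, p 2] k = 0
        · rw [hkp, zero_mul]
        · have hp0 : ![p 0, p 1, p 2] ≠ 0 := by
            intro h0
            rw [h0, hk, map_mul, hα.eval_zero one_ne_zero, mul_zero] at hkp
            exact hkp rfl
          have hkp' := hkp
          rw [hk, map_mul, map_mul] at hkp'
          obtain ⟨r, e, k1, k2, k3⟩ := exists_line (h := h) hF h0 h1 h2 hh hp0 hp.1 hp.2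
            (left_ne_zero_of_mul (left_ne_zero_of_mul hkp'))
            (right_ne_zero_of_mul (left_ne_zero_of_mul hkp')) (right_ne_zero_of_mul hkp')
          have h4 : p ∈ cone A := ⟨hp0, ⟨p, hp0⟩, r, e, rfl, k1, k2, k3⟩
          have h5 := hG p h4
          rw [aeval_eq_eval] at h5
          rw [h5, mul_zero]
      refine (hJ.mem_or_mem h3).resolve_left fun h4 => hkg ?_
      rw [← ker_toQuadratic, RingHom.mem_ker, toQuadratic_toTot] at h4
      have h5 := congrArg QuadraticAlgebra.re h4
      exact Ideal.mem_span_singleton.1 (Ideal.Quotient.eq_zero_iff_mem.1 h5)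
    · obtain ⟨hp0, p', r, e, hpp, k1, k2, k3⟩ := hp
      have h3 := eval_eq_zero_of_isLine k1 k2 k3
      have h4 : p'.1 ∈ zeroLocus ℂ (doubleIdeal (sextic F) (Ideal.span {quintic F h})) := by
        rw [mem_zeroLocus_doubleIdeal, forall_mem_span_singleton_eval]
        exact h3
      rw [← mk_mem_locus hW, hpp, mk_mem_locus hW] at h4
      exact h4 G hG
  unfold zariskiClosure
  rw [hvan]
  rfl

end ImageCurve

/-! ### The nodal curve of a good hyperplane -/

theorem doublePlane_eq (F : MvPolynomial (Fin 6) ℂ) :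
    doublePlane F = locus (doubleIdeal (sextic F) ⊥) := by
  ext q
  refine forall₂_congr fun p _ => ?_
  rw [mem_zeroLocus_doubleIdeal]
  refine ⟨fun h => ⟨h, fun a ha => ?_⟩, fun h => h.1⟩
  rw [Ideal.mem_bot.1 ha, map_zero]

section

variable {F : MvPolynomial (Fin 6) ℂ} {h : Fin 6 → ℂ}

theorem isNodalCurve_imageCurve (hF : F ∈ cubicsContainingPlane) (hs : IsSmoothPair F)
    (hh : h ∈ goodHyperplanes F) : IsNodalCurve (doublePlane F) (imageCurve F h) 15 := by
  rw [doublePlane_eq, imageCurve_eq hF hs hh.2.2.1]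
  exact isNodalCurve_of_isLocallySquare (isHomogeneous_sextic hF.1) (isHomogeneous_quintic hF.1 h)
    (by norm_num) (by norm_num) (isPrime_doubleIdeal_quintic hF hs hh.2.2.1) hs.2 hh.2.2.1
    (isLocallySquare_quintic hF.1 hs.2 h) hh.2.2.2 (by norm_num)

theorem eval_eq_zero_of_mem_singularPoints (hF : F ∈ cubicsContainingPlane) (hs : IsSmoothPair F)
    (hh : h ∈ goodHyperplanes F) (p : TotRep)
    (hp : ⟦p⟧ ∈ singularPoints (doublePlane F) (imageCurve F h)) :
    eval (base p) (sextic F) = 0 ∧ eval (base p) (quintic F h) = 0 := by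
  rw [doublePlane_eq, imageCurve_eq hF hs hh.2.2.1] at hp
  exact ((mk_mem_singularPoints_iff (isHomogeneous_sextic hF.1) (isHomogeneous_quintic hF.1 h)
    (isPrime_doubleIdeal_bot (irreducible_of_isSmoothHypersurface (isHomogeneous_sextic hF.1)
      (by norm_num) hs.2)) (isPrime_doubleIdeal_quintic hF hs hh.2.2.1) hh.2.2.1
    (isLocallySquare_quintic hF.1 hs.2 h) p).1 hp).2

end

/-! ### Elimination in polynomial families -/

/-- Families of polynomials, indexed by `T`, whose coefficients are polynomials in the parameters
`θ t`. -/
def polynomialFamilies {T τ : Type*} (θ : T → τ → ℂ) (n : ℕ) :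
    Subring (T → MvPolynomial (Fin n) ℂ) :=
  (RingHom.pi fun t => MvPolynomial.map (σ := Fin n) (eval (θ t))).range

theorem mem_polynomialFamilies {T τ : Type*} {θ : T → τ → ℂ} {n : ℕ}
    {G : T → MvPolynomial (Fin n) ℂ} : G ∈ polynomialFamilies θ n ↔
      ∃ Γ : MvPolynomial (Fin n) (MvPolynomial τ ℂ), ∀ t, MvPolynomial.map (eval (θ t)) Γ = G t := by
  constructor
  · rintro ⟨Γ, rfl⟩
    exact ⟨Γ, fun t => rfl⟩
  · rintro ⟨Γ, h⟩
    exact ⟨Γ, funext h⟩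

theorem const_mem_polynomialFamilies {T τ : Type*} (θ : T → τ → ℂ) {n : ℕ}
    (G : MvPolynomial (Fin n) ℂ) : (fun _ => G) ∈ polynomialFamilies θ n := by
  refine mem_polynomialFamilies.mpr ⟨MvPolynomial.map C G, fun t => ?_⟩
  rw [MvPolynomial.map_map]
  convert MvPolynomial.map_id G
  ext z
  simp

theorem C_mem_polynomialFamilies {T τ : Type*} (θ : T → τ → ℂ) {n : ℕ} (i : τ) :
    (fun t => (C (θ t i) : MvPolynomial (Fin n) ℂ)) ∈ polynomialFamilies θ n :=
  mem_polynomialFamilies.mpr ⟨C (X i), fun t => by simp⟩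

theorem pderiv_mem_polynomialFamilies {T τ : Type*} {θ : T → τ → ℂ} {n : ℕ}
    {G : T → MvPolynomial (Fin n) ℂ} (hG : G ∈ polynomialFamilies θ n) (i : Fin n) :
    (fun t => pderiv i (G t)) ∈ polynomialFamilies θ n := by
  obtain ⟨Γ, h⟩ := mem_polynomialFamilies.mp hG
  exact mem_polynomialFamilies.mpr ⟨pderiv i Γ, fun t => by rw [← h, pderiv_map]⟩

theorem det_mem_polynomialFamilies {T τ : Type*} {θ : T → τ → ℂ} {n k : ℕ}
    {M : T → Matrix (Fin k) (Fin k) (MvPolynomial (Fin n) ℂ)}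
    (hM : ∀ i j, (fun t => M t i j) ∈ polynomialFamilies θ n) :
    (fun t => (M t).det) ∈ polynomialFamilies θ n := by
  choose N hN using fun i j => mem_polynomialFamilies.mp (hM i j)
  refine mem_polynomialFamilies.mpr ⟨(Matrix.of N).det, fun t => ?_⟩
  rw [RingHom.map_det]
  congr 1
  ext1 i j
  exact hN i j t

theorem adjugate_mem_polynomialFamilies {T τ : Type*} {θ : T → τ → ℂ} {n k : ℕ}
    {M : T → Matrix (Fin k) (Fin k) (MvPolynomial (Fin n) ℂ)}
    (hM : ∀ i j, (fun t => M t i j) ∈ polynomialFamilies θ n) (i j : Fin k) :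
    (fun t => (M t).adjugate i j) ∈ polynomialFamilies θ n := by
  choose N hN using fun i j => mem_polynomialFamilies.mp (hM i j)
  refine mem_polynomialFamilies.mpr ⟨(Matrix.of N).adjugate i j, fun t => ?_⟩
  have h1 : (MvPolynomial.map (eval (θ t))).mapMatrix (Matrix.of N) = M t := by
    ext1 i j
    exact hN i j t
  rw [← h1, ← RingHom.map_adjugate]
  rfl

theorem eval_eq_sum_finsuppAntidiag {n d : ℕ} {G : MvPolynomial (Fin n) ℂ}
    (hG : G.IsHomogeneous d) (v : Fin n → ℂ) :
    eval v G = ∑ m ∈ (Finset.univ : Finset (Fin n)).finsuppAntidiag d,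
      G.coeff m * ∏ i, v i ^ m i := by
  rw [eval_eq']
  refine Finset.sum_subset (fun m hm => ?_) fun m _ hm => ?_
  · rw [Finset.mem_finsuppAntidiag]
    refine ⟨?_, Finset.subset_univ _⟩
    have := hG (mem_support_iff.mp hm)
    rwa [← Finsupp.degree_eq_sum, Finsupp.degree_eq_weight_one]
  · rw [notMem_support_iff.mp hm, zero_mul]

/-- A projective form of the Nullstellensatz: forms without common zero generate all forms of large
degree. -/
theorem exists_monomial_mem_span {n : ℕ} {ι : Type*} (G : ι → MvPolynomial (Fin n) ℂ)
    (h0 : ∀ v : Fin n → ℂ, (∀ i, eval v (G i) = 0) → v = 0) :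
    ∃ N, ∀ m : Fin n →₀ ℕ, N ≤ m.degree → monomial m 1 ∈ Ideal.span (Set.range G) := by
  have h1 : idealOfVars (Fin n) ℂ ≤ (Ideal.span (Set.range G)).radical := by
    rw [← vanishingIdeal_zeroLocus_eq_radical (K := ℂ), idealOfVars, Ideal.span_le]
    rintro _ ⟨j, rfl⟩
    rw [SetLike.mem_coe, mem_vanishingIdeal_iff]
    intro v hv
    rw [h0 v fun i => ?_]
    · simp
    · have := mem_zeroLocus_iff.mp hv (G i) (Ideal.subset_span ⟨i, rfl⟩)
      simpa [coe_aeval_eq_eval] using this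
  obtain ⟨N, hN⟩ := Ideal.exists_pow_le_of_le_radical_of_fg h1 (idealOfVars_fg _ _)
  refine ⟨N, fun m hm => hN ?_⟩
  rw [monomial_mem_pow_idealOfVars_iff _ _ one_ne_zero]
  exact hm

/-- The main theorem of elimination theory, for a polynomial family of systems of forms: having no
common zero in projective space is an open condition on the parameters. -/
theorem exists_eliminant {T τ : Type*} {θ : T → τ → ℂ} {n : ℕ} {ι : Type*} [Fintype ι]
    {G : ι → T → MvPolynomial (Fin n) ℂ} (hG : ∀ i, G i ∈ polynomialFamilies θ n) {d : ι → ℕ}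
    (hd : ∀ i t, (G i t).IsHomogeneous (d i)) {t₀ : T}
    (h0 : ∀ v : Fin n → ℂ, (∀ i, eval v (G i t₀) = 0) → v = 0) :
    ∃ E : MvPolynomial τ ℂ, eval (θ t₀) E ≠ 0 ∧
      ∀ t, eval (θ t) E ≠ 0 → ∀ v : Fin n → ℂ, (∀ i, eval v (G i t) = 0) → v = 0 := by
  classical
  obtain ⟨N, hN⟩ := exists_monomial_mem_span (fun i => G i t₀) h0
  choose Γ hΓ using fun i => mem_polynomialFamilies.mp (hG i)
  set D := N + ∑ i, d i + 1
  have hdD : ∀ i, d i ≤ D := fun i =>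
    (Finset.single_le_sum (fun _ _ => Nat.zero_le _) (Finset.mem_univ i)).trans (by omega)
  set S := (Finset.univ : Finset (Fin n)).finsuppAntidiag D
  have hS : ∀ m ∈ S, N ≤ m.degree := fun m hm => by
    rw [Finset.mem_finsuppAntidiag] at hm
    rw [Finsupp.degree_eq_sum, hm.1]
    omega
  have h1 : ∀ m : S, ∃ c : ι → MvPolynomial (Fin n) ℂ,
      ∑ i, c i * G i t₀ = monomial m.1 1 := fun m =>
    Ideal.mem_span_range_iff_exists_fun.mp (hN m.1 (hS m.1 m.2))
  choose c hc using h1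
  -- At `t₀` these combinations are the monomials of degree `D`; their coefficient matrix is the
  -- identity there, and its determinant is the eliminant.
  set A : Matrix S S (MvPolynomial τ ℂ) := Matrix.of fun m k =>
    (∑ i, MvPolynomial.map C (c m i) * Γ i).coeff k.1
  have hA : ∀ t, (eval (θ t)).mapMatrix A =
      Matrix.of fun m k : S => (∑ i, c m i * G i t).coeff k.1 := by
    intro t
    ext m k
    simp only [A, RingHom.mapMatrix_apply, Matrix.map_apply, Matrix.of_apply]
    rw [← coeff_map]
    simp only [map_sum, map_mul, hΓ, MvPolynomial.map_map]
    congr 1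
    refine Finset.sum_congr rfl fun i _ => ?_
    congr 1
    convert MvPolynomial.map_id (c m i)
    ext z
    simp
  refine ⟨A.det, ?_, fun t ht v hv => ?_⟩
  · rw [RingHom.map_det, hA]
    have : (Matrix.of fun m k : S => (∑ i, c m i * G i t₀).coeff k.1) = 1 := by
      ext m k
      rw [Matrix.of_apply, hc, coeff_monomial, Matrix.one_apply]
      exact if_congr Subtype.ext_iff.symm rfl rfl
    rw [this, Matrix.det_one]
    exact one_ne_zero
  · rw [RingHom.map_det, hA] at ht
    have h2 := Matrix.eq_zero_of_mulVec_eq_zero ht (v := fun m : S => ∏ i, v i ^ m.1 i) (by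
      ext m
      rw [Matrix.mulVec, dotProduct, Pi.zero_apply]
      simp only [Matrix.of_apply]
      have h3 := eval_eq_sum_finsuppAntidiag
        (homogeneousComponent_isHomogeneous D (∑ i, c m i * G i t)) v
      rw [map_sum, map_sum, Finset.sum_eq_zero] at h3
      · rw [← map_sum, ← Finset.sum_coe_sort] at h3
        rw [h3]
        refine Finset.sum_congr rfl fun k _ => ?_
        rw [coeff_homogeneousComponent, if_pos]
        have := k.2
        rw [Finset.mem_finsuppAntidiag] at this
        rw [Finsupp.degree_eq_sum, this.1]
      · intro i _
        rw [← Nat.sub_add_cancel (hdD i), homogeneousComponent_mul_of_isHomogeneous (hd i t),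
          map_mul, hv, mul_zero])
    ext j
    have hj : Finsupp.single j D ∈ S := by
      rw [Finset.mem_finsuppAntidiag]
      exact ⟨by simp [Finsupp.single_apply], Finset.subset_univ _⟩
    have h4 := congrFun h2 ⟨_, hj⟩
    simp only [Pi.zero_apply] at h4
    rw [Finset.prod_eq_single j (fun b _ hb => by simp [hb.symm])
      (by simp), Finsupp.single_eq_same] at h4
    exact eq_zero_of_pow_eq_zero h4

/-! ### Generic conditions on cubics containing the plane and hyperplanes -/

/-- Pairs of a cubic containing the plane and (the coefficients of) a hyperplane; `h = 0` is allowed,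
so that these pairs form a vector space. -/
abbrev SectionPair : Type := cubicsContainingPlane × (Fin 6 → ℂ)

/-- The coefficients of the two equations, the parameters on which all families here depend. -/
def SectionPair.coords (t : SectionPair) : (Fin 6 →₀ ℕ) ⊕ Fin 6 → ℂ := Sum.elim (fun m => t.1.1.coeff m) t.2

theorem cubic_mem_polynomialFamilies : (fun t : SectionPair => t.1.1) ∈ polynomialFamilies SectionPair.coords 6 := by
  refine mem_polynomialFamilies.mpr ⟨∑ m ∈ (Finset.univ : Finset (Fin 6)).finsuppAntidiag 3,
    monomial m (X (Sum.inl m)), fun t => ?_⟩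
  rw [map_sum]
  simp only [map_monomial, eval_X, SectionPair.coords, Sum.elim_inl]
  conv_rhs => rw [t.1.1.as_sum]
  symm
  refine Finset.sum_subset (fun m hm => ?_) fun m _ hm => ?_
  · rw [Finset.mem_finsuppAntidiag]
    refine ⟨?_, Finset.subset_univ _⟩
    have := t.1.2.1 (mem_support_iff.mp hm)
    rwa [← Finsupp.degree_eq_sum, Finsupp.degree_eq_weight_one]
  · rw [notMem_support_iff.mp hm, monomial_zero]

theorem restrictT_mem_polynomialFamilies {T τ : Type*} {θ : T → τ → ℂ}
    {G : T → MvPolynomial (Fin 6) ℂ} (hG : G ∈ polynomialFamilies θ 6) :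
    (fun t => restrictT (G t)) ∈ polynomialFamilies θ 3 := by
  obtain ⟨Γ, h⟩ := mem_polynomialFamilies.mp hG
  refine mem_polynomialFamilies.mpr ⟨bind₁ ![X 0, X 1, X 2, 0, 0, 0] Γ, fun t => ?_⟩
  rw [map_bind₁, h, restrictT, aeval_eq_bind₁]
  congr 2
  ext1 i
  fin_cases i <;> simp

theorem gram_mem_polynomialFamilies (i j : Fin 4) :
    (fun t : SectionPair => gram t.1.1 i j) ∈ polynomialFamilies SectionPair.coords 3 := by
  have hF := cubic_mem_polynomialFamilies
  have h2 : ∀ a b, (fun t : SectionPair => restrictT (pderiv a (pderiv b t.1.1))) ∈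
      polynomialFamilies SectionPair.coords 3 := fun a b =>
    restrictT_mem_polynomialFamilies (pderiv_mem_polynomialFamilies
      (pderiv_mem_polynomialFamilies hF b) a)
  have h1 : ∀ a, (fun t : SectionPair => restrictT (pderiv a t.1.1)) ∈
      polynomialFamilies SectionPair.coords 3 := fun a =>
    restrictT_mem_polynomialFamilies (pderiv_mem_polynomialFamilies hF a)
  have h0 : (fun t : SectionPair => 2 * restrictT t.1.1) ∈ polynomialFamilies SectionPair.coords 3 :=
    mul_mem (const_mem_polynomialFamilies SectionPair.coords 2) (restrictT_mem_polynomialFamilies hF)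
  fin_cases i <;> fin_cases j <;> simp only [gram] <;> simp <;>
    with_reducible first | exact h2 _ _ | exact h1 _ | exact h0

theorem sextic_mem_polynomialFamilies :
    (fun t : SectionPair => sextic t.1.1) ∈ polynomialFamilies SectionPair.coords 3 :=
  det_mem_polynomialFamilies gram_mem_polynomialFamilies

theorem normal_mem_polynomialFamilies (i : Fin 4) :
    (fun t : SectionPair => normal t.2 i) ∈ polynomialFamilies SectionPair.coords 3 := by
  have hC : ∀ i, (fun t : SectionPair => (C (t.2 i) : MvPolynomial (Fin 3) ℂ)) ∈
      polynomialFamilies SectionPair.coords 3 := fun i =>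
    C_mem_polynomialFamilies SectionPair.coords (Sum.inr i)
  have hX : ∀ i, (fun _ => X i) ∈ polynomialFamilies SectionPair.coords 3 := fun i =>
    const_mem_polynomialFamilies SectionPair.coords (X i)
  fin_cases i
  · exact hC 3
  · exact hC 4
  · exact hC 5
  · exact add_mem (add_mem (mul_mem (hC 0) (hX 0)) (mul_mem (hC 1) (hX 1))) (mul_mem (hC 2) (hX 2))

theorem sum_apply_mem_polynomialFamilies {T τ : Type*} {θ : T → τ → ℂ} {n k : ℕ}
    {G : Fin k → T → MvPolynomial (Fin n) ℂ} (hG : ∀ i, G i ∈ polynomialFamilies θ n) :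
    (fun t => ∑ i, G i t) ∈ polynomialFamilies θ n := by
  convert sum_mem (t := Finset.univ) fun i _ => hG i
  simp

theorem pole_mem_polynomialFamilies (j : Fin 4) :
    (fun t : SectionPair => pole t.1.1 t.2 j) ∈ polynomialFamilies SectionPair.coords 3 :=
  sum_apply_mem_polynomialFamilies fun i => mul_mem
    (adjugate_mem_polynomialFamilies gram_mem_polynomialFamilies j i)
    (normal_mem_polynomialFamilies i)

theorem quintic_mem_polynomialFamilies :
    (fun t : SectionPair => quintic t.1.1 t.2) ∈ polynomialFamilies SectionPair.coords 3 :=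
  sum_apply_mem_polynomialFamilies fun i => mul_mem (normal_mem_polynomialFamilies i)
    (pole_mem_polynomialFamilies i)

/-- A condition holds generically if it holds wherever some polynomial in the coefficients, not
identically zero, does not vanish. -/
def IsGeneric (Q : SectionPair → Prop) : Prop :=
  ∃ E : MvPolynomial ((Fin 6 →₀ ℕ) ⊕ Fin 6) ℂ, (∃ t : SectionPair, eval t.coords E ≠ 0) ∧
    ∀ t : SectionPair, eval t.coords E ≠ 0 → Q t

/-- The pairs `(F, h)` form a vector space over an infinite field, so that two nonempty open conditions
hold together at some point of the line joining two pairs. -/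
theorem IsGeneric.and {Q R : SectionPair → Prop} (hQ : IsGeneric Q) (hR : IsGeneric R) :
    IsGeneric fun t => Q t ∧ R t := by
  obtain ⟨D, ⟨t, ht⟩, hD⟩ := hQ
  obtain ⟨E, ⟨u, hu⟩, hE⟩ := hR
  refine ⟨D * E, ?_, fun s hs => ?_⟩
  swap
  · rw [map_mul] at hs
    exact ⟨hD s (left_ne_zero_of_mul hs), hE s (right_ne_zero_of_mul hs)⟩
  let γ (s : ℂ) : SectionPair :=
    ⟨⟨C (1 - s) * t.1.1 + C s * u.1.1, (t.1.2.1.C_mul _).add (u.1.2.1.C_mul _), fun v h0 h1 h2 => by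
      simp [t.1.2.2 v h0 h1 h2, u.1.2.2 v h0 h1 h2]⟩, (1 - s) • t.2 + s • u.2⟩
  have hγ : ∀ (s : ℂ) (G : MvPolynomial ((Fin 6 →₀ ℕ) ⊕ Fin 6) ℂ), eval (γ s).coords G =
      (aeval (fun i => Polynomial.C (t.coords i) * (1 - Polynomial.X) +
        Polynomial.C (u.coords i) * Polynomial.X) G).eval s := by
    intro s G
    have : eval (γ s).coords = (Polynomial.evalRingHom s).comp
        (aeval (R := ℂ) fun i => Polynomial.C (t.coords i) * (1 - Polynomial.X) +
          Polynomial.C (u.coords i) * Polynomial.X).toRingHom := by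
      ext i
      · simp
      · rcases i with m | i <;> simp [γ, SectionPair.coords, -map_sub, -C_sub] <;> ring
    rw [this]
    rfl
  by_contra! hc
  have h1 : aeval (fun i => Polynomial.C (t.coords i) * (1 - Polynomial.X) +
        Polynomial.C (u.coords i) * Polynomial.X) (D * E) = 0 :=
    Polynomial.funext fun s => by rw [← hγ, hc, Polynomial.eval_zero]
  rw [map_mul, mul_eq_zero] at h1
  rcases h1 with h1 | h1
  · apply ht
    have := hγ 0 D
    rw [h1, Polynomial.eval_zero] at this
    rw [← this]
    congr 2
    simp [γ]
  · apply hu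
    have := hγ 1 E
    rw [h1, Polynomial.eval_zero] at this
    rw [← this]
    congr 2
    simp [γ]

theorem isGeneric_of_forall_eq_zero {n : ℕ} {ι : Type*} [Fintype ι]
    {G : ι → SectionPair → MvPolynomial (Fin n) ℂ} (hG : ∀ i, G i ∈ polynomialFamilies SectionPair.coords n)
    {d : ι → ℕ} (hd : ∀ i t, (G i t).IsHomogeneous (d i)) (t₀ : SectionPair)
    (h0 : ∀ v : Fin n → ℂ, (∀ i, eval v (G i t₀) = 0) → v = 0) :
    IsGeneric fun t => ∀ v : Fin n → ℂ, (∀ i, eval v (G i t) = 0) → v = 0 := by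
  obtain ⟨E, h1, h2⟩ := exists_eliminant hG hd h0
  exact ⟨E, ⟨t₀, h1⟩, h2⟩

theorem IsGeneric.mono {Q R : SectionPair → Prop} (hQ : IsGeneric Q) (h : ∀ t, Q t → R t) :
    IsGeneric R := by
  obtain ⟨E, h1, h2⟩ := hQ
  exact ⟨E, h1, fun t ht => h t (h2 t ht)⟩

theorem isGeneric_isSmoothHypersurface {n d : ℕ} {G : SectionPair → MvPolynomial (Fin n) ℂ}
    (hG : G ∈ polynomialFamilies SectionPair.coords n) (hd : ∀ t, (G t).IsHomogeneous d) (t₀ : SectionPair)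
    (h0 : IsSmoothHypersurface (G t₀)) : IsGeneric fun t => IsSmoothHypersurface (G t) := by
  refine (isGeneric_of_forall_eq_zero (ι := Option (Fin n))
    (G := fun o t => o.elim (G t) fun i => pderiv i (G t)) (d := fun o => o.elim d fun _ => d - 1)
    ?_ ?_ t₀ ?_).mono ?_
  · rintro (_ | i)
    · exact hG
    · exact pderiv_mem_polynomialFamilies hG i
  · rintro (_ | i) t
    · exact hd t
    · exact (hd t).pderiv
  · intro v hv
    by_contra hv0
    obtain ⟨i, hi⟩ := h0 v hv0 (hv none)
    exact hi (hv (some i))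
  · intro t ht v hv0 hv
    by_contra! hc
    exact hv0 (ht v (by rintro (_ | i); exacts [hv, hc i]))

theorem isGeneric_isSmoothSection (t₀ : SectionPair) (h0 : IsSmoothSection t₀.1.1 t₀.2) :
    IsGeneric fun t => IsSmoothSection t.1.1 t.2 := by
  have hF := cubic_mem_polynomialFamilies
  have hC : ∀ i, (fun t : SectionPair => (C (t.2 i) : MvPolynomial (Fin 6) ℂ)) ∈
      polynomialFamilies SectionPair.coords 6 := fun i =>
    C_mem_polynomialFamilies SectionPair.coords (Sum.inr i)
  refine (isGeneric_of_forall_eq_zero (ι := Option (Option (Fin 6 × Fin 6)))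
    (G := fun o t => o.elim t.1.1 fun o => o.elim (∑ i, C (t.2 i) * X i) fun a =>
      pderiv a.1 t.1.1 * C (t.2 a.2) - pderiv a.2 t.1.1 * C (t.2 a.1))
    (d := fun o => o.elim 3 fun o => o.elim 1 fun _ => 2) ?_ ?_ t₀ ?_).mono ?_
  · rintro (_ | _ | a)
    · exact hF
    · exact sum_apply_mem_polynomialFamilies fun i =>
        mul_mem (hC i) (const_mem_polynomialFamilies SectionPair.coords (X i))
    · exact sub_mem (mul_mem (pderiv_mem_polynomialFamilies hF _) (hC _))
        (mul_mem (pderiv_mem_polynomialFamilies hF _) (hC _))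
  · rintro (_ | _ | a) t
    · exact t.1.2.1
    · exact IsHomogeneous.sum Finset.univ _ 1 fun i _ => isHomogeneous_C_mul_X (t.2 i) i
    · exact (t.1.2.1.pderiv.mul (isHomogeneous_C (Fin 6) _)).sub
        (t.1.2.1.pderiv.mul (isHomogeneous_C (Fin 6) _))
  · intro v hv
    by_contra hv0
    have h1 := h0 v hv0 (hv none) (by simpa [dotProduct] using hv (some none))
    have h2 : ∀ j, t₀.2 j = 0 := fun j => by
      refine ((LinearIndependent.pair_iff.mp h1) (t₀.2 j) (-eval v (pderiv j t₀.1.1)) ?_).1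
      ext i
      have := hv (some (some (i, j)))
      simp at this ⊢
      linear_combination this
    exact h1.ne_zero 1 (by ext j; exact h2 j)
  · intro t ht v hv0 hv hhv
    refine LinearIndependent.pair_iff.mpr fun a b hab => ?_
    by_contra hc
    refine hv0 (ht v ?_)
    rintro (_ | _ | ⟨i, j⟩)
    · exact hv
    · simpa [dotProduct] using hhv
    · have hi := congrFun hab i
      have hj := congrFun hab j
      simp at hi hj ⊢
      by_contra h3
      have ha : a = 0 := by
        refine (mul_eq_zero.mp (?_ : a * _ = 0)).resolve_right h3
        linear_combination t.2 j * hi - t.2 i * hj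
      have hb : b = 0 := by
        refine (mul_eq_zero.mp (?_ : b * _ = 0)).resolve_right h3
        linear_combination eval v (pderiv i t.1.1) * hj - eval v (pderiv j t.1.1) * hi
      exact hc ⟨ha, hb⟩

theorem eq_zero_of_cross_ne_zero {p q v τ : Fin 3 → ℂ} {i k : Fin 3} (hv : v i ≠ 0) (hτ : τ i = 0)
    (hpv : p ⬝ᵥ v = 0) (hqv : q ⬝ᵥ v = 0) (hpτ : p ⬝ᵥ τ = 0) (hqτ : q ⬝ᵥ τ = 0)
    (hk : p (k + 1) * q (k + 2) - p (k + 2) * q (k + 1) ≠ 0) : τ = 0 := by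
  set m : Fin 3 → ℂ := fun k => p (k + 1) * q (k + 2) - p (k + 2) * q (k + 1)
  -- The kernel of `p` and `q` is spanned by their cross product `m`.
  have h1 : ∀ w : Fin 3 → ℂ, p ⬝ᵥ w = 0 → q ⬝ᵥ w = 0 → ∀ a b, m a * w b = m b * w a := by
    intro w hp hq a b
    rw [dotProduct, Fin.sum_univ_three] at hp hq
    fin_cases a <;> fin_cases b <;> simp [m] <;> grind
  have hi : m i ≠ 0 := fun h => by
    have := h1 v hpv hqv k i
    rw [h, zero_mul] at this
    exact (mul_ne_zero hk hv) this
  ext l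
  have := h1 τ hpτ hqτ i l
  rw [hτ, mul_zero] at this
  exact (mul_eq_zero.mp this).resolve_left hi

/-- The sextic `f` and the quintic meet with multiplicity at most two where the differentials of `f` and
of a coordinate `bⱼ` of the pole are independent. With the factor `adj(M)ⱼⱼ` this is an open condition
that can hold everywhere: for some `j` the differentials of `f` and `bⱼ` may well be proportional. -/
theorem isGeneric_intersectionMultiplicity_le_two (t₀ : SectionPair)
    (h0 : ∀ v : Fin 3 → ℂ, eval v (sextic t₀.1.1) = 0 → eval v (quintic t₀.1.1 t₀.2) = 0 →
      (∀ j k, eval v ((gram t₀.1.1).adjugate j j) *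
        (eval v (pderiv (k + 1) (sextic t₀.1.1)) * eval v (pderiv (k + 2) (pole t₀.1.1 t₀.2 j)) -
          eval v (pderiv (k + 2) (sextic t₀.1.1)) *
            eval v (pderiv (k + 1) (pole t₀.1.1 t₀.2 j))) = 0) → v = 0) :
    IsGeneric fun t => ∀ (v : Fin 3 → ℂ) (i : Fin 3), v i ≠ 0 → eval v (sextic t.1.1) = 0 →
      eval v (quintic t.1.1 t.2) = 0 →
      intersectionMultiplicity (sextic t.1.1) (quintic t.1.1 t.2) i v ≤ 2 := by
  refine (isGeneric_of_forall_eq_zero (ι := Option (Option (Fin 4 × Fin 3)))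
    (G := fun o t => o.elim (sextic t.1.1) fun o => o.elim (quintic t.1.1 t.2) fun a =>
      (gram t.1.1).adjugate a.1 a.1 *
        (pderiv (a.2 + 1) (sextic t.1.1) * pderiv (a.2 + 2) (pole t.1.1 t.2 a.1) -
          pderiv (a.2 + 2) (sextic t.1.1) * pderiv (a.2 + 1) (pole t.1.1 t.2 a.1)))
    (d := fun o => o.elim 6 fun o => o.elim 5 fun a =>
      (5 - fibreWeight a.1 - fibreWeight a.1) + ((6 - 1) + (5 - fibreWeight a.1 - 1)))
    ?_ ?_ t₀ ?_).mono ?_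
  · rintro (_ | _ | ⟨j, k⟩)
    · exact sextic_mem_polynomialFamilies
    · exact quintic_mem_polynomialFamilies
    · have hf := fun i => pderiv_mem_polynomialFamilies sextic_mem_polynomialFamilies i
      have hb := fun i => pderiv_mem_polynomialFamilies (pole_mem_polynomialFamilies j) i
      exact mul_mem (adjugate_mem_polynomialFamilies gram_mem_polynomialFamilies j j)
        (sub_mem (mul_mem (hf _) (hb _)) (mul_mem (hf _) (hb _)))
  · rintro (_ | _ | ⟨j, k⟩) t
    · exact isHomogeneous_sextic t.1.2.1
    · exact isHomogeneous_quintic t.1.2.1 t.2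
    · have hf := fun i => (isHomogeneous_sextic t.1.2.1).pderiv (i := i)
      have hb := fun i => (isHomogeneous_pole t.1.2.1 t.2 j).pderiv (i := i)
      exact (isHomogeneous_adjugate t.1.2.1 j j).mul
        (((hf _).mul (hb _)).sub ((hf _).mul (hb _)))
  · intro v hv
    refine h0 v (hv none) (hv (some none)) fun j k => ?_
    have := hv (some (some (j, k)))
    simpa only [Option.elim, map_mul, map_sub] using this
  · intro t ht v i hi hfv hgv
    have h1 : ∃ j k, eval v ((gram t.1.1).adjugate j j) *
        (eval v (pderiv (k + 1) (sextic t.1.1)) * eval v (pderiv (k + 2) (pole t.1.1 t.2 j)) -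
          eval v (pderiv (k + 2) (sextic t.1.1)) *
            eval v (pderiv (k + 1) (pole t.1.1 t.2 j))) ≠ 0 := by
      by_contra! hc
      refine hi (congrFun (ht v ?_) i)
      rintro (_ | _ | ⟨j, k⟩)
      · exact hfv
      · exact hgv
      · simpa only [Option.elim, map_mul, map_sub] using hc j k
    obtain ⟨j, k, hjk⟩ := h1
    obtain ⟨κ, hκ⟩ := exists_quintic_mul t.1.1 t.2 j
    have hb := (dirDeriv_eq_zero_of_sq hκ hfv hgv).1
    have hdot : ∀ (w : Fin 3 → ℂ) (G : MvPolynomial (Fin 3) ℂ),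
        (fun a => eval v (pderiv a G)) ⬝ᵥ w = dirDeriv v w G := fun w G => by
      simp [dirDeriv_apply, dotProduct, mul_comm]
    refine intersectionMultiplicity_le_two hκ hfv hgv fun τ hτ hfτ hbτ => ?_
    refine eq_zero_of_cross_ne_zero hi hτ (p := fun a => eval v (pderiv a (sextic t.1.1)))
      (q := fun a => eval v (pderiv a (pole t.1.1 t.2 j))) ?_ ?_ ?_ ?_ (right_ne_zero_of_mul hjk)
    · rw [hdot, dirDeriv_self (isHomogeneous_sextic t.1.2.1), hfv, mul_zero]
    · rw [hdot, dirDeriv_self (isHomogeneous_pole t.1.2.1 t.2 j), hb, mul_zero]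
    · rw [hdot, hfτ]
    · rw [hdot, hbτ]

/-! ### Examples of smooth and transversal discriminants -/

/-- Polynomials in `x, y, z` as polynomials in the six coordinates of `ℙ⁵`. -/
def lift : MvPolynomial (Fin 3) ℂ →ₐ[ℂ] MvPolynomial (Fin 6) ℂ := rename (Fin.castAdd 3)

/-- The cubic `∑ aᵢ tᵢ² + ∑ bᵢ tᵢ + c`. -/
def diagonalCubic (a b : Fin 3 → MvPolynomial (Fin 3) ℂ) (c : MvPolynomial (Fin 3) ℂ) :
    MvPolynomial (Fin 6) ℂ :=
  lift (a 0) * X 3 ^ 2 + lift (a 1) * X 4 ^ 2 + lift (a 2) * X 5 ^ 2 +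
    (lift (b 0) * X 3 + lift (b 1) * X 4 + lift (b 2) * X 5) + lift c

section Diagonal

variable {a b : Fin 3 → MvPolynomial (Fin 3) ℂ} {c : MvPolynomial (Fin 3) ℂ}

theorem restrictT_lift (p : MvPolynomial (Fin 3) ℂ) : restrictT (lift p) = p := by
  rw [restrictT, lift, aeval_rename]
  convert aeval_X_left_apply p using 3
  ext1 i
  fin_cases i <;> rfl

theorem pderiv_lift (p : MvPolynomial (Fin 3) ℂ) {i : Fin 6} (hi : 3 ≤ i) :
    pderiv i (lift p) = 0 := by
  refine pderiv_eq_zero_of_notMem_vars fun h => ?_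
  have := vars_rename _ _ h
  simp only [Finset.mem_image] at this
  obtain ⟨j, -, rfl⟩ := this
  fin_cases j <;> simp at hi

theorem eval_lift (v : Fin 6 → ℂ) (p : MvPolynomial (Fin 3) ℂ) :
    eval v (lift p) = eval ![v 0, v 1, v 2] p := by
  rw [lift, eval_rename]
  congr 2
  ext1 i
  fin_cases i <;> rfl

theorem restrictT_X {i : Fin 6} (hi : 3 ≤ i) : restrictT (X i) = 0 := by
  fin_cases i <;> simp [restrictT] at hi ⊢

theorem pderiv_diagonalCubic (i : Fin 3) : pderiv (Fin.natAdd 3 i) (diagonalCubic a b c) =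
    lift (2 * a i) * X (Fin.natAdd 3 i) + lift (b i) := by
  have hl := fun p => pderiv_lift p (i := Fin.natAdd 3 i) (by fin_cases i <;> decide)
  simp only [diagonalCubic, map_add, Derivation.leibniz, Derivation.leibniz_pow, hl, pderiv_X, map_mul,
    map_ofNat]
  fin_cases i <;> simp <;> ring

theorem gram_diagonalCubic : gram (diagonalCubic a b c) =
    !![2 * a 0, 0, 0, b 0; 0, 2 * a 1, 0, b 1; 0, 0, 2 * a 2, b 2; b 0, b 1, b 2, 2 * c] := by
  have hr : ∀ p q, restrictT (p + q) = restrictT p + restrictT q := map_add _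
  have hm : ∀ p q, restrictT (p * q) = restrictT p * restrictT q := map_mul _
  have h1 : ∀ i, restrictT (pderiv (Fin.natAdd 3 i) (diagonalCubic a b c)) = b i := fun i => by
    rw [pderiv_diagonalCubic, hr, hm, restrictT_X (by fin_cases i <;> decide), restrictT_lift,
      mul_zero, zero_add, restrictT_lift]
  have h2 : ∀ i j, restrictT (pderiv (Fin.natAdd 3 i) (pderiv (Fin.natAdd 3 j)
      (diagonalCubic a b c))) = if i = j then 2 * a j else 0 := fun i j => by
    have hl := fun p => pderiv_lift p (i := Fin.natAdd 3 i) (by fin_cases i <;> decide)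
    rw [pderiv_diagonalCubic, map_add, Derivation.leibniz, hl, hl, smul_zero, add_zero, add_zero,
      pderiv_X, smul_eq_mul, hm, restrictT_lift]
    rcases eq_or_ne i j with rfl | hij
    · simp [restrictT]
    · rw [Pi.single_eq_of_ne (fun h => hij (Fin.natAdd_injective _ _ h).symm), if_neg hij]
      simp [restrictT]
  have h0 : restrictT (diagonalCubic a b c) = c := by
    simp only [diagonalCubic, pow_two, hr, hm, restrictT_lift, restrictT_X (i := 3) le_rfl,
      restrictT_X (i := 4) (by decide), restrictT_X (i := 5) (by decide), mul_zero, add_zero, zero_add]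
  have e3 : Fin.natAdd 3 (0 : Fin 3) = (3 : Fin 6) := rfl
  have e4 : Fin.natAdd 3 (1 : Fin 3) = (4 : Fin 6) := rfl
  have e5 : Fin.natAdd 3 (2 : Fin 3) = (5 : Fin 6) := rfl
  unfold gram
  simp only [← e3, ← e4, ← e5, h0, h1, h2]
  rfl

theorem diagonalCubic_mem (ha : ∀ i, (a i).IsHomogeneous 1) (hb : ∀ i, (b i).IsHomogeneous 2)
    (hc : c.IsHomogeneous 3) : diagonalCubic a b c ∈ cubicsContainingPlane := by
  have hl : ∀ {p : MvPolynomial (Fin 3) ℂ} {d}, p.IsHomogeneous d → (lift p).IsHomogeneous d :=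
    fun hp => hp.rename_isHomogeneous
  have h1 := fun i j => (hl (ha i)).mul ((isHomogeneous_X ℂ (j : Fin 6)).pow 2)
  have h2 := fun i j => (hl (hb i)).mul (isHomogeneous_X ℂ (j : Fin 6))
  refine ⟨((((h1 _ _).add (h1 _ _)).add (h1 _ _)).add (((h2 _ _).add (h2 _ _)).add (h2 _ _))).add
    (hl hc), fun v h0 h1 h2 => ?_⟩
  have h : ![v 0, v 1, v 2] = 0 := by
    ext i
    fin_cases i <;> simp [h0, h1, h2]
  simp only [diagonalCubic, map_add, map_mul, eval_lift, h, (ha _).eval_zero one_ne_zero,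
    (hb _).eval_zero two_ne_zero, hc.eval_zero three_ne_zero, zero_mul, add_zero]

theorem sextic_diagonalCubic : sextic (diagonalCubic a b c) =
    4 * (4 * a 0 * a 1 * a 2 * c - (b 0 ^ 2 * a 1 * a 2 + b 1 ^ 2 * a 0 * a 2 +
      b 2 ^ 2 * a 0 * a 1)) := by
  rw [sextic, gram_diagonalCubic]
  simp [Matrix.det_succ_row_zero, Fin.sum_univ_succ, Fin.succAbove]
  ring

theorem adjugate_diagonalCubic (j : Fin 4) : (gram (diagonalCubic a b c)).adjugate j j =
    ![8 * a 1 * a 2 * c - 2 * a 1 * b 2 ^ 2 - 2 * a 2 * b 1 ^ 2,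
      8 * a 0 * a 2 * c - 2 * a 0 * b 2 ^ 2 - 2 * a 2 * b 0 ^ 2,
      8 * a 0 * a 1 * c - 2 * a 0 * b 1 ^ 2 - 2 * a 1 * b 0 ^ 2,
      8 * a 0 * a 1 * a 2] j := by
  rw [gram_diagonalCubic, Matrix.adjugate_apply]
  fin_cases j <;>
  simp [Matrix.det_succ_row_zero, Fin.sum_univ_succ, Fin.succAbove, Matrix.updateRow_apply,
    Pi.single_apply] <;>
  ring

/-- The hyperplane `t₀ = 0`. -/
def coordinateHyperplane : Fin 6 → ℂ := Pi.single 3 1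

theorem normal_coordinateHyperplane : normal coordinateHyperplane = Pi.single 0 1 := by
  ext1 i
  fin_cases i <;> simp [normal, coordinateHyperplane]

theorem pole_diagonalCubic (j : Fin 4) : pole (diagonalCubic a b c) coordinateHyperplane j =
    ![8 * a 1 * a 2 * c - 2 * a 1 * b 2 ^ 2 - 2 * a 2 * b 1 ^ 2, 2 * a 2 * b 0 * b 1,
      2 * a 1 * b 0 * b 2, -4 * a 1 * a 2 * b 0] j := by
  rw [pole, normal_coordinateHyperplane, gram_diagonalCubic, Matrix.mulVec_single_one,
    Matrix.col_apply, Matrix.adjugate_apply]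
  fin_cases j <;>
  simp [Matrix.det_succ_row_zero, Fin.sum_univ_succ, Fin.succAbove, Matrix.updateRow_apply,
    Pi.single_apply] <;>
  ring

theorem quintic_diagonalCubic : quintic (diagonalCubic a b c) coordinateHyperplane =
    8 * a 1 * a 2 * c - 2 * a 1 * b 2 ^ 2 - 2 * a 2 * b 1 ^ 2 := by
  have := pole_diagonalCubic (a := a) (b := b) (c := c) 0
  rw [quintic, ← pole, normal_coordinateHyperplane, single_one_dotProduct, this]
  rfl

end Diagonal

theorem isHomogeneous_X_sq (i : Fin 3) : (X i ^ 2 : MvPolynomial (Fin 3) ℂ).IsHomogeneous 2 :=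
  (isHomogeneous_X ℂ i).pow 2

theorem pderiv_ofNat {n : ℕ} (i : Fin n) (k : ℕ) [k.AtLeastTwo] :
    pderiv i (OfNat.ofNat k : MvPolynomial (Fin n) ℂ) = 0 :=
  Derivation.map_natCast _ k

/-- The cubic `x t₀² + y t₁² + z t₂² + y² t₀ + z² t₁ + x² t₂`. -/
def smoothCubic : MvPolynomial (Fin 6) ℂ :=
  diagonalCubic ![X 0, X 1, X 2] ![X 1 ^ 2, X 2 ^ 2, X 0 ^ 2] 0

theorem smoothCubic_mem : smoothCubic ∈ cubicsContainingPlane :=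
  diagonalCubic_mem (fun i => by fin_cases i <;> exact isHomogeneous_X _ _)
    (fun i => by fin_cases i <;> exact isHomogeneous_X_sq _) (isHomogeneous_zero _ _ _)

theorem isSmoothHypersurface_smoothCubic : IsSmoothHypersurface smoothCubic := by
  intro v hv0 _
  by_contra! hc
  have e0 : v 3 ^ 2 + 2 * v 0 * v 5 = 0 := by
    rw [← hc 0]
    simp [smoothCubic, diagonalCubic, lift, pderiv_X]
    ring
  have e1 : v 4 ^ 2 + 2 * v 1 * v 3 = 0 := by
    rw [← hc 1]
    simp [smoothCubic, diagonalCubic, lift, pderiv_X]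
    ring
  have e2 : v 5 ^ 2 + 2 * v 2 * v 4 = 0 := by
    rw [← hc 2]
    simp [smoothCubic, diagonalCubic, lift, pderiv_X]
    ring
  have e3 : 2 * v 0 * v 3 + v 1 ^ 2 = 0 := by
    rw [← hc 3]
    simp [smoothCubic, diagonalCubic, lift, pderiv_X]
    ring
  have e4 : 2 * v 1 * v 4 + v 2 ^ 2 = 0 := by
    rw [← hc 4]
    simp [smoothCubic, diagonalCubic, lift, pderiv_X]
    ring
  have e5 : 2 * v 2 * v 5 + v 0 ^ 2 = 0 := by
    rw [← hc 5]
    simp [smoothCubic, diagonalCubic, lift, pderiv_X]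
    ring
  have k0 : v 1 ^ 4 * v 2 = 4 * v 0 ^ 5 := by grind
  have k1 : v 2 ^ 4 * v 0 = 4 * v 1 ^ 5 := by grind
  have k2 : v 0 ^ 4 * v 1 = 4 * v 2 ^ 5 := by grind
  have k : (v 0 * v 1 * v 2) ^ 5 = 0 := by
    have : (v 0 * v 1 * v 2) ^ 5 = 64 * (v 0 * v 1 * v 2) ^ 5 := by
      calc _ = (v 1 ^ 4 * v 2) * (v 2 ^ 4 * v 0) * (v 0 ^ 4 * v 1) := by ring
        _ = _ := by rw [k0, k1, k2]; ring
    linear_combination (-1 / 63 : ℂ) * this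
  have h0 : v 0 = 0 ∧ v 1 = 0 ∧ v 2 = 0 := by
    rcases mul_eq_zero.mp (eq_zero_of_pow_eq_zero k) with h | h
    · rcases mul_eq_zero.mp h with h | h <;> simp_all
    · simp_all
  obtain ⟨h0, h1, h2⟩ := h0
  refine hv0 (funext fun i => ?_)
  fin_cases i <;> simp_all

theorem isSmoothHypersurface_sextic_smoothCubic : IsSmoothHypersurface (sextic smoothCubic) := by
  intro v hv0 _
  by_contra! hc
  rw [smoothCubic, sextic_diagonalCubic] at hc
  have h4 := fun i : Fin 3 => pderiv_ofNat i 4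
  have e0 : -4 * (v 2 ^ 5 + 5 * v 0 ^ 4 * v 1) = 0 := by
    rw [← hc 0]
    simp [h4, pderiv_X]
    ring
  have e1 : -4 * (v 0 ^ 5 + 5 * v 1 ^ 4 * v 2) = 0 := by
    rw [← hc 1]
    simp [h4, pderiv_X]
    ring
  have e2 : -4 * (v 1 ^ 5 + 5 * v 2 ^ 4 * v 0) = 0 := by
    rw [← hc 2]
    simp [h4, pderiv_X]
    ring
  have k0 : v 2 ^ 5 = -5 * (v 0 ^ 4 * v 1) := by linear_combination (-1 / 4 : ℂ) * e0
  have k1 : v 0 ^ 5 = -5 * (v 1 ^ 4 * v 2) := by linear_combination (-1 / 4 : ℂ) * e1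
  have k2 : v 1 ^ 5 = -5 * (v 2 ^ 4 * v 0) := by linear_combination (-1 / 4 : ℂ) * e2
  have k : (v 0 * v 1 * v 2) ^ 5 = 0 := by
    have : (v 0 * v 1 * v 2) ^ 5 = -125 * (v 0 * v 1 * v 2) ^ 5 := by
      calc _ = v 0 ^ 5 * v 1 ^ 5 * v 2 ^ 5 := by ring
        _ = _ := by rw [k0, k1, k2]; ring
    linear_combination (1 / 126 : ℂ) * this
  have h0 : v 0 = 0 ∧ v 1 = 0 ∧ v 2 = 0 := by
    rcases mul_eq_zero.mp (eq_zero_of_pow_eq_zero k) with h | h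
    · rcases mul_eq_zero.mp h with h | h <;> simp_all
    · simp_all
  refine hv0 (funext fun i => ?_)
  fin_cases i <;> simp [h0]

/-- The cubic `x t₁² + y t₂² + z² t₁ + x² t₂ + y³`. -/
def smoothSectionCubic : MvPolynomial (Fin 6) ℂ :=
  diagonalCubic ![0, X 0, X 1] ![0, X 2 ^ 2, X 0 ^ 2] (X 1 ^ 3)

theorem smoothSectionCubic_mem : smoothSectionCubic ∈ cubicsContainingPlane :=
  diagonalCubic_mem
    (fun i => by
      fin_cases i
      exacts [isHomogeneous_zero _ _ _, isHomogeneous_X _ _, isHomogeneous_X _ _])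
    (fun i => by
      fin_cases i
      exacts [isHomogeneous_zero _ _ _, isHomogeneous_X_sq _, isHomogeneous_X_sq _])
    ((isHomogeneous_X ℂ 1).pow 3)

theorem isSmoothSection_smoothSectionCubic :
    IsSmoothSection smoothSectionCubic coordinateHyperplane := by
  intro v hv0 _ hv3
  have hv3 : v 3 = 0 := by simpa [coordinateHyperplane] using hv3
  have hc : ∃ i ≠ 3, eval v (pderiv i smoothSectionCubic) ≠ 0 := by
    by_contra! e
    have e0 : v 4 ^ 2 + 2 * v 0 * v 5 = 0 := by
      rw [← e 0 (by decide)]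
      simp [smoothSectionCubic, diagonalCubic, lift, pderiv_X]
      ring
    have e1 : v 5 ^ 2 + 3 * v 1 ^ 2 = 0 := by
      rw [← e 1 (by decide)]
      simp [smoothSectionCubic, diagonalCubic, lift, pderiv_X]
    have e2 : 2 * v 2 * v 4 = 0 := by
      rw [← e 2 (by decide)]
      simp [smoothSectionCubic, diagonalCubic, lift, pderiv_X]
      ring
    have e4 : 2 * v 0 * v 4 + v 2 ^ 2 = 0 := by
      rw [← e 4 (by decide)]
      simp [smoothSectionCubic, diagonalCubic, lift, pderiv_X]
      ring
    have e5 : 2 * v 1 * v 5 + v 0 ^ 2 = 0 := by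
      rw [← e 5 (by decide)]
      simp [smoothSectionCubic, diagonalCubic, lift, pderiv_X]
      ring
    have h2 : v 2 = 0 := by
      by_contra h2
      have h4 : v 4 = 0 := by simpa [h2] using e2
      rw [h4, mul_zero, zero_add] at e4
      exact h2 (eq_zero_of_pow_eq_zero e4)
    have h4 : v 4 = 0 := by
      by_contra h4
      have h0 : v 0 = 0 := by simpa [h2, h4] using e4
      rw [h0, mul_zero, zero_mul, add_zero] at e0
      exact h4 (eq_zero_of_pow_eq_zero e0)
    have h0 : v 0 = 0 := by
      by_contra h0
      have h5 : v 5 = 0 := by simpa [h0, h4] using e0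
      rw [h5, mul_zero, zero_add] at e5
      exact h0 (eq_zero_of_pow_eq_zero e5)
    have h15 : v 1 = 0 ∧ v 5 = 0 := by
      rw [h0] at e5
      rcases (by simpa using e5 : v 1 = 0 ∨ v 5 = 0) with h | h <;> simp_all
    refine hv0 (funext fun i => ?_)
    fin_cases i <;> simp [h0, h2, h4, h15, hv3]
  obtain ⟨i, hi, hne⟩ := hc
  refine LinearIndependent.pair_iff.mpr fun s t hst => ?_
  have hs : s = 0 := by simpa [coordinateHyperplane, hi, hne] using congrFun hst i
  refine ⟨hs, ?_⟩
  simpa [coordinateHyperplane, hs] using congrFun hst 3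

theorem isSmoothHypersurface_quintic_smoothSectionCubic :
    IsSmoothHypersurface (quintic smoothSectionCubic coordinateHyperplane) := by
  intro v hv0 _
  by_contra! hc
  rw [smoothSectionCubic, quintic_diagonalCubic] at hc
  have h2 := fun i : Fin 3 => pderiv_ofNat i 2
  have h8 := fun i : Fin 3 => pderiv_ofNat i 8
  have e0 : -2 * (5 * v 0 ^ 4 - 4 * v 1 ^ 4) = 0 := by
    rw [← hc 0]
    simp [h2, h8, pderiv_X]
    ring
  have e1 : -2 * (v 2 ^ 4 - 16 * v 0 * v 1 ^ 3) = 0 := by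
    rw [← hc 1]
    simp [h2, h8, pderiv_X]
    ring
  have e2 : -8 * v 1 * v 2 ^ 3 = 0 := by
    rw [← hc 2]
    simp [h2, h8, pderiv_X]
    ring
  have h : v 0 = 0 ∧ v 1 = 0 ∧ v 2 = 0 := by
    rcases (by simpa using e2 : v 1 = 0 ∨ v 2 = 0) with h | h
    · simp_all
    · rcases (by simpa [h] using e1 : v 0 = 0 ∨ v 1 = 0) with h1 | h1 <;> simp_all
  refine hv0 (funext fun i => ?_)
  fin_cases i <;> simp [h]

/-- The conic `xy = z²`. -/
def conic : MvPolynomial (Fin 3) ℂ := X 0 * X 1 - X 2 ^ 2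

theorem isHomogeneous_conic : conic.IsHomogeneous 2 :=
  ((isHomogeneous_X ℂ 0).mul (isHomogeneous_X ℂ 1)).sub (isHomogeneous_X_sq 2)

/-- The cubic `z t₀² + x t₁² + y t₂² + q t₀ + (y² - q) t₁ + (x² - q) t₂`, with `q = xy - z²`. Its
sextic and its quintic for `t₀ = 0` are `f = 2 z g - 4 x y q²` and
`g = -2 x (x² - q)² - 2 y (y² - q)²`, so that they meet on `x = 0`, on `y = 0` or on `q = 0`. -/
def transversalCubic : MvPolynomial (Fin 6) ℂ :=
  diagonalCubic ![X 2, X 0, X 1] ![conic, X 1 ^ 2 - conic, X 0 ^ 2 - conic] 0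

theorem transversalCubic_mem : transversalCubic ∈ cubicsContainingPlane :=
  diagonalCubic_mem (fun i => by fin_cases i <;> exact isHomogeneous_X _ _)
    (fun i => by
      fin_cases i
      exacts [isHomogeneous_conic, (isHomogeneous_X_sq 1).sub isHomogeneous_conic,
        (isHomogeneous_X_sq 0).sub isHomogeneous_conic]) (isHomogeneous_zero _ _ _)

/-- The sextic and the quintic of `transversalCubic`, for `t₀ = 0`, meet with independent differentials
of `f` and of a coordinate of the pole: the last one on `q = 0`, and the middle ones on `x = 0` and on
`y = 0`. -/
theorem transversal_transversalCubic {v : Fin 3 → ℂ} (hf : eval v (sextic transversalCubic) = 0)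
    (hg : eval v (quintic transversalCubic coordinateHyperplane) = 0)
    (hm : ∀ j k, eval v ((gram transversalCubic).adjugate j j) *
        (eval v (pderiv (k + 1) (sextic transversalCubic)) *
            eval v (pderiv (k + 2) (pole transversalCubic coordinateHyperplane j)) -
          eval v (pderiv (k + 2) (sextic transversalCubic)) *
            eval v (pderiv (k + 1) (pole transversalCubic coordinateHyperplane j))) = 0) :
    v = 0 := by
  rw [transversalCubic] at hf hg hm
  simp_rw [sextic_diagonalCubic, adjugate_diagonalCubic, pole_diagonalCubic] at hm
  rw [sextic_diagonalCubic] at hf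
  rw [quintic_diagonalCubic] at hg
  set x := v 0 with hx
  set y := v 1 with hy
  set z := v 2 with hz
  set q := x * y - z ^ 2 with hq
  have p2 := fun i : Fin 3 => pderiv_ofNat i 2
  have p4 := fun i : Fin 3 => pderiv_ofNat i 4
  have hf : -4 * (q ^ 2 * x * y + (y ^ 2 - q) ^ 2 * z * y + (x ^ 2 - q) ^ 2 * z * x) = 0 := by
    rw [← hf]
    simp [conic, ← hx, ← hy, ← hz, ← hq]
    ring
  have hg : -2 * (x * (x ^ 2 - q) ^ 2 + y * (y ^ 2 - q) ^ 2) = 0 := by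
    rw [← hg]
    simp [conic, ← hx, ← hy, ← hz, ← hq]
    ring
  have h1 : x * y * q ^ 2 = 0 := by linear_combination (-1 / 4) * hf + z / 2 * hg
  obtain ⟨fx, hfx⟩ : ∃ e, e = -4 * (2 * q * y * (x * y) + q ^ 2 * y - 2 * (y ^ 2 - q) * y * (z * y) +
    2 * (x ^ 2 - q) * (2 * x - y) * (z * x) + (x ^ 2 - q) ^ 2 * z) := ⟨_, rfl⟩
  obtain ⟨fy, hfy⟩ : ∃ e, e = -4 * (2 * q * x * (x * y) + q ^ 2 * x - 2 * (x ^ 2 - q) * x * (z * x) +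
    2 * (y ^ 2 - q) * (2 * y - x) * (z * y) + (y ^ 2 - q) ^ 2 * z) := ⟨_, rfl⟩
  obtain ⟨fz, hfz⟩ : ∃ e, e = -4 * (-4 * q * z * (x * y) + 4 * (y ^ 2 - q) * z * (z * y) + (y ^ 2 - q) ^ 2 * y +
    4 * (x ^ 2 - q) * z * (z * x) + (x ^ 2 - q) ^ 2 * x) := ⟨_, rfl⟩
  -- The minors of the differentials of `f` and of one coordinate of the pole that suffice, each
  -- multiplied by the corresponding cofactor.
  have h31 : 8 * z * x * y * (fz * (-4 * (x * y * y + y * q)) - fx * (8 * x * y * z)) = 0 := by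
    refine Eq.trans (congrArg₂ (· * ·) ?_ (congrArg₂ (· - ·) (congrArg₂ (· * ·) ?_ ?_)
      (congrArg₂ (· * ·) ?_ ?_))) (hm 3 1) <;>
    simp [p4, conic, pderiv_X, ← hx, ← hy, ← hz, ← hq, hfx, hfz,
      -mul_eq_mul_left_iff, -mul_eq_mul_right_iff] <;>
    ring
  have h12 : (-2 * z * (x ^ 2 - q) ^ 2 - 2 * y * q ^ 2) * (fx * (2 * q * (y ^ 2 - q) +
      2 * y * (x * (y ^ 2 - q) + q * (2 * y - x))) -
        fy * (2 * y * (y * (y ^ 2 - q) - q * y))) = 0 := by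
    refine Eq.trans (congrArg₂ (· * ·) ?_ (congrArg₂ (· - ·) (congrArg₂ (· * ·) ?_ ?_)
      (congrArg₂ (· * ·) ?_ ?_))) (hm 1 2) <;>
    simp [p2, p4, conic, pderiv_X, ← hx, ← hy, ← hz, ← hq, hfx, hfy,
      -mul_eq_mul_left_iff, -mul_eq_mul_right_iff] <;>
    ring
  have h11 : (-2 * z * (x ^ 2 - q) ^ 2 - 2 * y * q ^ 2) * (fz * (2 * y * (y * (y ^ 2 - q) - q * y)) -
      fx * (2 * y * (-2 * z * (y ^ 2 - q) + q * (2 * z)))) = 0 := by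
    refine Eq.trans (congrArg₂ (· * ·) ?_ (congrArg₂ (· - ·) (congrArg₂ (· * ·) ?_ ?_)
      (congrArg₂ (· * ·) ?_ ?_))) (hm 1 1) <;>
    simp [p2, p4, conic, pderiv_X, ← hx, ← hy, ← hz, ← hq, hfx, hfz,
      -mul_eq_mul_left_iff, -mul_eq_mul_right_iff] <;>
    ring
  have h20 : (-2 * z * (y ^ 2 - q) ^ 2 - 2 * x * q ^ 2) * (fy * (2 * x * (-2 * z * (x ^ 2 - q) +
      q * (2 * z))) - fz * (2 * x * (x * (x ^ 2 - q) - q * x))) = 0 := by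
    refine Eq.trans (congrArg₂ (· * ·) ?_ (congrArg₂ (· - ·) (congrArg₂ (· * ·) ?_ ?_)
      (congrArg₂ (· * ·) ?_ ?_))) (hm 2 0) <;>
    simp [p2, p4, conic, pderiv_X, ← hx, ← hy, ← hz, ← hq, hfy, hfz,
      -mul_eq_mul_left_iff, -mul_eq_mul_right_iff] <;>
    ring
  clear hm p2 p4
  clear_value q x y z
  suffices h : x = 0 ∧ y = 0 ∧ z = 0 by
    ext i
    fin_cases i
    exacts [hx ▸ h.1, hy ▸ h.2.1, hz ▸ h.2.2]
  clear hx hy hz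
  by_cases h0 : x = 0
  · have hq' : q = -z ^ 2 := by rw [hq, h0]; ring
    by_cases h2 : y = 0
    · have hfx' : fx = -4 * z ^ 5 := by rw [hfx, h0, h2, hq']; ring
      have hfy' : fy = -4 * z ^ 5 := by rw [hfy, h0, h2, hq']; ring
      rw [hfx', hfy', h0, h2, hq'] at h12
      have h3 : z ^ 14 = 0 := by linear_combination (-1 / 16) * h12
      exact ⟨h0, h2, eq_zero_of_pow_eq_zero h3⟩
    · exfalso
      have hb : y ^ 2 - q = 0 := by
        rw [h0] at hg
        simpa [h2] using hg
      have hfx' : fx = -4 * z ^ 4 * (y + z) := by rw [hfx, hb, h0, hq']; ring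
      have hfz' : fz = 0 := by rw [hfz, hb, h0]; ring
      rw [hfx', hfz', hb, h0, hq'] at h11
      have h3 : y * z ^ 11 * (y + z) ^ 2 = 0 := by linear_combination (1 / 32) * h11
      rw [hq'] at hb
      have hz0 : z ≠ 0 := fun hz0 => h2 (by simpa [hz0] using hb)
      have h4 : y = -z := eq_neg_of_add_eq_zero_left (by simpa [h2, hz0] using h3)
      rw [h4] at hb
      exact hz0 (eq_zero_of_pow_eq_zero (by linear_combination hb / 2 : z ^ 2 = 0))
  · exfalso
    by_cases h2 : y = 0
    · have hq' : q = -z ^ 2 := by rw [hq, h2]; ring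
      have hb : x ^ 2 - q = 0 := by
        rw [h2] at hg
        simpa [h0] using hg
      have hfy' : fy = -4 * z ^ 4 * (x + z) := by rw [hfy, hb, h2, hq']; ring
      have hfz' : fz = 0 := by rw [hfz, hb, h2]; ring
      rw [hfy', hfz', hb, h2, hq'] at h20
      have h3 : x * z ^ 11 * (x + z) ^ 2 = 0 := by linear_combination (-1 / 32) * h20
      rw [hq'] at hb
      have hz0 : z ≠ 0 := fun hz0 => h0 (by simpa [hz0] using hb)
      have h4 : x = -z := eq_neg_of_add_eq_zero_left (by simpa [h0, hz0] using h3)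
      rw [h4] at hb
      exact hz0 (eq_zero_of_pow_eq_zero (by linear_combination hb / 2 : z ^ 2 = 0))
    · have hq' : q = 0 := by simpa [h0, h2] using h1
      rw [hq'] at hq hg hfx hfz h31
      have h5 : x ^ 5 + y ^ 5 = 0 := by linear_combination (-1 / 2) * hg
      have hz0 : z ≠ 0 := fun hz0 => mul_ne_zero h0 h2 (by rw [hz0] at hq; linear_combination -hq)
      rw [hfx, hfz] at h31
      have h3 : x ^ 6 * y ^ 2 * z ^ 3 = 0 := by
        linear_combination (1 / 1280) * h31 - 1 / 10 * z * x ^ 2 * y ^ 3 * h5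
      simp [h0, h2, hz0] at h3

/-! ### A general hyperplane section of a general cubic containing the plane -/

theorem isGeneric_isSmoothPair_and_mem_goodHyperplanes :
    IsGeneric fun t => IsSmoothPair t.1.1 ∧ t.2 ∈ goodHyperplanes t.1.1 := by
  have h1 := isGeneric_isSmoothHypersurface cubic_mem_polynomialFamilies (fun t => t.1.2.1)
    (⟨smoothCubic, smoothCubic_mem⟩, 0) isSmoothHypersurface_smoothCubic
  have h2 := isGeneric_isSmoothHypersurface sextic_mem_polynomialFamilies
    (fun t => isHomogeneous_sextic t.1.2.1) (⟨smoothCubic, smoothCubic_mem⟩, 0)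
    isSmoothHypersurface_sextic_smoothCubic
  have h3 := isGeneric_isSmoothSection
    (⟨smoothSectionCubic, smoothSectionCubic_mem⟩, coordinateHyperplane)
    isSmoothSection_smoothSectionCubic
  have h4 := isGeneric_isSmoothHypersurface quintic_mem_polynomialFamilies
    (fun t => isHomogeneous_quintic t.1.2.1 t.2)
    (⟨smoothSectionCubic, smoothSectionCubic_mem⟩, coordinateHyperplane)
    isSmoothHypersurface_quintic_smoothSectionCubic
  have h5 := isGeneric_intersectionMultiplicity_le_two
    (⟨transversalCubic, transversalCubic_mem⟩, coordinateHyperplane)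
    fun v hf hg hm => transversal_transversalCubic hf hg hm
  refine ((h1.and h2).and ((h3.and h4).and h5)).mono ?_
  rintro t ⟨h12, ⟨h3, h4⟩, h5⟩
  refine ⟨h12, ?_, h3, h4, h5⟩
  intro h0
  refine ne_zero_of_isSmoothHypersurface h4 ?_
  have : normal t.2 = 0 := by
    rw [h0]
    ext1 i
    fin_cases i <;> simp [normal]
  rw [quintic, this, zero_dotProduct]

/-- A generic condition on pairs holds, for a general cubic, on a nonempty open set of hyperplanes. -/
theorem IsGeneric.exists_open {Q : SectionPair → Prop} (hQ : IsGeneric Q) :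
    ∃ Φ : MvPolynomial (Fin 6 →₀ ℕ) ℂ,
      (∃ F ∈ cubicsContainingPlane, eval (fun m => F.coeff m) Φ ≠ 0) ∧
      ∀ F (hF : F ∈ cubicsContainingPlane), eval (fun m => F.coeff m) Φ ≠ 0 →
        ∃ Ψ : MvPolynomial (Fin 6) ℂ, Ψ ≠ 0 ∧
          ∀ h : Fin 6 → ℂ, eval h Ψ ≠ 0 → Q (⟨F, hF⟩, h) := by
  obtain ⟨E, ⟨t, ht⟩, hE⟩ := hQ
  have h1 : ∀ (F : cubicsContainingPlane) (h : Fin 6 → ℂ), eval (fun m => F.1.coeff m)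
      (aeval (Sum.elim X fun i => C (h i)) E) = eval (SectionPair.coords (F, h)) E := by
    intro F h
    rw [← coe_aeval_eq_eval, ← coe_aeval_eq_eval, RingHom.coe_coe, RingHom.coe_coe,
      ← AlgHom.comp_apply]
    congr 1
    ext i
    rcases i with i | i <;> simp [SectionPair.coords]
  have h2 : ∀ (F : cubicsContainingPlane) (h : Fin 6 → ℂ), eval h
      (aeval (Sum.elim (fun m => C (F.1.coeff m)) X) E) = eval (SectionPair.coords (F, h)) E := by
    intro F h
    rw [← coe_aeval_eq_eval, ← coe_aeval_eq_eval, RingHom.coe_coe, RingHom.coe_coe,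
      ← AlgHom.comp_apply]
    congr 1
    ext i
    rcases i with i | i <;> simp [SectionPair.coords]
  refine ⟨aeval (Sum.elim X fun i => C (t.2 i)) E, ⟨t.1.1, t.1.2, ?_⟩, fun F hF hΦ =>
    ⟨aeval (Sum.elim (fun m => C (F.coeff m)) X) E, fun h0 => ?_, fun h hh => hE _ ?_⟩⟩
  · rwa [h1]
  · rw [h1 ⟨F, hF⟩, ← h2, h0, map_zero] at hΦ
    exact hΦ rfl
  · rwa [h2 ⟨F, hF⟩] at hh

end PlaneCubic

end

theorem mainTheorem6 :
    -- for a general cubic containing the plane, a general hyperplane belongs to `U`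
    (∃ Φ : MvPolynomial (Fin 6 →₀ ℕ) ℂ,
      (∃ F ∈ PlaneCubic.cubicsContainingPlane, eval (fun m => F.coeff m) Φ ≠ 0) ∧
      ∀ F ∈ PlaneCubic.cubicsContainingPlane, eval (fun m => F.coeff m) Φ ≠ 0 →
        PlaneCubic.IsSmoothPair F ∧
        ∃ Ψ : MvPolynomial (Fin 6) ℂ, Ψ ≠ 0 ∧
          ∀ h : Fin 6 → ℂ, eval h Ψ ≠ 0 → h ∈ PlaneCubic.goodHyperplanes F) ∧
    ∀ F ∈ PlaneCubic.cubicsContainingPlane, PlaneCubic.IsSmoothPair F →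
      ∀ h ∈ PlaneCubic.goodHyperplanes F,
        -- `D₆` and `D_H` meet with multiplicity exactly two
        (∀ (v : Fin 3 → ℂ) (i : Fin 3), v i ≠ 0 →
          eval v (PlaneCubic.sextic F) = 0 → eval v (PlaneCubic.quintic F h) = 0 →
          PlaneCubic.intersectionMultiplicity
            (PlaneCubic.sextic F) (PlaneCubic.quintic F h) i v = 2) ∧
        -- the image of `C_H` in `S` is a 15-nodal curve
        PlaneCubic.IsNodalCurve (PlaneCubic.doublePlane F) (PlaneCubic.imageCurve F h) 15 ∧
        -- its nodes lie over the points of `D₆ ∩ D_H`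
        ∀ p : PlaneCubic.TotRep,
          ⟦p⟧ ∈ PlaneCubic.singularPoints (PlaneCubic.doublePlane F) (PlaneCubic.imageCurve F h) →
          eval (PlaneCubic.base p) (PlaneCubic.sextic F) = 0 ∧
          eval (PlaneCubic.base p) (PlaneCubic.quintic F h) = 0 := by
  obtain ⟨Φ, ⟨F, hF, hΦ⟩, h⟩ := PlaneCubic.isGeneric_isSmoothPair_and_mem_goodHyperplanes.exists_open
  refine ⟨⟨Φ, ⟨F, hF, hΦ⟩, fun F hF hΦ => ?_⟩, fun F hF hs h hh =>
    ⟨fun v i hi hfv hgv => PlaneCubic.intersectionMultiplicity_eq_two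
      (PlaneCubic.isLocallySquare_quintic hF.1 hs.2 h) hh.2.2.2 hi hfv hgv,
      PlaneCubic.isNodalCurve_imageCurve hF hs hh,
      fun p hp => PlaneCubic.eval_eq_zero_of_mem_singularPoints hF hs hh p hp⟩⟩
  obtain ⟨Ψ, hΨ, hQ⟩ := h F hF hΦ
  -- The polynomial `Ψ` does not vanish identically on `ℂ⁶`, so there is a hyperplane to read off the
  -- smoothness of `X` and `D₆` from.
  obtain ⟨k, hk⟩ : ∃ k : Fin 6 → ℂ, eval k Ψ ≠ 0 := by
    by_contra! hc
    exact hΨ (MvPolynomial.funext fun k => by rw [hc, map_zero])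
  exact ⟨(hQ k hk).1, Ψ, hΨ, fun k hk => (hQ k hk).2⟩
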